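/- Let $F$ be a totally real number field of degree $g$ with ring of integers $\mathcal O_F$, let $I$ be the set of embeddings $F\hookrightarrow\mathbb R$, and fix a numbering $I=\{\tau_1,\dots,\tau_g\}$. Let $\mathcal O_{F+}$ be the set of totally positive integers, $\Delta=\mathcal O_{F+}^\times$ the group of totally positive units, and $A\subset\mathcal O_{F+}$ the set of primitive elements, i.e. those $\alpha$ with $\alpha/N\notin\mathcal O_{F+}$ for every integer $N>1$. Let $\xi\colon\mathcal O_F\to\mathbb C^\times$ be a nontrivial additive character of finite order (a nontrivial torsion point of $\mathbb T=\mathrm{Hom}_{\mathbb Z}(\mathcal O_F,\mathbb G_m)$), $\mathbb Q(\xi)$ the field generated by its values, $\Delta_\xi=\{\varepsilon\in\Delta\mid \xi(\varepsilon\alpha)=\xi(\alpha)\ \forall\alpha\in\mathcal O_F\}$, and $A_\xi=\{\alpha\in A\mid\xi(\alpha)\ne1\}$. Regard $\xi=\operatorname{Spec}\mathbb Q(\xi)$ as a scheme with trivial $\Delta_\xi$-action, and let $H^m(\xi/\Delta_\xi,-)$ be the right derived functors of $\mathcal F\mapsto\Gamma(\xi,\mathcal F)^{\Delta_\xi}$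 on $\Delta_\xi$-equivariant $\mathcal O_\xi$-modules. For $q\ge0$ let $C^q=\bigl(\prod^{\mathrm{alt}}_{A_\xi^{q+1}}\mathbb Q(\xi)\bigr)^{\Delta_\xi}$ be the space of functions $\eta\colon A_\xi^{q+1}\to\mathbb Q(\xi)$ that are alternating ($\eta_{\rho(\boldsymbol\alpha)}=\operatorname{sgn}(\rho)\eta_{\boldsymbol\alpha}$ for permutations $\rho$, and $\eta_{\boldsymbol\alpha}=0$ if $\boldsymbol\alpha$ has a repeated entry) and satisfy $\eta_{\varepsilon\boldsymbol\alpha}=\eta_{\boldsymbol\alpha}$ for $\varepsilon\in\Delta_\xi$, with the differential $(d\eta)_{\alpha_0\cdots\alpha_{q+1}}=\sum_j(-1)^j\eta_{\alpha_0\cdots\check\alpha_j\cdots\alpha_{q+1}}$. The corresponding alternating Čech resolution of $\mathcal O_\xi$ by equivariant sheaves induces a canonical isomorphism $H^{g-1}(C^\bullet)\cong H^{g-1}(\xi/\Delta_\xi,\mathcal O_\xi)$, through which cocycles in $C^{g-1}$ represent classes. For $\alpha_1,\dots,\alpha_m\in\mathcal O_{F+}$ let $\sigma_{\boldsymbol\alpha}\subset\mathbb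 R^I$ be the closed cone generated by the images of the $\alpha_i$. A cone is simplicial if it has an $\mathbb R$-linearly independent generating tuple in $\mathcal O_{F+}$; its faces are the cones generated by the subsets of such a tuple. Let $\Gamma$ be a group with $\Delta_\xi\subseteq\Gamma\subseteq\Delta$, and let $\Phi$ be a Shintani decomposition for $\Gamma$: a set of simplicial cones, closed under taking faces, any two of which intersect in a common face, such that $\mathbb R_{+}^I\cup\{0\}$ is the disjoint union of the relative interiors of the $\sigma\in\Phi$, such that $\varepsilon\sigma\in\Phi$ for $\sigma\in\Phi$, $\varepsilon\in\Gamma$, and such that $\Gamma\backslash\Phi$ is finite. Assume that every $\sigma\in\Phi$ of dimension $d$ is of the form $\sigma_{\boldsymbol\alpha}$ with $\boldsymbol\alpha\in A_\xi^d$. Let $\Phi_g$ be the set of $g$-dimensional cones of $\Phi$, and for a cocycle $\eta\in C^{g-1}$ and $\sigma=\sigma_{\boldsymbol\alpha}\in\Phi_g$ with $\boldsymbol\alpha\in A_\xi^g$ put $\eta_\sigma=\operatorname{sgn}(\boldsymbol\alpha)\,\eta_{\boldsymbol\alpha}$, where $\operatorname{sgn}(\boldsymbol\alpha)$ is the sign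 of $\det(\tau_i(\alpha_j))_{i,j}$. Then $\Delta_\xi\backslash\Phi_g$ is finite, $\sum_{\bar\sigma\in\Delta_\xi\backslash\Phi_g}\eta_\sigma$ does not depend on the choice of representatives $\sigma$ and of generators $\boldsymbol\alpha$, and there is a unique $\mathbb Q(\xi)$-linear map $$H^{g-1}(\xi/\Delta_\xi,\mathcal O_\xi)\longrightarrow\mathbb Q(\xi)$$ sending the class of every cocycle $\eta$ to $\sum_{\bar\sigma\in\Delta_\xi\backslash\Phi_g}\eta_\sigma$. This map is an isomorphism, and it is canonical: it is the same for all $\Gamma$ and $\Phi$ as above. -/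

import Mathlib

open CategoryTheory AlgebraicGeometry

namespace ShintaniEcc
noncomputable section

section AlternatingCochains

variable (K : Type) [Field K] (G : Type) [Group G] (S : Type) [MulAction G S]

/-- Alternating functions on `S^(q+1)` with values in `K`: the sign rule under permutations, and
vanishing on tuples with a repeated entry. -/
def altCochains (q : ℕ) : Submodule K ((Fin (q + 1) → S) → K) where
  carrier := {f | (∀ (ρ : Equiv.Perm (Fin (q + 1))) (a : Fin (q + 1) → S),
      f (a ∘ ρ) = ((Equiv.Perm.sign ρ : ℤ) : K) * f a) ∧
    ∀ a : Fin (q + 1) → S, ¬ Function.Injective a → f a = 0}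
  zero_mem' := by simp
  add_mem' {f h} hf hh :=
    ⟨fun ρ a => by simp [hf.1 ρ a, hh.1 ρ a, mul_add],
      fun a ha => by simp [hf.2 a ha, hh.2 a ha]⟩
  smul_mem' c f hf :=
    ⟨fun ρ a => by simp [hf.1 ρ a, mul_left_comm], fun a ha => by simp [hf.2 a ha]⟩

variable {K S} in
def altDiff {q : ℕ} (f : (Fin (q + 1) → S) → K) (a : Fin (q + 2) → S) : K :=
  ∑ j : Fin (q + 2), (-1) ^ (j : ℕ) * f (a ∘ j.succAbove)

lemma exists_perm_succAbove {n : ℕ} (ρ : Equiv.Perm (Fin (n + 1))) (j : Fin (n + 1)) :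
    ∃ ρ' : Equiv.Perm (Fin n), (∀ k, ρ (j.succAbove k) = (ρ j).succAbove (ρ' k)) ∧
      (Equiv.Perm.sign ρ' : ℤ) * (-1) ^ (j : ℕ) = (Equiv.Perm.sign ρ : ℤ) * (-1) ^ (ρ j : ℕ) := by
  set π : Equiv.Perm (Fin (n + 1)) := (ρ j).cycleRange * ρ * j.cycleRange⁻¹ with hπ
  have hρ : ρ = (ρ j).cycleRange⁻¹ * π * j.cycleRange := by simp [hπ, mul_assoc]
  have h0 : π 0 = 0 := by simp [hπ, Equiv.Perm.inv_def]
  obtain ⟨⟨p, ρ'⟩, h⟩ : ∃ x, Equiv.Perm.decomposeFin.symm x = π :=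
    Equiv.Perm.decomposeFin.symm.surjective π
  have hp : p = 0 := by
    have := congrArg (fun e : Equiv.Perm (Fin (n + 1)) => e 0) h
    simpa [h0] using this
  subst hp
  have hsucc : ∀ k : Fin n, π k.succ = (ρ' k).succ := fun k => by
    rw [← h]; simp
  refine ⟨ρ', fun k => ?_, ?_⟩
  · have : ρ (j.succAbove k) = (ρ j).cycleRange.symm (π (j.cycleRange (j.succAbove k))) := by
      simp [hπ, Equiv.Perm.inv_def]
    rw [this, Fin.cycleRange_succAbove, hsucc, Fin.cycleRange_symm_succ]
  · have hs : Equiv.Perm.sign π = Equiv.Perm.sign ρ' := by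
      rw [← h]; simp
    have : Equiv.Perm.sign ρ' = (-1) ^ (ρ j : ℕ) * Equiv.Perm.sign ρ * (-1) ^ (j : ℕ) := by
      rw [← hs, hπ]; simp [Fin.sign_cycleRange]
    rw [this]
    push_cast
    have h1 : ((-1 : ℤ) ^ (j : ℕ)) * (-1) ^ (j : ℕ) = 1 := by
      rw [← mul_pow]; simp
    linear_combination ((-1 : ℤ) ^ (ρ j : ℕ) * (Equiv.Perm.sign ρ : ℤ)) * h1

lemma altDiff_altDiff {q : ℕ} (f : (Fin (q + 1) → S) → K) : altDiff (altDiff f) = 0 := by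
  funext a
  simp only [altDiff, Finset.mul_sum, Pi.zero_apply]
  rw [← Finset.sum_product']
  refine Finset.sum_involution (fun p _ => (p.1.succAbove p.2, p.2.predAbove p.1))
    ?_ ?_ (fun _ _ => Finset.mem_univ _) ?_
  · rintro ⟨i, j⟩ -
    have e : (a ∘ (i.succAbove j).succAbove) ∘ (j.predAbove i).succAbove =
        (a ∘ i.succAbove) ∘ j.succAbove := by
      funext k
      simp [Fin.succAbove_succAbove_succAbove_predAbove]
    have h := Fin.neg_one_pow_succAbove_add_predAbove (R := K) i j
    simp only [e]
    rw [← mul_assoc, ← mul_assoc, ← pow_add, ← pow_add, h]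
    ring
  · rintro ⟨i, j⟩ - - h
    exact Fin.succAbove_ne i j (congrArg Prod.fst h)
  · rintro ⟨i, j⟩ -
    simp [Fin.succAbove_succAbove_predAbove, Fin.predAbove_predAbove_succAbove]

variable {S} in
/-- `(u f)(a) = f (u⁻¹ a)`. -/
def cochainAction (q : ℕ) : Representation K G (altCochains K S q) where
  toFun u :=
    { toFun := fun f => ⟨fun a => f.1 (u⁻¹ • a),
        fun ρ a => f.2.1 ρ (u⁻¹ • a),
        fun a ha => f.2.2 _ fun h => ha fun i j hij => h (by simp [hij])⟩
      map_add' := fun _ _ => rfl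
      map_smul' := fun _ _ => rfl }
  map_one' := by ext f a; simp
  map_mul' u v := by ext f a; simp [mul_smul]

/-- The module of global sections of the sheaf of alternating Čech `q`-cochains, with its `G`-action. -/
def cechObj (q : ℕ) : Action (ModuleCat K) G where
  V := ModuleCat.of K (altCochains K S q)
  ρ := (ModuleCat.endRingEquiv _).symm.toMonoidHom.comp (cochainAction K G q)

variable [CharZero K]

lemma altDiff_mem {q : ℕ} {f : (Fin (q + 1) → S) → K} (hf : f ∈ altCochains K S q) :
    altDiff f ∈ altCochains K S (q + 1) := by
  have key : ∀ (ρ : Equiv.Perm (Fin (q + 2))) (a : Fin (q + 2) → S),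
      altDiff f (a ∘ ρ) = ((Equiv.Perm.sign ρ : ℤ) : K) * altDiff f a := by
    intro ρ a
    rw [altDiff, altDiff, Finset.mul_sum, ← Equiv.sum_comp ρ (fun j : Fin (q + 2) =>
      ((Equiv.Perm.sign ρ : ℤ) : K) * ((-1) ^ (j : ℕ) * f (a ∘ j.succAbove)))]
    refine Finset.sum_congr rfl fun j _ => ?_
    obtain ⟨ρ', h1, h2⟩ := exists_perm_succAbove ρ j
    have e : (a ∘ ρ) ∘ j.succAbove = (a ∘ (ρ j).succAbove) ∘ ρ' := by
      funext k; simp [h1]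
    rw [e, hf.1]
    have h3 : ((Equiv.Perm.sign ρ' : ℤ) : K) * (-1) ^ (j : ℕ) =
        ((Equiv.Perm.sign ρ : ℤ) : K) * (-1) ^ (ρ j : ℕ) := by exact_mod_cast congrArg (Int.cast (R := K)) h2
    linear_combination (f (a ∘ (ρ j).succAbove)) * h3
  refine ⟨key, fun a ha => ?_⟩
  simp only [Function.Injective, not_forall] at ha
  obtain ⟨i, j, hij, hne⟩ := ha
  have h := key (Equiv.swap i j) a
  have e : a ∘ Equiv.swap i j = a := by
    funext k
    simp only [Function.comp, Equiv.swap_apply_def]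
    split_ifs with h1 h2 <;> simp_all
  rw [e, Equiv.Perm.sign_swap hne] at h
  have h2 : (2 : K) * altDiff f a = 0 := by push_cast at h; linear_combination h
  simpa using h2

def cechDiff (q : ℕ) : cechObj K G S q ⟶ cechObj K G S (q + 1) where
  hom := ModuleCat.ofHom
    { toFun := fun f => ⟨altDiff f.1, altDiff_mem K S f.2⟩
      map_add' := fun f h => by
        ext a
        simp [altDiff, mul_add, Finset.sum_add_distrib]
      map_smul' := fun c f => by
        ext a
        simp [altDiff, Finset.mul_sum, mul_left_comm] }
  comm u := rfl

def cechComplex : CochainComplex (Action (ModuleCat K) G) ℕ :=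
  CochainComplex.of (cechObj K G S) (cechDiff K G S) fun q => by
    apply Action.hom_ext
    ext f
    exact Subtype.ext (altDiff_altDiff K S f.1)

end AlternatingCochains

section EquivariantCohomology

variable (K : Type) [Field K] (G : Type) [Group G]

/-- `M ↦ M^G`. -/
def invariants : Action (ModuleCat K) G ⥤ ModuleCat K where
  obj M := ModuleCat.of K
    ({ carrier := {x : M.V | ∀ u : G, (M.ρ u).hom x = x}
       zero_mem' := fun u => map_zero _
       add_mem' := fun hx hy u => by rw [map_add, hx u, hy u]
       smul_mem' := fun c x hx u => by rw [map_smul, hx u] } : Submodule K M.V)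
  map {M N} f := ModuleCat.ofHom (f.hom.hom.restrict fun x hx u => by
    have h := congrArg (fun φ => φ.hom x) (f.comm u)
    simp only [ModuleCat.hom_comp, LinearMap.comp_apply] at h
    rw [← h, hx u])

instance : (invariants K G).Additive where

/-- `G`-equivariant `𝒪`-modules on `Spec K` for the trivial action of `G`. Every `[u]` is the identity,
so an equivariant structure is a homomorphism `u ↦ ι_u` from `G` to the automorphisms of the
`𝒪`-module. -/
abbrev EquivariantModules : Type 1 := Action (Spec (.of K)).Modules G

/-- The structure sheaf with its natural (trivial) equivariant structure. -/
abbrev structureSheaf : EquivariantModules K G where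
  V := SheafOfModules.unit (Spec (.of K)).ringCatSheaf
  ρ := 1

lemma additive_Γ (R : CommRingCat.{0}) : (moduleSpecΓFunctor (R := R)).Additive :=
  (tilde.adjunction (R := R)).right_adjoint_additive

instance : (moduleSpecΓFunctor (R := .of K)).Additive := additive_Γ _

/-- `Γ(Spec K / G, M) = Γ(Spec K, M)^G`. -/
def equivariantSections : EquivariantModules K G ⥤ ModuleCat K :=
  (moduleSpecΓFunctor (R := .of K)).mapAction G ⋙ invariants K G

instance : (equivariantSections K G).Additive := by
  unfold equivariantSections; infer_instance

lemma isIso_unit_tilde (R : CommRingCat.{0}) : IsIso (tilde.adjunction (R := R)).unit := inferInstance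

lemma isLocalizing_of_field (M : (Spec (.of K)).Modules) :
    IsLocalizing (modulesSpecToSheaf.obj M) := by
  intro f
  by_cases hf : f = 0
  · subst hf
    have hbot : PrimeSpectrum.basicOpen (0 : K) = ⊥ := PrimeSpectrum.basicOpen_zero
    have hsub : Subsingleton ((modulesSpecToSheaf.obj M).obj.obj
        (.op (PrimeSpectrum.basicOpen (0 : K)))) := by
      refine ⟨fun x y => TopCat.Presheaf.IsSheaf.section_ext (modulesSpecToSheaf.obj M).2 ?_⟩
      intro p hp
      have hp' : p ∈ PrimeSpectrum.basicOpen (0 : K) := hp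
      rw [hbot] at hp'
      exact hp'.elim
    refine ⟨fun x => ?_, fun y => ⟨(0, 1), hsub.elim _ _⟩,
      fun {x y} _ => ⟨⟨0, 1, by simp⟩, ?_⟩⟩
    · rw [Module.End.isUnit_iff]
      exact ⟨fun a b _ => hsub.elim a b, fun b => ⟨b, hsub.elim _ _⟩⟩
    · simp [Submonoid.smul_def]
  · have htop : PrimeSpectrum.basicOpen f = ⊤ := by
      ext p
      simpa using fun h => p.2.ne_top (Ideal.eq_top_of_isUnit_mem _ h (IsUnit.mk0 f hf))
    have hgen : ∀ U : (Spec (.of K)).Opens, U = ⊤ →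
        IsIso ((modulesSpecToSheaf.obj M).obj.map U.leTop.op) := by
      rintro _ rfl
      exact inferInstanceAs (IsIso ((modulesSpecToSheaf.obj M).obj.map (𝟙 _)))
    have hiso := hgen _ htop
    have hbij : Function.Bijective ((modulesSpecToSheaf.obj M).obj.map
        (TopologicalSpace.Opens.leTop (X := Spec (.of K)) (PrimeSpectrum.basicOpen f)).op).hom :=
      (ConcreteCategory.isIso_iff_bijective _).1 hiso
    have hu : ∀ x : Submonoid.powers f, IsUnit (x : K) := by
      rintro ⟨_, n, rfl⟩
      exact (IsUnit.mk0 f hf).pow n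
    refine ⟨fun x => (hu x).map _, fun y => ?_, fun {x y} h => ⟨1, ?_⟩⟩
    · obtain ⟨m, hm⟩ := hbij.2 y
      exact ⟨(m, 1), by simp [hm]⟩
    · rw [hbij.1 h]

instance : (moduleSpecΓFunctor (R := .of K)).IsEquivalence := by
  have : ∀ M : (Spec (.of K)).Modules, IsIso ((tilde.adjunction (R := .of K)).counit.app M) :=
    fun M => (isIso_fromTildeΓ_iff_isLocalizing M).2 (isLocalizing_of_field K M)
  have : IsIso (tilde.adjunction (R := .of K)).unit := isIso_unit_tilde _
  have : IsIso (tilde.adjunction (R := .of K)).counit := NatIso.isIso_of_isIso_app _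
  exact (tilde.adjunction (R := .of K)).toEquivalence.isEquivalence_inverse

instance : EnoughInjectives (EquivariantModules K G) := by
  have : ((moduleSpecΓFunctor (R := .of K)).mapAction G).IsEquivalence :=
    ((moduleSpecΓFunctor (R := .of K)).asEquivalence.mapAction G).isEquivalence_functor
  exact EnoughInjectives.of_equivalence ((moduleSpecΓFunctor (R := .of K)).mapAction G ⋙
    Rep.ActionToRep K G ⋙ Rep.equivalenceModuleMonoidAlgebra.functor)

/-- `H^m(Spec K / G, M)`: the `m`-th right derived functor of `M ↦ Γ(Spec K, M)^G` on equivariant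
`𝒪`-modules. -/
def equivariantCohomology (m : ℕ) (M : EquivariantModules K G) : ModuleCat K :=
  ((equivariantSections K G).rightDerived m).obj M


lemma additive_tilde (R : CommRingCat.{0}) : (tilde.functor R).Additive := inferInstance

instance : (tilde.functor (.of K)).Additive := additive_tilde _

/-- The equivariant sheaf on `Spec K` with a given module (with `G`-action) of global sections. -/
abbrev associatedSheaf : Action (ModuleCat K) G ⥤ EquivariantModules K G :=
  (tilde.functor (.of K)).mapAction G

/-- The canonical map `M^G → Γ(Spec K, M~)^G`. -/
def sectionsOfAssociated : invariants K G ⟶ associatedSheaf K G ⋙ equivariantSections K G where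
  app M := (invariants K G).map
    ({ hom := (tilde.toTildeΓNatIso (R := .of K)).hom.app M.V
       comm := fun u => (tilde.toTildeΓNatIso (R := .of K)).hom.naturality (M.ρ u) } :
      M ⟶ ((moduleSpecΓFunctor (R := .of K)).mapAction G).obj ((associatedSheaf K G).obj M))
  naturality M N f := by
    dsimp only [Functor.comp_map, equivariantSections]
    rw [← Functor.map_comp, ← Functor.map_comp]
    congr 1
    apply Action.hom_ext
    exact (tilde.toTildeΓNatIso (R := .of K)).hom.naturality f.hom

/-- `K` with trivial action. -/
def trivialModule : Action (ModuleCat K) G where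
  V := ModuleCat.of K K
  ρ := 1

/-- The canonical identification of `𝒪` with `K~`. -/
def structureSheafToAssociated :
    structureSheaf K G ⟶ (associatedSheaf K G).obj (trivialModule K G) where
  hom := (tildeSelf (R := .of K)).inv
  comm u := by
    have h : ((associatedSheaf K G).obj (trivialModule K G)).ρ u = 𝟙 _ :=
      (tilde.functor (.of K)).map_id _
    have h' : (tildeSelf (R := .of K)).inv ≫
        ((associatedSheaf K G).obj (trivialModule K G)).ρ u = (tildeSelf (R := .of K)).inv :=
      (congrArg (fun x => (tildeSelf (R := .of K)).inv ≫ x) h).trans (Category.comp_id _)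
    exact (Category.id_comp _).trans h'.symm

variable [CharZero K] (S : Type) [MulAction G S]

/-- The complex of equivariant sheaves of alternating Čech cochains. -/
def cechSheafComplex : CochainComplex (EquivariantModules K G) ℕ :=
  ((associatedSheaf K G).mapHomologicalComplex _).obj (cechComplex K G S)

/-- Constants as `0`-cochains. -/
def cechUnit : trivialModule K G ⟶ cechObj K G S 0 where
  hom := ModuleCat.ofHom
    { toFun := fun c => ⟨fun _ => c, fun ρ a => by
        have : Subsingleton (Equiv.Perm (Fin (0 + 1))) :=
          inferInstanceAs (Subsingleton (Equiv.Perm (Fin 1)))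
        simp [Subsingleton.elim ρ 1],
        fun a ha => (ha fun i j _ => Subsingleton.elim (α := Fin 1) i j).elim⟩
      map_add' := fun _ _ => rfl
      map_smul' := fun _ _ => rfl }
  comm u := rfl

/-- The inclusion `𝒪 → 𝒞^0`. -/
def cechAugmentation : structureSheaf K G ⟶ (cechSheafComplex K G S).X 0 :=
  structureSheafToAssociated K G ≫ (associatedSheaf K G).map (cechUnit K G S)

/-- The complex of `G`-invariant alternating Čech cochains. -/
def cechSections : CochainComplex (ModuleCat K) ℕ :=
  ((invariants K G).mapHomologicalComplex _).obj (cechComplex K G S)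

/-- The identification of invariant cochains with invariant global sections of the sheaves `𝒞^q`. -/
def cechSectionsMap : cechSections K G S ⟶
    ((equivariantSections K G).mapHomologicalComplex _).obj (cechSheafComplex K G S) where
  f _ := (sectionsOfAssociated K G).app _
  comm' _ _ _ := ((sectionsOfAssociated K G).naturality _).symm

/-- The map from Čech cohomology to derived functor cohomology induced by a map from the Čech
resolution to an injective resolution of `𝒪`. -/
def cechComparison {I : InjectiveResolution (structureSheaf K G)}
    (φ : cechSheafComplex K G S ⟶ I.cocomplex) (m : ℕ) :
    (cechSections K G S).homology m ⟶ equivariantCohomology K G m (structureSheaf K G) :=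
  HomologicalComplex.homologyMap (cechSectionsMap K G S ≫
      ((equivariantSections K G).mapHomologicalComplex _).map φ) m ≫
    (I.isoRightDerivedObj (equivariantSections K G) m).inv

/-- `f` is the comparison map induced by some map of complexes `𝒞^• → I^•` under `𝒪`, for an
injective resolution `I^•` of `𝒪` in equivariant sheaves. -/
def IsCechComparison (m : ℕ)
    (f : (cechSections K G S).homology m ⟶ equivariantCohomology K G m (structureSheaf K G)) :
    Prop :=
  ∃ (I : InjectiveResolution (structureSheaf K G))
    (φ : cechSheafComplex K G S ⟶ I.cocomplex),
    cechAugmentation K G S ≫ φ.f 0 = I.ι.f 0 ∧ f = cechComparison K G S φ m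

end EquivariantCohomology


section NumberField

open NumberField

variable (F : Type) [Field F]

/-- `ℝ^I`, with `I` the set of real embeddings. -/
abbrev RealSpace : Type := (F →+* ℝ) → ℝ

variable {F} in
def realEmbedding (x : F) : RealSpace F := fun τ => τ x

variable {F} in
def TotallyPositive (x : F) : Prop := ∀ τ : F →+* ℝ, 0 < τ x

/-- The group `Δ`. -/
def totallyPositiveUnits : Subgroup (𝓞 F)ˣ where
  carrier := {u | TotallyPositive (u : F)}
  one_mem' := fun τ => by simp
  mul_mem' {u v} hu hv := fun τ => by simpa using mul_pos (hu τ) (hv τ)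
  inv_mem' {u} hu := fun τ => by simpa using hu τ

variable {F} in
/-- `x` is totally positive and `x / N` is not a totally positive integer for any `N > 1`. -/
def IsPrimitiveElement (x : 𝓞 F) : Prop :=
  TotallyPositive (x : F) ∧
    ∀ N : ℕ, 1 < N → ∀ y : 𝓞 F, TotallyPositive (y : F) → (N : 𝓞 F) * y ≠ x

variable {F} (ξ : AddChar (𝓞 F) ℂ)

/-- The group `Δ_ξ` of totally positive units `u` with `ξ (u x) = ξ x` for all `x`. -/
def stabilizer : Subgroup (𝓞 F)ˣ where
  carrier := {u | u ∈ totallyPositiveUnits F ∧ ∀ x : 𝓞 F, ξ ((u : 𝓞 F) * x) = ξ x}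
  one_mem' := ⟨one_mem _, fun x => by simp⟩
  mul_mem' {u v} hu hv := ⟨mul_mem hu.1 hv.1, fun x => by
    rw [Units.val_mul, mul_assoc, hu.2, hv.2]⟩
  inv_mem' {u} hu := ⟨inv_mem hu.1, fun x => by
    rw [← hu.2, Units.mul_inv_cancel_left]⟩

/-- The field `ℚ(ξ)`. -/
def valueField : IntermediateField ℚ ℂ := IntermediateField.adjoin ℚ (Set.range ξ)

/-- The set `A_ξ` of primitive elements `x` with `ξ x ≠ 1`. -/
def PrimitiveSet : Type := {x : 𝓞 F // IsPrimitiveElement x ∧ ξ x ≠ 1}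

lemma IsPrimitiveElement.unit_mul {x : 𝓞 F} (hx : IsPrimitiveElement x) {u : (𝓞 F)ˣ}
    (hu : u ∈ totallyPositiveUnits F) : IsPrimitiveElement ((u : 𝓞 F) * x) := by
  refine ⟨fun τ => by simpa using mul_pos (hu τ) (hx.1 τ), fun N hN y hy h => ?_⟩
  refine hx.2 N hN (((u⁻¹ : (𝓞 F)ˣ) : 𝓞 F) * y)
    (fun τ => by simpa using mul_pos (inv_mem hu τ) (hy τ)) ?_
  rw [mul_left_comm, h, Units.inv_mul_cancel_left]

instance : MulAction (stabilizer ξ) (PrimitiveSet ξ) where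
  smul u x := ⟨((u : (𝓞 F)ˣ) : 𝓞 F) * x.1, x.2.1.unit_mul u.2.1, by
    rw [u.2.2]; exact x.2.2⟩
  one_smul x := Subtype.ext (one_mul x.1)
  mul_smul u v x := Subtype.ext (mul_assoc _ _ x.1)

/-- The closed cone generated by a finite family. -/
def generatedCone {ι : Type} [Fintype ι] (a : ι → 𝓞 F) : Set (RealSpace F) :=
  {v | ∃ x : ι → ℝ, (∀ i, 0 ≤ x i) ∧ v = ∑ i, x i • realEmbedding (a i : F)}

def IsSimplicialGenerator {m : ℕ} (a : Fin m → 𝓞 F) (σ : Set (RealSpace F)) : Prop :=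
  (∀ i, TotallyPositive (a i : F)) ∧
    LinearIndependent ℝ (fun i => realEmbedding (a i : F)) ∧ generatedCone a = σ

def IsFace (ρ σ : Set (RealSpace F)) : Prop :=
  ∃ (m : ℕ) (a : Fin m → 𝓞 F), IsSimplicialGenerator a σ ∧
    ∃ s : Finset (Fin m), ρ = generatedCone (fun i : s => a i)

structure IsSimplicialFan (Φ : Set (Set (RealSpace F))) : Prop where
  simplicial : ∀ σ ∈ Φ, ∃ (m : ℕ) (a : Fin m → 𝓞 F), IsSimplicialGenerator a σ
  face_mem : ∀ σ ∈ Φ, ∀ ρ, IsFace ρ σ → ρ ∈ Φ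
  inter_isFace : ∀ σ ∈ Φ, ∀ σ' ∈ Φ, IsFace (σ ∩ σ') σ ∧ IsFace (σ ∩ σ') σ'

def unitScale (u : (𝓞 F)ˣ) (σ : Set (RealSpace F)) : Set (RealSpace F) :=
  (fun v τ => τ (u : F) * v τ) '' σ

/-- A Shintani decomposition for a group `Γ` of units. -/
structure IsShintaniDecomposition (Γ : Subgroup (𝓞 F)ˣ) (Φ : Set (Set (RealSpace F))) : Prop
    extends IsSimplicialFan Φ where
  iUnion_interior : ⋃ σ ∈ Φ, intrinsicInterior ℝ σ = {v | ∀ τ, 0 < v τ} ∪ {0}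
  disjoint_interior : Φ.PairwiseDisjoint (intrinsicInterior ℝ)
  unitScale_mem : ∀ σ ∈ Φ, ∀ u ∈ Γ, unitScale u σ ∈ Φ
  finite_orbits : ∃ T ⊆ Φ, T.Finite ∧ ∀ σ ∈ Φ, ∃ ρ ∈ T, ∃ u ∈ Γ, unitScale u ρ = σ

def coneDim (σ : Set (RealSpace F)) : ℕ := Module.finrank ℝ (Submodule.span ℝ σ)

/-- Every `σ ∈ Φ` of dimension `d` is generated by some tuple in `A_ξ^d`. -/
def HasGeneratorsIn (Φ : Set (Set (RealSpace F))) : Prop :=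
  ∀ σ ∈ Φ, ∃ a : Fin (coneDim σ) → PrimitiveSet ξ, generatedCone (fun i => (a i).1) = σ

/-- The set `Φ_m`. -/
def ConesOfDim (Φ : Set (Set (RealSpace F))) (m : ℕ) : Type :=
  {σ : Set (RealSpace F) // σ ∈ Φ ∧ coneDim σ = m}

lemma unitScale_one (σ : Set (RealSpace F)) : unitScale 1 σ = σ := by
  simp [unitScale]

lemma unitScale_mul (u v : (𝓞 F)ˣ) (σ : Set (RealSpace F)) :
    unitScale (u * v) σ = unitScale u (unitScale v σ) := by
  simp [unitScale, Set.image_image, mul_assoc]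

def orbitSetoid (Φ : Set (Set (RealSpace F))) (m : ℕ) : Setoid (ConesOfDim Φ m) where
  r σ σ' := ∃ u ∈ stabilizer ξ, unitScale u σ.1 = σ'.1
  iseqv :=
    { refl := fun σ => ⟨1, one_mem _, unitScale_one _⟩
      symm := fun {σ σ'} ⟨u, hu, h⟩ => ⟨u⁻¹, inv_mem hu, by
        rw [← h, ← unitScale_mul, inv_mul_cancel, unitScale_one]⟩
      trans := fun {σ σ' σ''} ⟨u, hu, h⟩ ⟨v, hv, h'⟩ => ⟨v * u, mul_mem hv hu, by
        rw [unitScale_mul, h, h']⟩ }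

/-- The quotient `Δ_ξ \ Φ_m`. -/
def ConeOrbits (Φ : Set (Set (RealSpace F))) (m : ℕ) : Type := Quotient (orbitSetoid ξ Φ m)

/-- A choice, for each orbit, of a generator in `A_ξ^m` of some cone in that orbit. -/
def IsGeneratorSystem (Φ : Set (Set (RealSpace F))) (m : ℕ)
    (a : ConeOrbits ξ Φ m → Fin m → PrimitiveSet ξ) : Prop :=
  ∀ c, ∃ σ : ConesOfDim Φ m, Quotient.mk (orbitSetoid ξ Φ m) σ = c ∧
    generatedCone (fun i => (a c i).1) = σ.1

/-- The sign of the determinant of the matrix with `(i, j)` entry `τ_i (a_j)`. -/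
def orientation {m : ℕ} (τ : Fin m ≃ (F →+* ℝ)) (a : Fin m → 𝓞 F) : ℤ :=
  SignType.sign (Matrix.det (Matrix.of fun i j => τ i (a j : F)))

/-- `C^•(𝔙 / Δ_ξ, 𝒪_ξ)`, the `Δ_ξ`-invariant alternating `ℚ(ξ)`-valued functions on `A_ξ^(q+1)`. -/
abbrev CechComplex : CochainComplex (ModuleCat (valueField ξ)) ℕ :=
  cechSections (valueField ξ) (stabilizer ξ) (PrimitiveSet ξ)

/-- `H^m(ξ / Δ_ξ, 𝒪_ξ)` for `ξ = Spec ℚ(ξ)`. -/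
abbrev PointCohomology (m : ℕ) : ModuleCat (valueField ξ) :=
  equivariantCohomology (valueField ξ) (stabilizer ξ) m
    (structureSheaf (valueField ξ) (stabilizer ξ))

/-- The component `η_a` of a cocycle `η`. -/
def component {q : ℕ} (z : (CechComplex ξ).cycles q) (a : Fin (q + 1) → PrimitiveSet ξ) :
    valueField ξ :=
  ((CechComplex ξ).iCycles q z).1.1 a

/-- The sum over `Δ_ξ \ Φ_g` of `sgn(a) η_a`. -/
def orbitSum (Φ : Set (Set (RealSpace F))) {n : ℕ} (τ : Fin (n + 1) ≃ (F →+* ℝ))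
    (a : ConeOrbits ξ Φ (n + 1) → Fin (n + 1) → PrimitiveSet ξ)
    (z : (CechComplex ξ).cycles n) : valueField ξ :=
  ∑ᶠ c : ConeOrbits ξ Φ (n + 1), (orientation τ fun i => (a c i).1) • component ξ z (a c)

end NumberField

end

end ShintaniEcc

open ShintaniEcc NumberField

/-!
The group `Δ_ξ` acts freely on `A_ξ`, so the alternating Čech resolution of `𝒪_ξ` consists of
relatively injective modules and computes `H^{g-1}(ξ / Δ_ξ, 𝒪_ξ)`. The group is free abelian of rank
at most `g - 1`; peeling off one cyclic factor at a time shows that its cohomology in degree `q` has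
rank at most `(g - 1).choose q`, so that `H^{g-1}` has rank at most one.

The orbit sum, taken over ordered generating tuples instead of cones, kills coboundaries: each facet
of a top-dimensional cone is shared with exactly one other cone, on its other side, and the two
contributions cancel. Finally, fix a totally positive `x` in general position and let `η_a` count,
with sign, the points of the orbit `Δ_ξ x` in `σ_a`. This is a cocycle, and its orbit sum is `1` for
every `Φ`, since `x` lies in exactly one cone of `Φ_g`. Hence the orbit sum is an isomorphism,
determined by the value at the class of `η` and so independent of `Φ`.
-/

namespace ShintaniEcc

noncomputable section

section RelativelyInjective

variable {K : Type} [Field K] {G : Type} [Group G]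

lemma action_hom_apply {X Y : Action (ModuleCat.{0} K) G} (f : X ⟶ Y) (u : G) (x : X.V) :
    f.hom.hom ((X.ρ u).hom x) = (Y.ρ u).hom (f.hom.hom x) :=
  congrArg (fun φ => φ.hom x) (f.comm u)

lemma action_ρ_mul_apply {M : Action (ModuleCat.{0} K) G} (u v : G) (x : M.V) :
    (M.ρ (u * v)).hom x = (M.ρ u).hom ((M.ρ v).hom x) := by
  rw [map_mul]; rfl

lemma action_ρ_inv_apply_self {M : Action (ModuleCat.{0} K) G} (u : G) (x : M.V) :
    (M.ρ u⁻¹).hom ((M.ρ u).hom x) = x := by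
  rw [← action_ρ_mul_apply, inv_mul_cancel, map_one]; rfl

lemma action_ρ_self_apply_inv {M : Action (ModuleCat.{0} K) G} (u : G) (x : M.V) :
    (M.ρ u).hom ((M.ρ u⁻¹).hom x) = x := by
  rw [← action_ρ_mul_apply, mul_inv_cancel, map_one]; rfl

/-- Relative injectivity: the embedding of `M` by constants into the module of all functions
`G → M`, where `(u φ) v = u (φ (u⁻¹ v))`, has an equivariant retraction. -/
def IsRelativelyInjective (M : Action (ModuleCat.{0} K) G) : Prop :=
  ∃ avg : (G → M.V) →ₗ[K] M.V, (∀ x, avg (fun _ => x) = x) ∧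
    ∀ u φ, avg (fun v => (M.ρ u).hom (φ (u⁻¹ * v))) = (M.ρ u).hom (avg φ)

lemma IsRelativelyInjective.injective {M : Action (ModuleCat.{0} K) G}
    (hM : IsRelativelyInjective M) : Injective M := by
  obtain ⟨avg, avg_const, avg_equivariant⟩ := hM
  refine ⟨fun {X Y} g f _ => ?_⟩
  have f_injective : Function.Injective f.hom.hom :=
    (ModuleCat.mono_iff_injective _).1
      (inferInstanceAs (Mono ((Action.forget (ModuleCat K) G).map f)))
  obtain ⟨r, hr⟩ := f.hom.hom.exists_leftInverse_of_injective (LinearMap.ker_eq_bot.2 f_injective)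
  let extend : Y.V →ₗ[K] M.V := avg ∘ₗ LinearMap.pi fun v =>
    (M.ρ v).hom ∘ₗ g.hom.hom ∘ₗ r ∘ₗ (Y.ρ v⁻¹).hom
  refine ⟨{ hom := ModuleCat.ofHom extend, comm := fun u => ?_ }, ?_⟩
  · ext y
    refine Eq.trans (congrArg avg (funext fun v => ?_)) (avg_equivariant u _)
    change (M.ρ v).hom (g.hom.hom (r ((Y.ρ v⁻¹).hom ((Y.ρ u).hom y)))) =
      (M.ρ u).hom ((M.ρ (u⁻¹ * v)).hom (g.hom.hom (r ((Y.ρ (u⁻¹ * v)⁻¹).hom y))))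
    rw [← action_ρ_mul_apply, ← action_ρ_mul_apply, mul_inv_rev, inv_inv, mul_inv_cancel_left]
  · apply Action.hom_ext
    ext x
    refine Eq.trans (congrArg avg (funext fun v => ?_)) (avg_const _)
    change (M.ρ v).hom (g.hom.hom (r ((Y.ρ v⁻¹).hom (f.hom.hom x)))) = g.hom.hom x
    rw [← action_hom_apply f, show ∀ z, r (f.hom.hom z) = z from LinearMap.congr_fun hr,
      action_hom_apply, action_ρ_self_apply_inv]

lemma exists_equivariant_map (G S : Type) [Group G] [MulAction G S] [IsCancelSMul G S] :
    ∃ ν : S → G, ∀ (u : G) (s : S), ν (u • s) = u * ν s := by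
  let rep : S → S := fun s => Quotient.out (Quotient.mk (MulAction.orbitRel G S) s)
  have rep_smul (u : G) (s : S) : rep (u • s) = rep s :=
    congrArg Quotient.out (Quotient.sound (s := MulAction.orbitRel G S) ⟨u, rfl⟩)
  have exists_smul_rep (s : S) : ∃ u : G, u • rep s = s :=
    (MulAction.orbitRel G S).symm (Quotient.mk_out s)
  choose ν hν using exists_smul_rep
  refine ⟨ν, fun u s => IsCancelSMul.right_cancel _ _ (rep s) ?_⟩
  rw [mul_smul, hν, ← rep_smul u, hν]

lemma IsRelativelyInjective.res {M : Action (ModuleCat.{0} K) G} (hM : IsRelativelyInjective M)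
    (N : Subgroup G) : IsRelativelyInjective ((Action.res (ModuleCat K) N.subtype).obj M) := by
  obtain ⟨avg, avg_const, avg_equivariant⟩ := hM
  obtain ⟨ν, hν⟩ := exists_equivariant_map N G
  refine ⟨avg ∘ₗ LinearMap.funLeft K M.V ν, avg_const, fun u φ => ?_⟩
  refine Eq.trans (congrArg avg (funext fun v => ?_)) (avg_equivariant u (φ ∘ ν))
  change (M.ρ u).hom (φ (u⁻¹ * ν v)) = (M.ρ u).hom (φ (ν (u⁻¹ * v)))
  rw [← hν]
  rfl

end RelativelyInjective

section CyclicQuotient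

variable (K : Type) [Field K] {G : Type} [CommGroup G] (N : Subgroup G)

/-- `M ↦ M^N`. -/
abbrev invariantsOn : Action (ModuleCat.{0} K) G ⥤ ModuleCat.{0} K :=
  Action.res (ModuleCat K) N.subtype ⋙ invariants K N

/-- The inclusion `M^G → M^N`. -/
def invariantsInclusion : invariants K G ⟶ invariantsOn K N where
  app M := ModuleCat.ofHom
    { toFun := fun x => ⟨x.1, fun u => x.2 u⟩
      map_add' := fun _ _ => rfl
      map_smul' := fun _ _ => rfl }

/-- Multiplication by `t`, as an endomorphism of the identity functor. -/
def translate (t : G) : 𝟭 (Action (ModuleCat.{0} K) G) ⟶ 𝟭 _ where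
  app M :=
    { hom := M.ρ t
      comm := fun u => by
        change M.ρ t * M.ρ u = M.ρ u * M.ρ t
        rw [← map_mul, ← map_mul, mul_comm] }
  naturality M M' f := Action.hom_ext _ _ (f.comm t).symm

variable {K} {χ : G →* Multiplicative ℤ} {t : G}

lemma exists_sub_translate_eq (ht : χ t = Multiplicative.ofAdd 1)
    {M : Action (ModuleCat.{0} K) G} (hM : IsRelativelyInjective M) {y : M.V}
    (hy : ∀ u ∈ χ.ker, (M.ρ u).hom y = y) :
    ∃ x : M.V, (∀ u ∈ χ.ker, (M.ρ u).hom x = x) ∧ x - (M.ρ t).hom x = y := by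
  obtain ⟨avg, avg_const, avg_equivariant⟩ := hM
  -- A sequence with `c (k + 1) = t (c k) + y`; the average of `v ↦ c (χ v)` solves `x - t x = y`.
  let step : Equiv.Perm M.V :=
    { toFun := fun x => (M.ρ t).hom x + y
      invFun := fun x => (M.ρ t⁻¹).hom (x - y)
      left_inv := fun x => by simp [action_ρ_inv_apply_self]
      right_inv := fun x => by simp [action_ρ_self_apply_inv] }
  let c : ℤ → M.V := fun k => (step ^ k) 0
  have c_succ (k : ℤ) : c (k + 1) = (M.ρ t).hom (c k) + y := by
    simp only [c, zpow_one_add, add_comm k 1, Equiv.Perm.mul_apply]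
    rfl
  have c_pred (k : ℤ) : c (k - 1) = (M.ρ t⁻¹).hom (c k - y) := by
    rw [← sub_add_cancel k 1, c_succ, add_sub_cancel_right, add_sub_cancel_right,
      action_ρ_inv_apply_self]
  have c_mem (u : G) (hu : u ∈ χ.ker) (k : ℤ) : (M.ρ u).hom (c k) = c k := by
    induction k using Int.induction_on with
    | zero => exact map_zero _
    | succ k ih =>
      rw [c_succ, map_add, hy u hu, ← action_ρ_mul_apply, mul_comm, action_ρ_mul_apply, ih]
    | pred k ih =>
      rw [c_pred, ← action_ρ_mul_apply, mul_comm, action_ρ_mul_apply, map_sub, hy u hu, ih]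
  refine ⟨avg fun v => c (χ v).toAdd, fun u hu => ?_, ?_⟩
  · rw [← avg_equivariant]
    simp only [map_mul, map_inv, c_mem u hu, MonoidHom.mem_ker.1 hu, inv_one, one_mul]
  · rw [sub_eq_iff_eq_add', ← avg_equivariant]
    conv_rhs => rw [← avg_const y, ← map_add]
    refine congrArg avg (funext fun v => ?_)
    rw [Pi.add_apply, ← c_succ, map_mul, map_inv, ht, toAdd_mul, toAdd_inv, toAdd_ofAdd,
      neg_add_cancel_comm]

lemma fixed_of_fixed_ker (ht : χ t = Multiplicative.ofAdd 1) {M : Action (ModuleCat.{0} K) G}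
    {x : M.V} (hker : ∀ u ∈ χ.ker, (M.ρ u).hom x = x) (hx : (M.ρ t).hom x = x) (u : G) :
    (M.ρ u).hom x = x := by
  let H : Subgroup G :=
    { carrier := {v | (M.ρ v).hom x = x}
      one_mem' := by rw [Set.mem_ofPred_eq, map_one]; rfl
      mul_mem' := fun {v w} (hv : _ = x) (hw : _ = x) => by
        rw [Set.mem_ofPred_eq, action_ρ_mul_apply, hw, hv]
      inv_mem' := fun {v} (hv : _ = x) => by
        rw [Set.mem_ofPred_eq]
        nth_rewrite 1 [← hv]
        exact action_ρ_inv_apply_self v x }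
  have quotient_mem : u * (t ^ (χ u).toAdd)⁻¹ ∈ H := hker _ (by
    rw [MonoidHom.mem_ker, map_mul, map_inv, map_zpow, ht, ← ofAdd_zsmul, smul_eq_mul, mul_one,
      ofAdd_toAdd, mul_inv_cancel])
  have := H.mul_mem quotient_mem (H.zpow_mem (x := t) hx (χ u).toAdd)
  rwa [inv_mul_cancel_right] at this

variable (L : CochainComplex (Action (ModuleCat.{0} K) G) ℕ)

/-- The sequence `0 → L^G → L^N → L^N → 0`, with second map `x ↦ x - t x`. -/
def invariantsSequence (t : G) : ShortComplex (CochainComplex (ModuleCat.{0} K) ℕ) :=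
  ShortComplex.mk ((NatTrans.mapHomologicalComplex (invariantsInclusion K N) _).app L)
    ((NatTrans.mapHomologicalComplex
      (Functor.whiskerRight (𝟙 _ - translate K t) (invariantsOn K N)) _).app L) (by
    ext q x
    refine Subtype.ext ?_
    exact sub_eq_zero.2 (x.2 t).symm)

lemma invariantsSequence_shortExact (ht : χ t = Multiplicative.ofAdd 1)
    (hL : ∀ q, IsRelativelyInjective (L.X q)) : (invariantsSequence χ.ker L t).ShortExact := by
  refine HomologicalComplex.shortExact_of_degreewise_shortExact _ fun q =>
    { exact := ?_, mono_f := ?_, epi_g := ?_ }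
  · rw [ShortComplex.moduleCat_exact_iff]
    intro x hx
    have x_fixed : ((L.X q).ρ t).hom x.1 = x.1 :=
      (sub_eq_zero.1 (congrArg (fun z => z.1) hx)).symm
    exact ⟨⟨x.1, fixed_of_fixed_ker ht (fun u hu => x.2 ⟨u, hu⟩) x_fixed⟩, rfl⟩
  · exact (ModuleCat.mono_iff_injective _).2 fun x y h =>
      Subtype.ext (congrArg (fun z => z.1) h)
  · refine (ModuleCat.epi_iff_surjective _).2 fun y => ?_
    obtain ⟨x, hx, h⟩ := exists_sub_translate_eq ht (hL q) fun u hu => y.2 ⟨u, hu⟩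
    exact ⟨⟨x, fun u => hx u u.2⟩, Subtype.ext h⟩

end CyclicQuotient

section RankBound

variable {K : Type} [Field K] {G : Type} [CommGroup G]

/-- The kernel of the first coordinate of `ℤ^(r+1)`. -/
def kerEquivOfEquiv {r : ℕ} (e : G ≃* Multiplicative (Fin (r + 1) → ℤ)) :
    ((Pi.evalAddMonoidHom (fun _ => ℤ) (0 : Fin (r + 1))).toMultiplicative.comp
      e.toMonoidHom).ker ≃* Multiplicative (Fin r → ℤ) where
  toFun u := .ofAdd fun i => (e u).toAdd i.succ
  invFun w := ⟨e.symm (.ofAdd (Fin.cons 0 w.toAdd)), by simp⟩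
  left_inv u := by
    have head_eq_zero : (e u).toAdd 0 = 0 := congrArg Multiplicative.toAdd u.2
    refine Subtype.ext (e.symm_apply_eq.2 (Multiplicative.toAdd.injective ?_))
    change Fin.cons 0 (Fin.tail (e u).toAdd) = (e u).toAdd
    rw [← head_eq_zero, Fin.cons_self_tail]
  right_inv w := by simp
  map_mul' u v := by
    rw [Subgroup.coe_mul, map_mul]
    rfl

/-- For trivial `G`, every vector is invariant. -/
def invariantsIsoForget (K : Type) [Field K] (G : Type) [Group G] [Subsingleton G] :
    invariants K G ≅ Action.forget (ModuleCat.{0} K) G :=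
  NatIso.ofComponents fun M => LinearEquiv.toModuleIso
    (LinearEquiv.ofTop _ (eq_top_iff.2 fun x _ u => by
      rw [Subsingleton.elim u 1, map_one]
      rfl))

lemma rank_le_add_of_exact {T : ShortComplex (ModuleCat.{0} K)} (hT : T.Exact) :
    Module.rank K T.X₂ ≤ Module.rank K T.X₁ + Module.rank K T.X₃ := by
  rw [← LinearMap.rank_range_add_rank_ker T.g.hom, add_comm,
    ← (ShortComplex.moduleCat_exact_iff_range_eq_ker T).1 hT]
  exact add_le_add (rank_range_le _) (Submodule.rank_le _)

lemma rank_homology_zero_le {L M : CochainComplex (ModuleCat.{0} K) ℕ} (φ : L ⟶ M)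
    [Mono (φ.f 0)] : Module.rank K (L.homology 0) ≤ Module.rank K (M.homology 0) := by
  have : Mono (HomologicalComplex.homologyMap φ 0) := by
    have : HomologicalComplex.homologyMap φ 0 =
        inv (L.homologyπ 0) ≫ HomologicalComplex.cyclesMap φ 0 ≫ M.homologyπ 0 := by
      rw [← HomologicalComplex.homologyπ_naturality, IsIso.inv_hom_id_assoc]
    rw [this]
    infer_instance
  exact LinearMap.rank_le_of_injective _ ((ModuleCat.mono_iff_injective _).1 this)

theorem rank_homology_invariants_le {r : ℕ} (e : G ≃* Multiplicative (Fin r → ℤ))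
    {L : CochainComplex (Action (ModuleCat.{0} K) G) ℕ}
    (hL : ∀ q, IsRelativelyInjective (L.X q))
    (hrank : ∀ q, Module.rank K ((((Action.forget _ G).mapHomologicalComplex _).obj L).homology q) ≤
      Nat.choose 0 q) (q : ℕ) :
    Module.rank K ((((invariants K G).mapHomologicalComplex _).obj L).homology q) ≤ r.choose q := by
  induction r generalizing G q with
  | zero =>
    have : Subsingleton G := e.toEquiv.subsingleton
    have iso := HomologicalComplex.homologyMapIso
      ((NatIso.mapHomologicalComplex (invariantsIsoForget K G) _).app L) q
    exact iso.toLinearEquiv.rank_eq.trans_le (hrank q)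
  | succ r ih =>
    let χ : G →* Multiplicative ℤ :=
      (Pi.evalAddMonoidHom (fun _ => ℤ) (0 : Fin (r + 1))).toMultiplicative.comp e.toMonoidHom
    let t : G := e.symm (.ofAdd (Pi.single 0 1))
    have ht : χ t = .ofAdd 1 := by simp [χ, t]
    have hS := invariantsSequence_shortExact L ht hL
    have ih_ker (q : ℕ) : Module.rank K ((invariantsSequence χ.ker L t).X₂.homology q) ≤
        r.choose q :=
      ih (kerEquivOfEquiv e) (L := ((Action.res _ χ.ker.subtype).mapHomologicalComplex _).obj L)
        (fun q => (hL q).res _) hrank q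
    cases q with
    | zero =>
      have := hS.mono_f
      exact (rank_homology_zero_le (invariantsSequence χ.ker L t).f).trans
        (by simpa only [Nat.choose_zero_right] using ih_ker 0)
    | succ q =>
      refine (rank_le_add_of_exact (hS.homology_exact₁ q (q + 1) rfl)).trans ?_
      rw [Nat.choose_succ_succ, Nat.cast_add]
      exact add_le_add (ih_ker q) (ih_ker (q + 1))

end RankBound

section CechExactness

variable {K : Type} [Field K] {S : Type}

/-- The contracting homotopy `f ↦ f (s, -)` of the alternating cochain complex. -/
def coneOff (s : S) {q : ℕ} (f : (Fin (q + 2) → S) → K) (a : Fin (q + 1) → S) : K :=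
  f (Fin.cons s a)

lemma coneOff_mem (s : S) {q : ℕ} {f : (Fin (q + 2) → S) → K}
    (hf : f ∈ altCochains K S (q + 1)) : coneOff s f ∈ altCochains K S q := by
  refine ⟨fun ρ a => ?_, fun a ha => hf.2 _ fun h => ha fun i j hij => ?_⟩
  · have cons_comp : (Fin.cons s (a ∘ ρ) : Fin (q + 2) → S) =
        Fin.cons s a ∘ Equiv.Perm.decomposeFin.symm (0, ρ) := by
      funext k
      refine Fin.cases ?_ (fun k => ?_) k <;> simp
    rw [coneOff, cons_comp, hf.1, coneOff, Equiv.Perm.decomposeFin.symm_sign, if_pos rfl, one_mul]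
  · exact Fin.succ_injective _ (h (by simpa using hij))

lemma altDiff_cons (s : S) {q : ℕ} (f : (Fin (q + 2) → S) → K) (a : Fin (q + 2) → S) :
    altDiff f (Fin.cons s a) = f a - altDiff (coneOff s f) a := by
  have cons_comp_succAbove (j : Fin (q + 2)) : (Fin.cons s a : Fin (q + 3) → S) ∘ j.succ.succAbove =
      Fin.cons s (a ∘ j.succAbove) := by
    funext k
    refine Fin.cases ?_ (fun k => ?_) k <;> simp
  rw [altDiff, Fin.sum_univ_succ, altDiff, sub_eq_add_neg, ← Finset.sum_neg_distrib]
  congr 1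
  · simp only [Fin.val_zero, pow_zero, one_mul]
    rfl
  · refine Finset.sum_congr rfl fun j _ => ?_
    rw [cons_comp_succAbove, coneOff, Fin.val_succ, pow_succ, mul_neg_one, neg_mul]

lemma altDiff_coneOff (s : S) {q : ℕ} {f : (Fin (q + 2) → S) → K} (hf : altDiff f = 0) :
    altDiff (coneOff s f) = f :=
  funext fun a => (sub_eq_zero.1 ((altDiff_cons s f a).symm.trans (congrFun hf _))).symm

lemma altDiff_apply_cons_zero (s : S) (f : (Fin (0 + 1) → S) → K) (a : Fin (0 + 1) → S) :
    altDiff f (Fin.cons s a) = f a - f fun _ => s := by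
  have cons_comp_last : (Fin.cons s a : Fin 2 → S) ∘ (1 : Fin 2).succAbove = fun _ => s :=
    funext fun k => by rw [Subsingleton.elim (α := Fin 1) k 0]; rfl
  rw [altDiff, Fin.sum_univ_two, Fin.val_zero, Fin.val_one, cons_comp_last, pow_zero, pow_one,
    one_mul, neg_one_mul, ← sub_eq_add_neg]
  rfl

end CechExactness

section CechRelativelyInjective

variable {K : Type} [Field K] {G S : Type} [Group G] [MulAction G S]

/-- The average over `i` of the cochains `φ (ν (a i))`, evaluated at `a`. -/
def averageAlong (ν : S → G) (q : ℕ) : (G → altCochains K S q) →ₗ[K] altCochains K S q where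
  toFun φ := ⟨fun a => ((q : K) + 1)⁻¹ * ∑ i, (φ (ν (a i))).1 a, fun ρ a => by
      simp only [Function.comp_apply, (φ _).2.1]
      rw [← Finset.mul_sum, Equiv.sum_comp ρ fun i => (φ (ν (a i))).1 a, mul_left_comm],
    fun a ha => by simp [(φ _).2.2 a ha]⟩
  map_add' φ ψ := by
    ext a
    simp [Finset.sum_add_distrib, mul_add]
  map_smul' c φ := by
    ext a
    simp [← Finset.mul_sum, mul_left_comm]

lemma isRelativelyInjective_cechObj [CharZero K] [IsCancelSMul G S] (q : ℕ) :
    IsRelativelyInjective (cechObj K G S q) := by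
  obtain ⟨ν, hν⟩ := exists_equivariant_map G S
  refine ⟨averageAlong ν q, fun (f : altCochains K S q) => Subtype.ext (funext fun a => ?_),
    fun u (φ : G → altCochains K S q) => Subtype.ext (funext fun a => ?_)⟩
  · change ((q : K) + 1)⁻¹ * ∑ _ : Fin (q + 1), f.1 a = f.1 a
    rw [Finset.sum_const, Finset.card_univ, Fintype.card_fin, nsmul_eq_mul, Nat.cast_add_one,
      inv_mul_cancel_left₀ (Nat.cast_add_one_ne_zero q)]
  · change ((q : K) + 1)⁻¹ * ∑ i, (φ (u⁻¹ * ν (a i))).1 (u⁻¹ • a) =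
      ((q : K) + 1)⁻¹ * ∑ i, (φ (ν (u⁻¹ • a i))).1 (u⁻¹ • a)
    simp only [hν]

end CechRelativelyInjective

section InjectiveResolutions

variable {C : Type*} [Category* C] [Abelian C]

/-- A coaugmented exact complex of injectives as an injective resolution. -/
def resolutionOfExact {Z : C} (L : CochainComplex C ℕ) (hL : ∀ q, Injective (L.X q))
    (ε : Z ⟶ L.X 0) [Mono ε] (hε : ε ≫ L.d 0 1 = 0) (exact_zero : (ShortComplex.mk _ _ hε).Exact)
    (exact_succ : ∀ q, (ShortComplex.mk _ _ (L.d_comp_d q (q + 1) (q + 2))).Exact) :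
    InjectiveResolution Z where
  cocomplex := L
  injective := hL
  ι := (CochainComplex.fromSingle₀Equiv _ _).symm ⟨ε, hε⟩
  quasiIso := ⟨fun n => by
    cases n with
    | zero =>
      rw [CochainComplex.quasiIsoAt₀_iff, ShortComplex.quasiIso_iff_of_zeros]
      · refine (ShortComplex.exact_and_mono_f_iff_of_iso ?_).2 ⟨exact_zero, ‹Mono ε›⟩
        refine ShortComplex.isoMk (Iso.refl _) (Iso.refl _) (Iso.refl _) ?_ ?_
        · refine (Category.id_comp _).trans (Eq.trans ?_ (Category.comp_id _).symm)
          exact (CochainComplex.fromSingle₀Equiv_symm_apply_f_zero _ _).symm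
        · exact (Category.id_comp _).trans (Category.comp_id _).symm
      · rfl
      · rfl
      · exact L.shape _ _ (by simp)
    | succ n =>
      rw [quasiIsoAt_iff_exactAt]
      · exact (HomologicalComplex.exactAt_iff' _ n (n + 1) (n + 2) (by simp)
          (by simp only [CochainComplex.next]; rfl)).2 (exact_succ n)
      · exact CochainComplex.exactAt_succ_single_obj _ _⟩

variable {D : Type*} [Category* D] [Abelian D]

lemma homologyMap_comp_isoRightDerivedObj_inv [HasInjectiveResolutions C]
    (F : C ⥤ D) [F.Additive] {Z : C}
    (J I : InjectiveResolution Z) (φ : J.cocomplex ⟶ I.cocomplex)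
    (hφ : J.ι.f 0 ≫ φ.f 0 = I.ι.f 0) {B : CochainComplex D ℕ}
    (σ : B ⟶ (F.mapHomologicalComplex _).obj J.cocomplex) (m : ℕ) :
    HomologicalComplex.homologyMap (σ ≫ (F.mapHomologicalComplex _).map φ) m ≫
        (I.isoRightDerivedObj F m).inv =
      HomologicalComplex.homologyMap σ m ≫ (J.isoRightDerivedObj F m).inv := by
  have naturality := InjectiveResolution.isoRightDerivedObj_inv_naturality (𝟙 Z) J I φ
    (hφ.trans (Category.id_comp (I.ι.f 0)).symm) F m
  rw [CategoryTheory.Functor.map_id, Category.comp_id] at naturality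
  rw [HomologicalComplex.homologyMap_comp, naturality]
  exact Category.assoc _ _ _

end InjectiveResolutions

section CechResolution

variable (K : Type) [Field K] (G : Type) [Group G]

instance : (tilde.functor (.of K)).IsEquivalence :=
  (tilde.adjunction (R := .of K)).isEquivalence_left_of_isEquivalence_right

instance : (associatedSheaf K G).IsEquivalence :=
  ((tilde.functor (.of K)).asEquivalence.mapAction G).isEquivalence_functor

instance : IsIso (structureSheafToAssociated K G) := by
  have : IsIso (structureSheafToAssociated K G).hom := (tildeSelf (R := .of K)).isIso_inv
  exact Action.isIso_of_hom_isIso _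

instance (M : Action (ModuleCat K) G) : IsIso ((sectionsOfAssociated K G).app M) := by
  let φ : M ⟶ ((moduleSpecΓFunctor (R := .of K)).mapAction G).obj ((associatedSheaf K G).obj M) :=
    { hom := (tilde.toTildeΓNatIso (R := .of K)).hom.app M.V
      comm := fun u => (tilde.toTildeΓNatIso (R := .of K)).hom.naturality (M.ρ u) }
  have : IsIso φ.hom := NatIso.hom_app_isIso (tilde.toTildeΓNatIso (R := .of K)) M.V
  have : IsIso φ := Action.isIso_of_hom_isIso φ
  exact Functor.map_isIso (invariants K G) φ

variable {K G} in
lemma action_exact_iff (T : ShortComplex (Action (ModuleCat K) G)) :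
    T.Exact ↔ ∀ y : T.X₂.V, T.g.hom.hom y = 0 → ∃ x : T.X₁.V, T.f.hom.hom x = y := by
  rw [← ShortComplex.exact_map_iff_of_faithful T (Action.forget (ModuleCat K) G),
    ShortComplex.moduleCat_exact_iff]
  rfl

lemma cechUnit_mono {S : Type} [MulAction G S] (s : S) : Mono (cechUnit K G S) := by
  have : Mono ((Action.forget (ModuleCat K) G).map (cechUnit K G S)) :=
    (ModuleCat.mono_iff_injective _).2 fun _ _ h => congrFun (congrArg Subtype.val h) fun _ => s
  exact (Action.forget (ModuleCat K) G).mono_of_mono_map this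

variable [CharZero K] (S : Type) [MulAction G S]

instance : IsIso (cechSectionsMap K G S) := by
  have (q : ℕ) : IsIso ((cechSectionsMap K G S).f q) :=
    inferInstanceAs (IsIso ((sectionsOfAssociated K G).app _))
  exact HomologicalComplex.Hom.isIso_of_components _

lemma cechComplex_d_apply (q : ℕ) (f : altCochains K S q) :
    (((cechComplex K G S).d q (q + 1)).hom.hom f : altCochains K S (q + 1)).1 = altDiff f.1 := by
  rw [show (cechComplex K G S).d q (q + 1) = cechDiff K G S q from CochainComplex.of_d _ _ _]
  rfl

lemma cechUnit_comp_d :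
    (cechUnit K G S ≫ (cechComplex K G S).d 0 1 : trivialModule K G ⟶ (cechComplex K G S).X 1) =
      0 := by
  apply Action.hom_ext
  refine ModuleCat.hom_ext (LinearMap.ext fun (c : K) => Subtype.ext (funext fun a => ?_))
  refine (congrFun (cechComplex_d_apply K G S 0 _) a).trans ?_
  rw [← Fin.cons_self_tail a, altDiff_apply_cons_zero]
  exact sub_self c

lemma associatedSheaf_map_cechUnit_comp_d :
    (associatedSheaf K G).map (cechUnit K G S : trivialModule K G ⟶ (cechComplex K G S).X 0) ≫
      (cechSheafComplex K G S).d 0 1 = 0 :=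
  ((associatedSheaf K G).map_comp _ _).symm.trans
    ((congrArg (associatedSheaf K G).map (cechUnit_comp_d K G S)).trans
      (Functor.map_zero _ _ _))

lemma cechAugmentation_comp_d :
    cechAugmentation K G S ≫ (cechSheafComplex K G S).d 0 1 = 0 :=
  (Category.assoc _ _ _).trans ((congrArg (structureSheafToAssociated K G ≫ ·)
    (associatedSheaf_map_cechUnit_comp_d K G S)).trans Limits.comp_zero)

variable {S}

lemma cechUnit_exact (s : S) :
    (ShortComplex.mk (cechUnit K G S : trivialModule K G ⟶ (cechComplex K G S).X 0) _
      (cechUnit_comp_d K G S)).Exact := by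
  rw [action_exact_iff]
  intro (f : altCochains K S 0) hf
  have hf' : altDiff f.1 = 0 :=
    (cechComplex_d_apply K G S 0 f).symm.trans (congrArg Subtype.val hf)
  refine ⟨(f.1 fun _ => s : K), Subtype.ext (funext fun a => ?_)⟩
  have := congrFun hf' (Fin.cons s a)
  rw [altDiff_apply_cons_zero] at this
  exact (sub_eq_zero.1 this).symm

lemma cechComplex_exact (s : S) (q : ℕ) :
    (ShortComplex.mk _ _ ((cechComplex K G S).d_comp_d q (q + 1) (q + 2))).Exact := by
  rw [action_exact_iff]
  intro (f : altCochains K S (q + 1)) hf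
  have hf' : altDiff f.1 = 0 :=
    (cechComplex_d_apply K G S (q + 1) f).symm.trans (congrArg Subtype.val hf)
  refine ⟨(⟨_, coneOff_mem s f.2⟩ : altCochains K S q), Subtype.ext ?_⟩
  exact (cechComplex_d_apply K G S q _).trans (altDiff_coneOff s hf')

lemma cechAugmentation_exact (s : S) :
    (ShortComplex.mk _ _ (cechAugmentation_comp_d K G S)).Exact := by
  let e : structureSheaf K G ≅ (associatedSheaf K G).obj (trivialModule K G) :=
    asIso (structureSheafToAssociated K G)
  refine (ShortComplex.exact_iff_of_iso ?_).2 ((cechUnit_exact K G s).map (associatedSheaf K G))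
  exact ShortComplex.isoMk e (Iso.refl _) (Iso.refl _)
    (Category.comp_id _).symm ((Category.id_comp _).trans (Category.comp_id _).symm)

lemma cechAugmentation_mono (s : S) : Mono (cechAugmentation K G S) := by
  have := cechUnit_mono K G s
  have : Mono ((associatedSheaf K G).map (cechUnit K G S)) := inferInstance
  exact mono_comp (structureSheafToAssociated K G) ((associatedSheaf K G).map (cechUnit K G S))

/-- The Čech resolution of the structure sheaf for a free action on a set with a point `s`. -/
def cechResolution [IsCancelSMul G S] (s : S) : InjectiveResolution (structureSheaf K G) :=
  have := cechAugmentation_mono K G s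
  resolutionOfExact (cechSheafComplex K G S)
    (fun q => ((associatedSheaf K G).asEquivalence.map_injective_iff (cechObj K G S q)).2
      (isRelativelyInjective_cechObj q).injective)
    (cechAugmentation K G S) (cechAugmentation_comp_d K G S) (cechAugmentation_exact K G s)
    fun q => (cechComplex_exact K G s q).map (associatedSheaf K G)

lemma cechResolution_ι_f_zero [IsCancelSMul G S] (s : S) :
    (cechResolution K G s).ι.f 0 = cechAugmentation K G S :=
  CochainComplex.fromSingle₀Equiv_symm_apply_f_zero _ _

theorem exists_cechComparison_iso [IsCancelSMul G S] (s : S) (m : ℕ) :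
    ∃ κ : (cechSections K G S).homology m ≅ equivariantCohomology K G m (structureSheaf K G),
      ∀ f, IsCechComparison K G S m f ↔ f = κ.hom := by
  let J := cechResolution K G s
  let κ := asIso (HomologicalComplex.homologyMap (cechSectionsMap K G S) m) ≪≫
    (J.isoRightDerivedObj (equivariantSections K G) m).symm
  have comparison_eq (I : InjectiveResolution (structureSheaf K G))
      (φ : cechSheafComplex K G S ⟶ I.cocomplex)
      (hφ : cechAugmentation K G S ≫ φ.f 0 = I.ι.f 0) : cechComparison K G S φ m = κ.hom :=
    homologyMap_comp_isoRightDerivedObj_inv (equivariantSections K G) J I φ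
      ((congrArg (· ≫ φ.f 0) (cechResolution_ι_f_zero K G s)).trans hφ) (cechSectionsMap K G S) m
  have id_comp_augmentation : cechAugmentation K G S ≫
      HomologicalComplex.Hom.f (𝟙 (cechSheafComplex K G S)) 0 = J.ι.f 0 :=
    (Category.comp_id _).trans (cechResolution_ι_f_zero K G s).symm
  refine ⟨κ, fun f => ⟨?_, fun hf => ?_⟩⟩
  · rintro ⟨I, φ, hφ, rfl⟩
    exact comparison_eq I φ hφ
  · exact ⟨J, 𝟙 _, id_comp_augmentation,
      hf.trans (comparison_eq J (𝟙 _) id_comp_augmentation).symm⟩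

end CechResolution

section ModuleComplexes

variable {R : Type} [Ring R] (L : CochainComplex (ModuleCat.{0} R) ℕ)

lemma iCycles_injective (q : ℕ) : Function.Injective (L.iCycles q) :=
  (ModuleCat.mono_iff_injective _).1 inferInstance

lemma homologyπ_surjective (q : ℕ) : Function.Surjective (L.homologyπ q) :=
  (ModuleCat.epi_iff_surjective _).1 inferInstance

lemma d_iCycles_apply (q : ℕ) (z : L.cycles q) : L.d q (q + 1) (L.iCycles q z) = 0 := by
  rw [← ModuleCat.comp_apply, HomologicalComplex.iCycles_d]; rfl

lemma exists_iCycles_eq (q : ℕ) (x : L.X q) (hx : L.d q (q + 1) x = 0) :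
    ∃ z : L.cycles q, L.iCycles q z = x := by
  let k : ModuleCat.of R R ⟶ L.X q := ModuleCat.ofHom (LinearMap.toSpanSingleton R (L.X q) x)
  have k_comp_d : k ≫ L.d q (q + 1) = 0 := by
    ext
    change L.d q (q + 1) ((1 : R) • x) = 0
    rw [one_smul, hx]
  refine ⟨L.liftCycles k (q + 1) (by simp) k_comp_d (1 : R), ?_⟩
  rw [← ModuleCat.comp_apply, HomologicalComplex.liftCycles_i]
  exact one_smul R x

lemma exists_toCycles_eq {q : ℕ} {z : L.cycles q} (hz : L.homologyπ q z = 0) :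
    ∃ w : L.X ((ComplexShape.up ℕ).prev q), L.toCycles _ q w = z := by
  have exact : (ShortComplex.mk (L.toCycles ((ComplexShape.up ℕ).prev q) q) (L.homologyπ q)
      (by simp)).Exact :=
    ShortComplex.exact_of_g_is_cokernel _ (L.homologyIsCokernel _ q rfl)
  exact (ShortComplex.moduleCat_exact_iff _).1 exact z hz

lemma iCycles_eq_zero {z : L.cycles 0} (hz : L.homologyπ 0 z = 0) : L.iCycles 0 z = 0 := by
  obtain ⟨w, rfl⟩ := exists_toCycles_eq L hz
  rw [← ModuleCat.comp_apply, HomologicalComplex.toCycles_i, L.shape _ _ (by simp)]; rfl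

lemma exists_d_eq_iCycles {q : ℕ} {z : L.cycles (q + 1)} (hz : L.homologyπ (q + 1) z = 0) :
    ∃ w : L.X q, L.d q (q + 1) w = L.iCycles (q + 1) z := by
  obtain ⟨w, rfl⟩ := exists_toCycles_eq L hz
  have prev_eq : (ComplexShape.up ℕ).prev (q + 1) = q := CochainComplex.prev_nat_succ q
  revert w
  rw [prev_eq]
  intro w _
  exact ⟨w, by rw [← ModuleCat.comp_apply, HomologicalComplex.toCycles_i]⟩

end ModuleComplexes

section TopCohomology

variable (K : Type) [Field K] [CharZero K] (G : Type)

lemma rank_homology_forget_cechComplex_le [Group G] {S : Type} [MulAction G S] (s : S) (q : ℕ) :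
    Module.rank K ((((Action.forget (ModuleCat.{0} K) G).mapHomologicalComplex _).obj
      (cechComplex K G S)).homology q) ≤ Nat.choose 0 q := by
  let L := ((Action.forget (ModuleCat.{0} K) G).mapHomologicalComplex _).obj (cechComplex K G S)
  change Module.rank K (L.homology q) ≤ _
  cases q with
  | zero =>
    obtain ⟨z₁, hz₁⟩ := exists_iCycles_eq L 0 ((cechUnit K G S).hom.hom (1 : K))
      (congrArg (fun φ => φ.hom.hom (1 : K)) (cechUnit_comp_d K G S))
    rw [Nat.choose_self, Nat.cast_one, rank_le_one_iff]
    refine ⟨L.homologyπ 0 z₁, fun v => ?_⟩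
    obtain ⟨z, rfl⟩ := homologyπ_surjective L 0 v
    obtain ⟨c, hc⟩ : ∃ c : K, (cechUnit K G S).hom.hom c = L.iCycles 0 z :=
      (action_exact_iff _).1 (cechUnit_exact K G s) _ (d_iCycles_apply L 0 z)
    have z_eq : c • z₁ = z := by
      refine iCycles_injective L 0 ?_
      rw [map_smul, hz₁, ← hc]
      exact Subtype.ext (funext fun _ => mul_one c)
    exact ⟨c, by rw [← z_eq, map_smul]⟩
  | succ q =>
    have exactAt : L.ExactAt (q + 1) :=
      (HomologicalComplex.exactAt_iff' _ q (q + 1) (q + 2) (by simp)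
        (by simp only [CochainComplex.next]; rfl)).2
        ((cechComplex_exact K G s q).map (Action.forget (ModuleCat K) G))
    have := ModuleCat.subsingleton_of_isZero exactAt.isZero_homology
    rw [rank_subsingleton', Nat.choose_zero_succ, Nat.cast_zero]

theorem rank_homology_cechSections_le [CommGroup G] {S : Type} [MulAction G S] [IsCancelSMul G S]
    (s : S) {r : ℕ} (e : G ≃* Multiplicative (Fin r → ℤ)) (m : ℕ) :
    Module.rank K ((cechSections K G S).homology m) ≤ r.choose m :=
  rank_homology_invariants_le e isRelativelyInjective_cechObj
    (rank_homology_forget_cechComplex_le K G s) m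

end TopCohomology

section Cocycles

variable {K : Type} [Field K] [CharZero K] {G : Type} [Group G] {S : Type} [MulAction G S]

/-- The function on `S^(q+1)` underlying an invariant cochain. -/
def cochainFun {q : ℕ} : (cechSections K G S).X q →ₗ[K] ((Fin (q + 1) → S) → K) where
  toFun x := (x.1 : altCochains K S q).1
  map_add' _ _ := rfl
  map_smul' _ _ := rfl

lemma cochainFun_injective {q : ℕ} :
    Function.Injective (cochainFun (K := K) (G := G) (S := S) (q := q)) :=
  fun _ _ h => Subtype.ext (Subtype.ext h)

lemma cochainFun_mem {q : ℕ} (x : (cechSections K G S).X q) :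
    cochainFun x ∈ altCochains K S q := (x.1 : altCochains K S q).2

lemma cochainFun_smul {q : ℕ} (x : (cechSections K G S).X q) (u : G) (a : Fin (q + 1) → S) :
    cochainFun x (u • a) = cochainFun x a := by
  have h : (((cechObj K G S q).ρ u⁻¹).hom x.1 : altCochains K S q) = x.1 := x.2 u⁻¹
  have h' : (x.1 : altCochains K S q).1 ((u⁻¹)⁻¹ • a) = (x.1 : altCochains K S q).1 a :=
    congrFun (congrArg Subtype.val h) a
  rwa [inv_inv] at h'

lemma cochainFun_d {q : ℕ} (x : (cechSections K G S).X q) :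
    cochainFun ((cechSections K G S).d q (q + 1) x) = altDiff (cochainFun x) :=
  cechComplex_d_apply K G S q x.1

/-- The function on `S^(q+1)` underlying a cocycle. -/
def cocycleFun {q : ℕ} : (cechSections K G S).cycles q →ₗ[K] ((Fin (q + 1) → S) → K) :=
  cochainFun ∘ₗ ((cechSections K G S).iCycles q).hom

lemma exists_cocycleFun_eq {q : ℕ} {f : (Fin (q + 1) → S) → K} (hf : f ∈ altCochains K S q)
    (hinv : ∀ (u : G) a, f (u • a) = f a) (hd : altDiff f = 0) :
    ∃ z : (cechSections K G S).cycles q, cocycleFun z = f := by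
  let x : (cechSections K G S).X q :=
    ⟨(⟨f, hf⟩ : altCochains K S q), fun u => Subtype.ext (funext fun a => hinv u⁻¹ a)⟩
  obtain ⟨z, hz⟩ := exists_iCycles_eq (cechSections K G S) q x
    (cochainFun_injective ((cochainFun_d x).trans (hd.trans (map_zero _).symm)))
  exact ⟨z, congrArg cochainFun hz⟩

lemma cocycleFun_eq_zero {z : (cechSections K G S).cycles 0}
    (hz : (cechSections K G S).homologyπ 0 z = 0) : cocycleFun z = 0 :=
  (congrArg cochainFun (iCycles_eq_zero _ hz)).trans (map_zero _)

lemma exists_cocycleFun_eq_altDiff {q : ℕ} {z : (cechSections K G S).cycles (q + 1)}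
    (hz : (cechSections K G S).homologyπ (q + 1) z = 0) :
    ∃ θ ∈ altCochains K S q, (∀ (u : G) a, θ (u • a) = θ a) ∧ cocycleFun z = altDiff θ := by
  obtain ⟨w, hw⟩ := exists_d_eq_iCycles _ hz
  exact ⟨cochainFun w, cochainFun_mem w, cochainFun_smul w,
    (congrArg cochainFun hw).symm.trans (cochainFun_d w)⟩

end Cocycles

section Units

variable {F : Type} [Field F]

lemma eq_one_of_pow_eq_one (τ : F →+* ℝ) {u : (𝓞 F)ˣ} (hu : 0 < τ (u : F)) {k : ℕ}
    (hk : k ≠ 0) (h : u ^ k = 1) : u = 1 := by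
  have pow_eq : τ (u : F) ^ k = 1 := by
    rw [← map_pow, ← map_one τ]
    exact congrArg (fun v : (𝓞 F)ˣ => τ (v : F)) h
  have eq_one : τ (u : F) = τ 1 :=
    ((pow_eq_one_iff_of_nonneg hu.le hk).1 pow_eq).trans (map_one τ).symm
  exact Units.ext (RingOfIntegers.ext (τ.injective eq_one))

lemma isCancelSMul_primitiveSet (ξ : AddChar (𝓞 F) ℂ) (τ : F →+* ℝ) :
    IsCancelSMul (stabilizer ξ) (PrimitiveSet ξ) := by
  refine isCancelSMul_iff_eq_one_of_smul_eq.2 fun u s h => Subtype.ext (Units.ext ?_)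
  have s_ne_zero : s.1 ≠ 0 := fun hs => by simpa [hs] using s.2.1.1 τ
  exact mul_right_cancel₀ s_ne_zero ((congrArg Subtype.val h).trans (one_mul _).symm)

lemma exists_real_embedding [IsTotallyReal F] (φ : F →+* ℂ) :
    ∃ τ : F →+* ℝ, ∀ x, φ x = (τ x : ℂ) :=
  ⟨(IsTotallyReal.complexEmbedding_isReal φ).embedding, fun x =>
    (ComplexEmbedding.IsReal.coe_embedding_apply _ x).symm⟩

lemma mul_inv_mem_stabilizer {ξ : AddChar (𝓞 F) ℂ} {N : ℕ} (hN : ξ ^ N = 1) {u v : (𝓞 F)ˣ}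
    (hu : u ∈ totallyPositiveUnits F) (hv : v ∈ totallyPositiveUnits F)
    (h : (N : 𝓞 F) ∣ v - u) : v * u⁻¹ ∈ stabilizer ξ := by
  obtain ⟨y, hy⟩ := h
  refine ⟨mul_mem hv (inv_mem hu), fun x => ?_⟩
  have trivial_on_multiples (z : 𝓞 F) : ξ ((N : 𝓞 F) * z) = 1 := by
    rw [← nsmul_eq_mul, AddChar.map_nsmul_eq_pow]
    exact DFunLike.congr_fun hN z
  have expand : ((v * u⁻¹ : (𝓞 F)ˣ) : 𝓞 F) * x =
      x + (N : 𝓞 F) * (y * ((u⁻¹ : (𝓞 F)ˣ) : 𝓞 F) * x) := by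
    rw [← mul_assoc, ← mul_assoc, ← hy, Units.val_mul, sub_mul, sub_mul, Units.mul_inv]
    ring
  rw [expand, AddChar.map_add_eq_mul, trivial_on_multiples, mul_one]

variable [NumberField F]

lemma exists_ratio_bound {ι : Type} [Finite ι] {b : ι → F} (hb : ∀ i, TotallyPositive (b i)) :
    ∃ R : ℝ, 0 < R ∧ ∀ i (τ τ' : F →+* ℝ), τ (b i) ≤ R * τ' (b i) := by
  obtain ⟨R, hR⟩ := (Set.finite_range fun x : ι × (F →+* ℝ) × (F →+* ℝ) =>
    x.2.1 (b x.1) / x.2.2 (b x.1)).bddAbove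
  refine ⟨max R 1, by positivity, fun i τ τ' => ?_⟩
  rw [← div_le_iff₀ (hb i τ')]
  exact (hR ⟨(i, τ, τ'), rfl⟩).trans (le_max_left _ _)

theorem finite_coneOrbits {ξ : AddChar (𝓞 F) ℂ} (hξ : IsOfFinOrder ξ) {Γ : Subgroup (𝓞 F)ˣ}
    (hΓ : Γ ≤ totallyPositiveUnits F) {Φ : Set (Set (RealSpace F))}
    (hΦ : IsShintaniDecomposition Γ Φ) (m : ℕ) : Finite (ConeOrbits ξ Φ m) := by
  obtain ⟨N, N_pos, hN⟩ := isOfFinOrder_iff_pow_eq_one.1 hξ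
  have span_ne_bot : Ideal.span {(N : 𝓞 F)} ≠ ⊥ := by
    rw [Ne, Ideal.span_singleton_eq_bot]
    exact_mod_cast N_pos.ne'
  have := Ideal.finiteQuotientOfFreeOfNeBot _ span_ne_bot
  obtain ⟨T, -, T_finite, hT⟩ := hΦ.finite_orbits
  have := T_finite.to_subtype
  choose ρ hρ u hu hσ using fun c : ConeOrbits ξ Φ m => hT _ c.out.2.1
  refine Finite.of_injective (β := T × 𝓞 F ⧸ Ideal.span {(N : 𝓞 F)})
    (fun c => (⟨ρ c, hρ c⟩, (u c : 𝓞 F))) fun c c' h => ?_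
  obtain ⟨ρ_eq, u_eq⟩ := Prod.mk.inj h
  rw [← Quotient.out_eq c, ← Quotient.out_eq c']
  refine Quotient.sound ⟨_, mul_inv_mem_stabilizer hN (hΓ (hu c)) (hΓ (hu c')) ?_, ?_⟩
  · exact Ideal.mem_span_singleton.1 (Ideal.Quotient.eq.1 u_eq.symm)
  · rw [← hσ c, ← hσ c', ← unitScale_mul, inv_mul_cancel_right, Subtype.mk.inj ρ_eq]

variable [IsTotallyReal F]

/-- Dirichlet's unit theorem, for a torsion-free group of units. -/
lemma exists_stabilizer_mulEquiv (ξ : AddChar (𝓞 F) ℂ) (τ : F →+* ℝ) :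
    ∃ r < Module.finrank ℚ F, Nonempty (stabilizer ξ ≃* Multiplicative (Fin r → ℤ)) := by
  let inclusion : Additive (stabilizer ξ) →ₗ[ℤ] Additive (𝓞 F)ˣ :=
    (MonoidHom.toAdditive (stabilizer ξ).subtype).toIntLinearMap
  have inclusion_injective : Function.Injective inclusion := (stabilizer ξ).subtype_injective
  have : Module.Finite ℤ (Additive (stabilizer ξ)) :=
    Module.Finite.of_injective inclusion inclusion_injective
  have : IsMulTorsionFree (stabilizer ξ) := IsMulTorsionFree.of_not_isOfFinOrder fun u u_ne hu => by
    obtain ⟨k, k_pos, hk⟩ := isOfFinOrder_iff_pow_eq_one.1 hu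
    exact u_ne (Subtype.ext
      (eq_one_of_pow_eq_one τ (u.2.1 τ) k_pos.ne' (congrArg Subtype.val hk)))
  have rank_le := LinearMap.finrank_le_finrank_of_injective inclusion_injective
  rw [Units.finrank_eq, Units.rank, InfinitePlace.card_eq_nrRealPlaces_add_nrComplexPlaces,
    IsTotallyReal.nrComplexPlaces_eq_zero, add_zero, ← IsTotallyReal.finrank] at rank_le
  exact ⟨_, rank_le.trans_lt (Nat.sub_one_lt Module.finrank_pos.ne'),
    ⟨AddEquiv.toMultiplicativeRight (Module.finBasis ℤ _).equivFun.toAddEquiv⟩⟩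

theorem rank_homology_cechComplex_le_one (ξ : AddChar (𝓞 F) ℂ) (τ : F →+* ℝ) (s : PrimitiveSet ξ)
    {n : ℕ} (hn : Module.finrank ℚ F = n + 1) :
    Module.rank (valueField ξ) ((CechComplex ξ).homology n) ≤ 1 := by
  obtain ⟨r, r_lt, ⟨e⟩⟩ := exists_stabilizer_mulEquiv ξ τ
  have := isCancelSMul_primitiveSet ξ τ
  have choose_le : r.choose n ≤ 1 :=
    (Nat.choose_le_choose n (Nat.le_of_lt_succ (r_lt.trans_eq hn))).trans_eq (Nat.choose_self n)
  exact (rank_homology_cechSections_le _ _ s e n).trans (mod_cast choose_le)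

lemma exists_embedding_le_one (u : (𝓞 F)ˣ) : ∃ τ : F →+* ℝ, τ (u : F) ≤ 1 := by
  by_contra! hu
  have inv_lt_one (w : InfinitePlace F) : w ((u⁻¹ : (𝓞 F)ˣ) : F) < 1 := by
    obtain ⟨τ, hτ⟩ := exists_real_embedding w.embedding
    rw [← InfinitePlace.norm_embedding_eq, hτ, Complex.norm_real, Real.norm_eq_abs,
      show τ ((u⁻¹ : (𝓞 F)ˣ) : F) = (τ (u : F))⁻¹ by simp, abs_inv]
    exact inv_lt_one_of_one_lt₀ ((hu τ).trans_le (le_abs_self _))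
  obtain ⟨w⟩ := (inferInstance : Nonempty (InfinitePlace F))
  exact (inv_lt_one w).not_ge (InfinitePlace.one_le_of_lt_one (Units.ne_zero _)
    fun z _ => inv_lt_one z)

lemma finite_units_of_le (R : ℝ) :
    {u : (𝓞 F)ˣ | u ∈ totallyPositiveUnits F ∧ ∀ τ : F →+* ℝ, τ (u : F) ≤ R}.Finite := by
  refine Set.Finite.of_finite_image (f := fun u : (𝓞 F)ˣ => (u : F))
    ((Embeddings.finite_of_norm_le F ℂ R).subset ?_)
    fun u _ v _ h => Units.ext (RingOfIntegers.ext h)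
  rintro _ ⟨u, ⟨hu, hR⟩, rfl⟩
  refine ⟨RingOfIntegers.isIntegral_coe _, fun φ => ?_⟩
  obtain ⟨τ, hτ⟩ := exists_real_embedding φ
  rw [hτ, Complex.norm_real, Real.norm_eq_abs, abs_of_pos (hu τ)]
  exact hR τ

lemma finite_units_meeting {ι : Type} [Fintype ι] {b : ι → 𝓞 F}
    (hb : ∀ i, TotallyPositive (b i : F)) {lo hi : ℝ} (hlo : 0 < lo) :
    {u : (𝓞 F)ˣ | u ∈ totallyPositiveUnits F ∧ ∃ p ∈ generatedCone b,
      ∀ τ : F →+* ℝ, lo ≤ τ (u : F) * p τ ∧ τ (u : F) * p τ ≤ hi}.Finite := by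
  obtain ⟨R, R_pos, ratio_le⟩ := exists_ratio_bound hb
  refine (finite_units_of_le (hi / lo * R)).subset ?_
  rintro u ⟨hu, p, ⟨x, x_nonneg, hx⟩, p_mem⟩
  refine ⟨hu, fun τ => ?_⟩
  obtain ⟨τ', u_le_one⟩ := exists_embedding_le_one u
  have p_ratio_le : p τ' ≤ R * p τ := by
    simp only [hx, Finset.sum_apply, Pi.smul_apply, smul_eq_mul, realEmbedding, Finset.mul_sum,
      mul_left_comm R]
    gcongr with i
    · exact x_nonneg i
    · exact ratio_le i τ' τ
  have p_pos : 0 < p τ' := pos_of_mul_pos_right (hlo.trans_le (p_mem τ').1) (hu τ').le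
  have lo_le : lo ≤ R * p τ :=
    (p_mem τ').1.trans ((mul_le_of_le_one_left p_pos.le u_le_one).trans p_ratio_le)
  rw [div_mul_eq_mul_div, le_div_iff₀ hlo]
  calc τ (u : F) * lo ≤ τ (u : F) * (R * p τ) := mul_le_mul_of_nonneg_left lo_le (hu τ).le
    _ = (τ (u : F) * p τ) * R := by ring
    _ ≤ hi * R := mul_le_mul_of_nonneg_right (p_mem τ).2 R_pos.le

end Units

section Cones

open scoped NNReal

variable {E : Type*} [AddCommGroup E] [Module ℝ E] {ι κ : Type*} [Fintype ι] [Fintype κ]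

/-- The closed convex cone generated by a finite family of vectors of a real vector space. It is a
set of explicit combinations, rather than a `Submodule ℝ≥0`, so that `generatedCone a` unfolds to
an instance of it. -/
def vectorCone (v : ι → E) : Set E :=
  {w | ∃ x : ι → ℝ, (∀ i, 0 ≤ x i) ∧ w = ∑ i, x i • v i}

lemma vectorCone_eq_span (v : ι → E) :
    vectorCone v = (Submodule.span ℝ≥0 (Set.range v) : Set E) := by
  ext w
  rw [SetLike.mem_coe, Submodule.mem_span_range_iff_exists_fun]
  constructor
  · rintro ⟨x, hx, rfl⟩
    exact ⟨fun i => ⟨x i, hx i⟩, rfl⟩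
  · rintro ⟨x, rfl⟩
    exact ⟨fun i => x i, fun i => (x i).2, rfl⟩

lemma mem_vectorCone_self (v : ι → E) (i : ι) : v i ∈ vectorCone v := by
  rw [vectorCone_eq_span]
  exact Submodule.subset_span ⟨i, rfl⟩

lemma vectorCone_subset {v : ι → E} {w : κ → E} (h : ∀ i, v i ∈ vectorCone w) :
    vectorCone v ⊆ vectorCone w := by
  simp only [vectorCone_eq_span w] at h ⊢
  rw [vectorCone_eq_span]
  exact Submodule.span_le.2 (Set.range_subset_iff.2 h)

lemma vectorCone_comp_equiv (v : ι → E) (e : κ ≃ ι) : vectorCone (v ∘ e) = vectorCone v := by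
  rw [vectorCone_eq_span, vectorCone_eq_span, e.surjective.range_comp]

lemma vectorCone_image (v : ι → E) (L : E →ₗ[ℝ] E) : L '' vectorCone v = vectorCone (L ∘ v) := by
  rw [vectorCone_eq_span, vectorCone_eq_span, Set.range_comp]
  exact congrArg SetLike.coe
    (Submodule.map_span (L.restrictScalars ℝ≥0) (Set.range v))

lemma span_vectorCone (v : ι → E) :
    Submodule.span ℝ (vectorCone v) = Submodule.span ℝ (Set.range v) := by
  rw [vectorCone_eq_span]
  exact Submodule.span_span_of_tower ℝ≥0 ℝ (Set.range v)

lemma coeff_eq_of_linearIndependent {v : ι → E} (hv : LinearIndependent ℝ v) {x y : ι → ℝ}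
    (h : ∑ i, x i • v i = ∑ i, y i • v i) : x = y :=
  hv.fintypeLinearCombination_injective h

lemma mem_vectorCone_restrict_iff {w : κ → E} {s : Finset κ} {v : E} :
    v ∈ vectorCone (fun k : s => w k) ↔
      ∃ x : κ → ℝ, (∀ k, 0 ≤ x k) ∧ (∀ k ∉ s, x k = 0) ∧ v = ∑ k, x k • w k := by
  classical
  have sum_restrict (x : κ → ℝ) (hx : ∀ k ∉ s, x k = 0) :
      ∑ k, x k • w k = ∑ k : s, x k • w k := by
    rw [Finset.sum_coe_sort s fun k => x k • w k]
    exact (Finset.sum_subset s.subset_univ fun k _ hk => by rw [hx k hk, zero_smul]).symm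
  constructor
  · rintro ⟨x, hx, rfl⟩
    refine ⟨fun k => if hk : k ∈ s then x ⟨k, hk⟩ else 0, fun k => ?_, fun k hk => dif_neg hk, ?_⟩
    · dsimp only
      split
      exacts [hx _, le_rfl]
    · rw [sum_restrict _ fun k hk => dif_neg hk]
      exact Finset.sum_congr rfl fun k _ => by rw [dif_pos k.2]
  · rintro ⟨x, hx, hxs, rfl⟩
    exact ⟨fun k => x k, fun k => hx k, sum_restrict x hxs⟩

/-- Faces of a simplicial cone are extreme: the coefficients outside `s` of the summands are
nonnegative and add up to zero. -/
lemma mem_vectorCone_restrict_of_sum_mem {w : κ → E} (hw : LinearIndependent ℝ w) {s : Finset κ}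
    {u : ι → E} (hu : ∀ i, u i ∈ vectorCone w) (hs : ∑ i, u i ∈ vectorCone fun k : s => w k)
    (i : ι) : u i ∈ vectorCone fun k : s => w k := by
  choose y hy hyu using hu
  obtain ⟨x, -, hxs, hsum⟩ := mem_vectorCone_restrict_iff.1 hs
  have sum_eq : ∑ k, (∑ i, y i k) • w k = ∑ k, x k • w k := by
    simp only [Finset.sum_smul]
    rw [Finset.sum_comm, ← hsum]
    exact Finset.sum_congr rfl fun i _ => (hyu i).symm
  have coeff_eq := coeff_eq_of_linearIndependent hw sum_eq
  refine mem_vectorCone_restrict_iff.2 ⟨y i, hy i, fun k hk => ?_, hyu i⟩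
  exact (Finset.sum_eq_zero_iff_of_nonneg fun i _ => hy i k).1
    ((congrFun coeff_eq k).trans (hxs k hk)) i (Finset.mem_univ i)

/-- A generator spans an extreme ray, so the summands of its expansion in any other generating
family lie on that ray. -/
lemma exists_smul_of_vectorCone_eq {v : ι → E} {w : κ → E} (hv : LinearIndependent ℝ v)
    (hw : ∀ k, w k ≠ 0) (h : vectorCone v = vectorCone w) (i : ι) :
    ∃ k, ∃ c : ℝ, 0 < c ∧ v i = c • w k := by
  obtain ⟨x, hx, hxi⟩ : v i ∈ vectorCone w := h ▸ mem_vectorCone_self v i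
  obtain ⟨k, hk⟩ : ∃ k, x k ≠ 0 := by
    by_contra! hcon
    exact hv.ne_zero i (by simp [hxi, hcon])
  have summand_mem (l : κ) : x l • w l ∈ vectorCone v := by
    rw [h, vectorCone_eq_span]
    exact Submodule.smul_mem _ (⟨x l, hx l⟩ : ℝ≥0) (Submodule.subset_span ⟨l, rfl⟩)
  have sum_mem : ∑ l, x l • w l ∈ vectorCone fun j : ({i} : Finset ι) => v j :=
    hxi ▸ mem_vectorCone_self (fun j : ({i} : Finset ι) => v j) ⟨i, Finset.mem_singleton_self i⟩
  obtain ⟨y, hy, hyw⟩ := mem_vectorCone_restrict_of_sum_mem hv summand_mem sum_mem k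
  set t := y ⟨i, Finset.mem_singleton_self i⟩
  have on_ray : x k • w k = t • v i := by
    rw [hyw, Fintype.sum_unique]
    rfl
  have t_pos : 0 < t := (hy _).lt_of_ne' fun ht =>
    smul_ne_zero hk (hw k) (by rw [on_ray, show t = 0 from ht, zero_smul])
  refine ⟨k, t⁻¹ * x k, mul_pos (inv_pos.2 t_pos) ((hx k).lt_of_ne' hk), ?_⟩
  rw [mul_smul, on_ray, inv_smul_smul₀ t_pos.ne']

variable [TopologicalSpace E] [IsTopologicalAddGroup E] [ContinuousSMul ℝ E] [T2Space E]

lemma mem_interior_vectorCone [FiniteDimensional ℝ E] {v : ι → E}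
    (hv : LinearIndependent ℝ v) (hcard : Fintype.card ι = Module.finrank ℝ E)
    {x : ι → ℝ} (hx : ∀ i, 0 < x i) : ∑ i, x i • v i ∈ interior (vectorCone v) := by
  let b : Module.Basis ι ℝ E := Module.Basis.mk hv
    (hv.span_eq_top_of_card_eq_finrank' hcard).ge
  have b_apply : ⇑b = v := Module.Basis.coe_mk _ _
  rw [← b_apply]
  refine mem_interior.2 ⟨⋂ i, {w | 0 < b.coord i w}, fun w hw => ?_, ?_, ?_⟩
  · exact ⟨fun i => b.coord i w, fun i => (Set.mem_iInter.1 hw i).le, (b.sum_repr w).symm⟩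
  · exact isOpen_iInter_of_finite fun i =>
      isOpen_lt continuous_const (LinearMap.continuous_of_finiteDimensional (b.coord i))
  · refine Set.mem_iInter.2 fun i => ?_
    rw [Set.mem_ofPred_eq, Module.Basis.coord_apply, b.repr_sum_self]
    exact hx i

/-- Far along the common generators, the hyperplanes through the origin containing the other
facets are no longer crossed. -/
lemma nonempty_interior_inter_vectorCone [FiniteDimensional ℝ E] {v v' : ι → E}
    (hv : LinearIndependent ℝ v) (hv' : LinearIndependent ℝ v')
    (hcard : Fintype.card ι = Module.finrank ℝ E) {j : ι} (hvv' : ∀ i, i ≠ j → v' i = v i)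
    {x : ι → ℝ} (hx : v' j = ∑ i, x i • v i) (hxj : 0 < x j) :
    (interior (vectorCone v) ∩ interior (vectorCone v')).Nonempty := by
  classical
  obtain ⟨M, hM, hxM⟩ : ∃ M : ℝ, 0 < M ∧ ∀ i, -x i < M :=
    ((Filter.eventually_gt_atTop 0).and
      (Filter.eventually_all.2 fun i => Filter.eventually_gt_atTop (-x i))).exists
  have same_point : ∑ i, (x i + if i = j then 0 else M) • v i =
      ∑ i, (if i = j then 1 else M) • v' i := by
    simp only [add_smul, Finset.sum_add_distrib, ← hx]
    rw [Fintype.sum_eq_add_sum_compl j, Fintype.sum_eq_add_sum_compl j]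
    simp only [if_true, one_smul, zero_smul, zero_add]
    congr 1
    refine Finset.sum_congr rfl fun i hi => ?_
    have hij : i ≠ j := by simpa using hi
    rw [if_neg hij, if_neg hij, hvv' i hij]
  have mem_left := mem_interior_vectorCone hv hcard (x := fun i => x i + if i = j then 0 else M)
    fun i => by
      split_ifs with hij
      · rwa [hij, add_zero]
      · linarith [hxM i]
  have mem_right := mem_interior_vectorCone hv' hcard (x := fun i => if i = j then 1 else M)
    fun i => by
      split_ifs
      exacts [one_pos, hM]
  exact ⟨_, mem_left, same_point ▸ mem_right⟩

lemma isClosed_vectorCone {v : ι → E} (hv : LinearIndependent ℝ v) :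
    IsClosed (vectorCone v) := by
  have eq_image : vectorCone v = Fintype.linearCombination ℝ v '' Set.Ici 0 := by
    ext w
    exact exists_congr fun x => and_congr_right fun _ => eq_comm
  rw [eq_image]
  exact (LinearMap.isClosedEmbedding_of_injective (LinearMap.ker_eq_bot.2
    hv.fintypeLinearCombination_injective)).isClosedMap _ isClosed_Ici

end Cones

section Determinant

variable {F : Type} [Field F] {n : ℕ} (τ : Fin n ≃ (F →+* ℝ))

/-- The standard basis of `ℝ^I`, ordered by a numbering of the set `I` of embeddings. -/
def spaceBasis : Module.Basis (Fin n) ℝ (RealSpace F) :=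
  Module.Basis.ofEquivFun (LinearEquiv.funCongrLeft ℝ ℝ τ)

lemma spaceBasis_det_apply (v : Fin n → RealSpace F) :
    (spaceBasis τ).det v = Matrix.det (Matrix.of fun i j => v j (τ i)) :=
  rfl

lemma det_ne_zero_iff (v : Fin n → RealSpace F) :
    (spaceBasis τ).det v ≠ 0 ↔ LinearIndependent ℝ v := by
  have := (spaceBasis τ).finiteDimensional_of_finite
  have finrank_eq := (Module.finrank_eq_card_basis (spaceBasis τ)).symm
  rw [← isUnit_iff_ne_zero, ← Module.Basis.is_basis_iff_det]
  exact and_iff_left_of_imp fun h => h.span_eq_top_of_card_eq_finrank' finrank_eq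

lemma det_update_sum (v : Fin n → RealSpace F) (j : Fin n) (x : Fin n → ℝ) :
    (spaceBasis τ).det (Function.update v j (∑ i, x i • v i)) = x j * (spaceBasis τ).det v := by
  rw [AlternatingMap.map_update_sum, Finset.sum_eq_single j]
  · rw [AlternatingMap.map_update_smul, Function.update_eq_self, smul_eq_mul]
  · intro i _ hij
    rw [AlternatingMap.map_update_smul, AlternatingMap.map_update_self _ _ hij.symm, smul_zero]
  · simp

/-- Cramer's rule for two families which differ at one place. -/
lemma coeff_mul_det_eq {v w : Fin n → RealSpace F} {j : Fin n} (hvw : ∀ i, i ≠ j → v i = w i)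
    {x y : Fin n → ℝ} (h : ∑ i, x i • v i = ∑ i, y i • w i) :
    x j * (spaceBasis τ).det v = y j * (spaceBasis τ).det w := by
  rw [← det_update_sum, ← det_update_sum, h]
  congr 1
  funext i
  rcases eq_or_ne i j with rfl | hij
  · rw [Function.update_self, Function.update_self]
  · rw [Function.update_of_ne hij, Function.update_of_ne hij, hvw i hij]

/-- The action of a unit on `ℝ^I`, scaling the coordinate at `σ` by `σ u`. -/
def unitMul (u : (𝓞 F)ˣ) : RealSpace F →ₗ[ℝ] RealSpace F where
  toFun v σ := σ (u : F) * v σ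
  map_add' _ _ := funext fun _ => mul_add _ _ _
  map_smul' _ _ := funext fun _ => mul_left_comm _ _ _

lemma unitMul_apply (u : (𝓞 F)ˣ) (v : RealSpace F) (σ : F →+* ℝ) :
    unitMul u v σ = σ (u : F) * v σ := rfl

lemma unitScale_eq_image (u : (𝓞 F)ˣ) (σ : Set (RealSpace F)) : unitScale u σ = unitMul u '' σ :=
  rfl

lemma unitMul_realEmbedding (u : (𝓞 F)ˣ) (x : 𝓞 F) :
    unitMul u (realEmbedding (x : F)) = realEmbedding (((u : 𝓞 F) * x : 𝓞 F) : F) := by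
  funext σ
  simp [unitMul_apply, realEmbedding]

lemma unitMul_mul (u v : (𝓞 F)ˣ) (w : RealSpace F) :
    unitMul (u * v) w = unitMul u (unitMul v w) := by
  funext σ
  simp [unitMul_apply, mul_assoc]

lemma unitMul_one (w : RealSpace F) : unitMul 1 w = w := by
  funext σ
  simp [unitMul_apply]

lemma unitMul_inv_cancel (u : (𝓞 F)ˣ) (w : RealSpace F) : unitMul u⁻¹ (unitMul u w) = w := by
  rw [← unitMul_mul, inv_mul_cancel, unitMul_one]

lemma unitScale_generatedCone {ι : Type} [Fintype ι] (u : (𝓞 F)ˣ) (a : ι → 𝓞 F) :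
    unitScale u (generatedCone a) = generatedCone fun i => (u : 𝓞 F) * a i :=
  (vectorCone_image (fun i => realEmbedding (a i : F)) (unitMul u)).trans
    (congrArg vectorCone (funext fun i => unitMul_realEmbedding u (a i)))

lemma det_unitMul (u : (𝓞 F)ˣ) (v : Fin n → RealSpace F) :
    (spaceBasis τ).det (fun j => unitMul u (v j)) =
      (∏ i, τ i (u : F)) * (spaceBasis τ).det v := by
  rw [spaceBasis_det_apply, spaceBasis_det_apply, ← Matrix.det_mul_column]
  rfl

end Determinant

section Primitive

variable {F : Type} [Field F]

lemma IsPrimitiveElement.eq_one_of_coprime {x y : 𝓞 F} (hx : IsPrimitiveElement x)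
    {p d : ℕ} (hp : 0 < p) (hpd : Nat.Coprime p d) (h : (d : 𝓞 F) * x = (p : 𝓞 F) * y) : p = 1 := by
  obtain ⟨r, s, hrs⟩ := Nat.isCoprime_iff_coprime.2 hpd
  have bezout : (r : 𝓞 F) * p + (s : 𝓞 F) * d = 1 := by
    exact_mod_cast congrArg (Int.cast (R := 𝓞 F)) hrs
  have p_dvd : (p : 𝓞 F) * (r * x + s * y) = x := by linear_combination x * bezout - s * h
  by_contra p_ne_one
  refine hx.2 p (by omega) (r * x + s * y) (fun τ => ?_) p_dvd
  have embedded : (p : ℝ) * τ ((r * x + s * y : 𝓞 F) : F) = τ (x : F) := by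
    rw [← map_natCast τ, ← map_mul]
    exact congrArg (fun z : 𝓞 F => τ (z : F)) p_dvd
  exact pos_of_mul_pos_right (embedded ▸ hx.1 τ) (Nat.cast_nonneg p)

lemma IsPrimitiveElement.eq_of_eq_rat_mul {x y : 𝓞 F} (hx : IsPrimitiveElement x)
    (hy : IsPrimitiveElement y) [CharZero F] {r : ℚ} (hr : 0 < r) (h : (x : F) = r * y) :
    x = y := by
  have natAbs_num : (r.num.natAbs : F) = r.num := by
    rw [Nat.cast_natAbs, abs_of_pos (Rat.num_pos.2 hr)]
  have den_mul : (r.den : 𝓞 F) * x = (r.num.natAbs : 𝓞 F) * y := by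
    refine RingOfIntegers.ext (?_ : (r.den : F) * (x : F) = (r.num.natAbs : F) * (y : F))
    rw [h, natAbs_num, ← mul_assoc]
    exact_mod_cast congrArg (fun q : ℚ => (q : F) * (y : F)) (Rat.den_mul_eq_num r)
  have num_eq_one := hx.eq_one_of_coprime (Int.natAbs_pos.2 (Rat.num_pos.2 hr).ne') r.reduced
    den_mul
  have den_eq_one := hy.eq_one_of_coprime r.den_pos r.reduced.symm den_mul.symm
  simpa [num_eq_one, den_eq_one] using den_mul

variable [NumberField F] [IsTotallyReal F]

lemma nonempty_realEmbeddings (F : Type) [Field F] [NumberField F] [IsTotallyReal F] :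
    Nonempty (F →+* ℝ) := by
  obtain ⟨φ⟩ := (inferInstance : Nonempty (F →+* ℂ))
  obtain ⟨τ, -⟩ := exists_real_embedding φ
  exact ⟨τ⟩

/-- The trace of such an `x` is `[F : ℚ] * c`. -/
lemma exists_rat_of_embeddings_eq {x : F} {c : ℝ} (h : ∀ τ : F →+* ℝ, τ x = c) :
    ∃ r : ℚ, x = r := by
  have apply_eq (σ : F →ₐ[ℚ] ℂ) : σ x = c := by
    obtain ⟨τ, hτ⟩ := exists_real_embedding (σ : F →+* ℂ)
    exact (hτ x).trans (by rw [h τ])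
  have trace_eq : (Algebra.trace ℚ F x : ℂ) = Module.finrank ℚ F * c := by
    simpa [apply_eq, AlgHom.card] using trace_eq_sum_embeddings ℂ (K := ℚ) (x := x)
  have finrank_ne_zero : (Module.finrank ℚ F : ℂ) ≠ 0 :=
    Nat.cast_ne_zero.2 Module.finrank_pos.ne'
  refine ⟨Algebra.trace ℚ F x / Module.finrank ℚ F, ?_⟩
  have σ : F →ₐ[ℚ] ℂ := IsAlgClosed.lift
  refine σ.toRingHom.injective ((apply_eq σ).trans ?_)
  rw [map_ratCast, Rat.cast_div, trace_eq, Rat.cast_natCast, mul_div_cancel_left₀ _ finrank_ne_zero]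

/-- The ratio of the two elements has all its conjugates equal, so it is a rational number. -/
lemma IsPrimitiveElement.eq_of_smul {x y : 𝓞 F} (hx : IsPrimitiveElement x)
    (hy : IsPrimitiveElement y) {c : ℝ}
    (h : realEmbedding (x : F) = c • realEmbedding (y : F)) : x = y := by
  obtain ⟨τ⟩ := nonempty_realEmbeddings F
  have y_ne_zero : (y : F) ≠ 0 := (map_ne_zero τ).1 (hy.1 τ).ne'
  obtain ⟨r, hr⟩ := exists_rat_of_embeddings_eq (x := (x : F) / (y : F)) (c := c) fun τ => by
    rw [map_div₀, div_eq_iff ((map_ne_zero τ).2 y_ne_zero)]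
    exact congrFun h τ
  have r_pos : (0 : ℝ) < r := by
    rw [← map_ratCast τ, ← hr, map_div₀]
    exact div_pos (hx.1 τ) (hy.1 τ)
  exact hx.eq_of_eq_rat_mul hy (Rat.cast_pos.1 r_pos) (by rw [← hr, div_mul_cancel₀ _ y_ne_zero])

end Primitive

section Fans

variable {F : Type} [Field F] {ξ : AddChar (𝓞 F) ℂ}

/-- The images in `ℝ^I` of a tuple in `A_ξ`. -/
def tupleVec {ι : Type} (a : ι → PrimitiveSet ξ) (i : ι) : RealSpace F :=
  realEmbedding ((a i).1 : F)

/-- The cone `σ_a` of a tuple `a` in `A_ξ`. -/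
def tupleCone {ι : Type} [Fintype ι] (a : ι → PrimitiveSet ξ) : Set (RealSpace F) :=
  generatedCone fun i => (a i).1

lemma tupleCone_eq {ι : Type} [Fintype ι] (a : ι → PrimitiveSet ξ) :
    tupleCone a = vectorCone (tupleVec a) := rfl

lemma tupleVec_pos {ι : Type} (a : ι → PrimitiveSet ξ) (i : ι) (τ : F →+* ℝ) :
    0 < tupleVec a i τ := (a i).2.1.1 τ

lemma tupleVec_ne_zero (τ : F →+* ℝ) {ι : Type} (a : ι → PrimitiveSet ξ) (i : ι) :
    tupleVec a i ≠ 0 := fun h => (tupleVec_pos a i τ).ne' (congrFun h τ)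

lemma injective_of_linearIndependent {ι : Type} {a : ι → PrimitiveSet ξ}
    (ha : LinearIndependent ℝ (tupleVec a)) : Function.Injective a := fun _ _ hij =>
  ha.injective (congrArg (fun s : PrimitiveSet ξ => realEmbedding (s.1 : F)) hij)

lemma coneDim_vectorCone {m : ℕ} {v : Fin m → RealSpace F} (hv : LinearIndependent ℝ v) :
    coneDim (vectorCone v) = m := by
  rw [coneDim, span_vectorCone, finrank_span_eq_card hv, Fintype.card_fin]

lemma linearIndependent_of_coneDim {m : ℕ} {v : Fin m → RealSpace F}
    (h : coneDim (vectorCone v) = m) : LinearIndependent ℝ v := by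
  rw [linearIndependent_iff_card_eq_finrank_span, Fintype.card_fin, Set.finrank, ← span_vectorCone]
  exact h.symm

lemma HasGeneratorsIn.exists_tuple {Φ : Set (Set (RealSpace F))} (hgen : HasGeneratorsIn ξ Φ)
    {σ : Set (RealSpace F)} (hσ : σ ∈ Φ) {m : ℕ} (hm : coneDim σ = m) :
    ∃ a : Fin m → PrimitiveSet ξ, tupleCone a = σ := by
  subst hm
  exact hgen σ hσ

/-- The tuple `a` generates a full-dimensional cone of `Φ`, when `m` is the degree of the field. -/
def IsTopTuple (Φ : Set (Set (RealSpace F))) {m : ℕ} (a : Fin m → PrimitiveSet ξ) : Prop :=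
  tupleCone a ∈ Φ ∧ LinearIndependent ℝ (tupleVec a)

lemma IsTopTuple.comp_perm {Φ : Set (Set (RealSpace F))} {m : ℕ} {a : Fin m → PrimitiveSet ξ}
    (ha : IsTopTuple Φ a) (ρ : Equiv.Perm (Fin m)) : IsTopTuple Φ (a ∘ ρ) :=
  ⟨Set.mem_of_eq_of_mem (vectorCone_comp_equiv (tupleVec a) ρ) ha.1, ha.2.comp _ ρ.injective⟩

lemma finiteDimensional_realSpace {n : ℕ} (τ : Fin n ≃ (F →+* ℝ)) :
    FiniteDimensional ℝ (RealSpace F) :=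
  (spaceBasis τ).finiteDimensional_of_finite

lemma finrank_realSpace {n : ℕ} (τ : Fin n ≃ (F →+* ℝ)) :
    Module.finrank ℝ (RealSpace F) = n := by
  rw [Module.finrank_eq_card_basis (spaceBasis τ), Fintype.card_fin]

variable {Φ : Set (Set (RealSpace F))} {Γ : Subgroup (𝓞 F)ˣ}

lemma IsShintaniDecomposition.exists_mem (hΦ : IsShintaniDecomposition Γ Φ) {v : RealSpace F}
    (hv : ∀ τ, 0 < v τ) : ∃ σ ∈ Φ, v ∈ intrinsicInterior ℝ σ := by
  have mem_union : v ∈ ⋃ σ ∈ Φ, intrinsicInterior ℝ σ := hΦ.iUnion_interior ▸ Or.inl hv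
  simpa only [Set.mem_iUnion, exists_prop] using mem_union

variable [NumberField F] [IsTotallyReal F]

lemma primitiveSet_eq_of_smul {s s' : PrimitiveSet ξ} {c : ℝ}
    (h : realEmbedding (s.1 : F) = c • realEmbedding (s'.1 : F)) : s = s' :=
  Subtype.ext (s.2.1.eq_of_smul s'.2.1 h)

lemma exists_perm_of_tupleCone_eq {m : ℕ} {a c : Fin m → PrimitiveSet ξ}
    (ha : LinearIndependent ℝ (tupleVec a)) (h : tupleCone a = tupleCone c) :
    ∃ ρ : Equiv.Perm (Fin m), a = c ∘ ρ := by
  obtain ⟨τ⟩ := nonempty_realEmbeddings F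
  choose k r _ hk using exists_smul_of_vectorCone_eq ha (tupleVec_ne_zero τ c) h
  have a_eq (i : Fin m) : a i = c (k i) := primitiveSet_eq_of_smul (hk i)
  have k_injective : Function.Injective k := fun i j hij =>
    injective_of_linearIndependent ha (by rw [a_eq i, a_eq j, hij])
  exact ⟨Equiv.ofBijective k (Finite.injective_iff_bijective.1 k_injective), funext a_eq⟩

lemma mem_range_of_isFace {ι κ : Type} [Fintype ι] [Fintype κ] {a : ι → PrimitiveSet ξ}
    {c : κ → PrimitiveSet ξ} (ha : LinearIndependent ℝ (tupleVec a))
    (h : IsFace (tupleCone a) (tupleCone c)) (i : ι) : a i ∈ Set.range c := by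
  obtain ⟨τ⟩ := nonempty_realEmbeddings F
  obtain ⟨m, b, ⟨b_pos, hb, hbc⟩, s, hs⟩ := h
  have b_ne_zero (l : s) : realEmbedding (b l : F) ≠ 0 := fun h0 =>
    (b_pos l τ).ne' (congrFun h0 τ)
  obtain ⟨l, r, -, hl⟩ := exists_smul_of_vectorCone_eq ha b_ne_zero hs i
  obtain ⟨k, r', -, hk⟩ := exists_smul_of_vectorCone_eq hb (tupleVec_ne_zero τ c) hbc l
  refine ⟨k, (primitiveSet_eq_of_smul (c := r * r') ?_).symm⟩
  rw [mul_smul]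
  exact hl.trans (congrArg (r • ·) hk)

lemma finite_cones_meeting (hΦ : IsShintaniDecomposition Γ Φ) (hΓ : Γ ≤ totallyPositiveUnits F)
    {lo hi : ℝ} (hlo : 0 < lo) :
    {σ ∈ Φ | ∃ p ∈ σ, ∀ τ : F →+* ℝ, lo ≤ p τ ∧ p τ ≤ hi}.Finite := by
  obtain ⟨T, hTΦ, T_finite, hT⟩ := hΦ.finite_orbits
  have units_finite : ∀ ρ ∈ T, {u : (𝓞 F)ˣ | u ∈ totallyPositiveUnits F ∧ ∃ p ∈ ρ,
      ∀ τ : F →+* ℝ, lo ≤ τ (u : F) * p τ ∧ τ (u : F) * p τ ≤ hi}.Finite := fun ρ hρ => by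
    obtain ⟨m, b, hb, -, rfl⟩ := hΦ.simplicial ρ (hTΦ hρ)
    exact finite_units_meeting hb hlo
  refine (T_finite.biUnion fun ρ hρ => (units_finite ρ hρ).image fun u => unitScale u ρ).subset ?_
  rintro σ ⟨hσ, p, hp, p_bounds⟩
  obtain ⟨ρ, hρ, u, hu, rfl⟩ := hT σ hσ
  obtain ⟨p, hp, rfl⟩ := hp
  exact Set.mem_biUnion hρ ⟨u, ⟨hΓ hu, p, hp, p_bounds⟩, rfl⟩

end Fans

section Facets

open NumberField Filter Topology

variable {F : Type} [Field F] {ξ : AddChar (𝓞 F) ℂ}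

/-- The sign `sgn a` of `det (τ_i (a_j))` for a tuple `a` in `A_ξ`. -/
def tupleSign {n : ℕ} (τ : Fin n ≃ (F →+* ℝ)) (a : Fin n → PrimitiveSet ξ) : ℤ :=
  orientation τ fun i => (a i).1

lemma tupleSign_eq {n : ℕ} (τ : Fin n ≃ (F →+* ℝ)) (a : Fin n → PrimitiveSet ξ) :
    tupleSign τ a = SignType.sign ((spaceBasis τ).det (tupleVec a)) :=
  rfl

lemma tupleSign_comp_perm {n : ℕ} (τ : Fin n ≃ (F →+* ℝ)) (a : Fin n → PrimitiveSet ξ)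
    (ρ : Equiv.Perm (Fin n)) : tupleSign τ (a ∘ ρ) = Equiv.Perm.sign ρ * tupleSign τ a := by
  have det_comp : (spaceBasis τ).det (tupleVec (a ∘ ρ)) =
      Equiv.Perm.sign ρ • (spaceBasis τ).det (tupleVec a) :=
    (spaceBasis τ).det.map_perm (tupleVec a) ρ
  rw [tupleSign_eq, tupleSign_eq, det_comp]
  rcases Int.units_eq_one_or (Equiv.Perm.sign ρ) with h | h <;> rw [h] <;> simp [Left.sign_neg]

lemma unitScale_tupleCone {ι : Type} [Fintype ι] (u : stabilizer ξ) (a : ι → PrimitiveSet ξ) :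
    unitScale (u : (𝓞 F)ˣ) (tupleCone a) = tupleCone (u • a) :=
  unitScale_generatedCone (u : (𝓞 F)ˣ) fun i => (a i).1

lemma tupleVec_smul {ι : Type} (u : stabilizer ξ) (a : ι → PrimitiveSet ξ) :
    tupleVec (u • a) = unitMul (u : (𝓞 F)ˣ) ∘ tupleVec a :=
  funext fun i => (unitMul_realEmbedding (u : (𝓞 F)ˣ) (a i).1).symm

lemma tupleSign_smul {n : ℕ} (τ : Fin n ≃ (F →+* ℝ)) (u : stabilizer ξ)
    (a : Fin n → PrimitiveSet ξ) : tupleSign τ (u • a) = tupleSign τ a := by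
  have norm_pos : 0 < ∏ i, τ i ((u : (𝓞 F)ˣ) : F) := Finset.prod_pos fun i _ => u.2.1 (τ i)
  rw [tupleSign_eq, tupleSign_eq, tupleVec_smul]
  exact congrArg SignType.cast
    ((congrArg SignType.sign (det_unitMul τ (u : (𝓞 F)ˣ) (tupleVec a))).trans
      (by rw [sign_mul, sign_pos norm_pos, one_mul]))

lemma unitMul_injective (u : (𝓞 F)ˣ) : Function.Injective (unitMul u) :=
  Function.LeftInverse.injective (unitMul_inv_cancel u)

lemma linearIndependent_smul {ι : Type} (u : stabilizer ξ) {a : ι → PrimitiveSet ξ}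
    (ha : LinearIndependent ℝ (tupleVec a)) : LinearIndependent ℝ (tupleVec (u • a)) := by
  rw [tupleVec_smul]
  exact ha.map' _ (LinearMap.ker_eq_bot.2 (unitMul_injective _))

lemma tupleSign_mul_self {n : ℕ} (τ : Fin n ≃ (F →+* ℝ)) {a : Fin n → PrimitiveSet ξ}
    (ha : LinearIndependent ℝ (tupleVec a)) : tupleSign τ a * tupleSign τ a = 1 := by
  rw [tupleSign_eq]
  rcases ((det_ne_zero_iff τ _).2 ha).lt_or_gt with h | h
  · simp [sign_neg h]
  · simp [sign_pos h]

lemma sign_mul_tupleSign_eq {n : ℕ} (τ : Fin n ≃ (F →+* ℝ)) {a c : Fin n → PrimitiveSet ξ}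
    {j : Fin n} (hac : ∀ i, i ≠ j → a i = c i) {x y : Fin n → ℝ}
    (h : ∑ i, x i • tupleVec a i = ∑ i, y i • tupleVec c i) :
    (SignType.sign (x j) : ℤ) * tupleSign τ a = (SignType.sign (y j) : ℤ) * tupleSign τ c := by
  have vec_eq (i : Fin n) (hij : i ≠ j) : tupleVec a i = tupleVec c i :=
    congrArg (fun s : PrimitiveSet ξ => realEmbedding (s.1 : F)) (hac i hij)
  rw [tupleSign_eq, tupleSign_eq, ← SignType.coe_mul, ← SignType.coe_mul, ← sign_mul, ← sign_mul,
    coeff_mul_det_eq τ vec_eq h]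

variable {Φ : Set (Set (RealSpace F))} {Γ : Subgroup (𝓞 F)ˣ}

lemma IsTopTuple.smul (hΦ : IsShintaniDecomposition Γ Φ) (hΓ : stabilizer ξ ≤ Γ) {m : ℕ}
    {a : Fin m → PrimitiveSet ξ} (ha : IsTopTuple Φ a) (u : stabilizer ξ) :
    IsTopTuple Φ (u • a) :=
  ⟨unitScale_tupleCone u a ▸ hΦ.unitScale_mem _ ha.1 _ (hΓ u.2), linearIndependent_smul u ha.2⟩

lemma facet_isFace {n : ℕ} {a : Fin (n + 1) → PrimitiveSet ξ}
    (ha : LinearIndependent ℝ (tupleVec a)) (j : Fin (n + 1)) :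
    IsFace (tupleCone (a ∘ j.succAbove)) (tupleCone a) := by
  let e : Fin n ≃ {i // i ∈ ({j}ᶜ : Finset (Fin (n + 1)))} :=
    (finSuccAboveEquiv j).trans (Equiv.subtypeEquivRight fun i => by simp)
  exact ⟨n + 1, fun i => (a i).1, ⟨fun i => (a i).2.1.1, ha, rfl⟩, {j}ᶜ,
    vectorCone_comp_equiv (fun i : {i // i ∈ ({j}ᶜ : Finset (Fin (n + 1)))} => tupleVec a i) e⟩

lemma IsSimplicialFan.isClosed (hΦ : IsSimplicialFan Φ) {σ : Set (RealSpace F)} (hσ : σ ∈ Φ) :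
    IsClosed σ := by
  obtain ⟨m, b, -, hb, rfl⟩ := hΦ.simplicial σ hσ
  exact isClosed_vectorCone hb

lemma sum_mem_tupleCone {ι : Type} [Fintype ι] (b : ι → PrimitiveSet ξ) :
    ∑ i, tupleVec b i ∈ tupleCone b :=
  ⟨fun _ => 1, fun _ => zero_le_one, Finset.sum_congr rfl fun _ _ => (one_smul _ _).symm⟩

/-- The intersection with `σ` is a face of the cone of `b` containing the sum of the generators,
hence is the whole cone. -/
lemma IsSimplicialFan.tupleCone_subset (hΦ : IsSimplicialFan Φ) {ι : Type} [Fintype ι]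
    {b : ι → PrimitiveSet ξ} {σ : Set (RealSpace F)} (hb : tupleCone b ∈ Φ) (hσ : σ ∈ Φ)
    (h : ∑ i, tupleVec b i ∈ σ) : tupleCone b ⊆ σ := by
  obtain ⟨m, b', ⟨-, hb', hbb'⟩, s, hs⟩ := (hΦ.inter_isFace _ hb σ hσ).1
  have generator_mem (i : ι) : tupleVec b i ∈ vectorCone fun k : s => realEmbedding (b' k : F) :=
    mem_vectorCone_restrict_of_sum_mem (w := fun k => realEmbedding (b' k : F)) hb'
      (fun i => hbb'.ge (mem_vectorCone_self (tupleVec b) i)) (hs.le ⟨sum_mem_tupleCone b, h⟩) i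
  exact (vectorCone_subset generator_mem).trans (hs.ge.trans Set.inter_subset_right)

lemma coneDim_eq_of_mem_span {n : ℕ} (τ : Fin n ≃ (F →+* ℝ)) {v : Fin n → RealSpace F}
    (hv : LinearIndependent ℝ v) {σ : Set (RealSpace F)}
    (h : ∀ i, v i ∈ Submodule.span ℝ σ) : coneDim σ = n := by
  have := finiteDimensional_realSpace τ
  have span_eq_top : Submodule.span ℝ σ = ⊤ := by
    rw [eq_top_iff, ← hv.span_eq_top_of_card_eq_finrank'
      (by rw [finrank_realSpace τ, Fintype.card_fin]), Submodule.span_le]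
    exact Set.range_subset_iff.2 h
  rw [coneDim, span_eq_top, finrank_top, finrank_realSpace τ]

lemma exists_perm_comp_eqOn {ι α : Type*} [Finite ι] {a c : ι → α} {s : Set ι}
    (ha : s.InjOn a) (h : ∀ i ∈ s, a i ∈ Set.range c) :
    ∃ ρ : Equiv.Perm ι, s.EqOn (c ∘ ρ) a := by
  classical
  have := Fintype.ofFinite ι
  choose! l hl using h
  have l_injOn : s.InjOn l := fun i hi k hk hik => ha hi hk (by rw [← hl i hi, ← hl k hk, hik])
  obtain ⟨g, hg⟩ := Set.MapsTo.exists_equiv_extend_of_card_eq (t := Finset.univ) rfl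
    (fun i _ => Finset.mem_coe.2 (Finset.mem_univ (l i))) l_injOn
  refine ⟨g.trans (Equiv.subtypeUnivEquiv Finset.mem_univ), fun i hi => ?_⟩
  exact (congrArg c (hg i hi)).trans (hl i hi)

variable [NumberField F] [IsTotallyReal F]

/-- If the new generator is on the same side of the facet, the interiors of the two cones meet. -/
lemma IsTopTuple.eq_of_eqOn {n : ℕ} (hΦ : IsShintaniDecomposition Γ Φ)
    (τ : Fin n ≃ (F →+* ℝ)) {a a' : Fin n → PrimitiveSet ξ}
    (ha : IsTopTuple Φ a) (ha' : IsTopTuple Φ a') (j : Fin n) (hj : ∀ k, k ≠ j → a' k = a k)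
    (hs : tupleSign τ a = tupleSign τ a') : a = a' := by
  have := finiteDimensional_realSpace τ
  have card_eq : Fintype.card (Fin n) = Module.finrank ℝ (RealSpace F) := by
    rw [finrank_realSpace τ, Fintype.card_fin]
  obtain ⟨x, hx⟩ := (Submodule.mem_span_range_iff_exists_fun ℝ).1
    ((ha.2.span_eq_top_of_card_eq_finrank' card_eq).ge (Submodule.mem_top (x := tupleVec a' j)))
  have sign_eq := sign_mul_tupleSign_eq τ hj (x := Pi.single j 1) (y := x)
    (by rw [hx]; simp [Pi.single_apply])
  have sign_ne_zero : tupleSign τ a' ≠ 0 := fun h0 => by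
    simpa [h0] using tupleSign_mul_self τ ha'.2
  rw [hs, Pi.single_eq_same] at sign_eq
  have x_pos : 0 < x j := by
    have sign_cast := mul_right_cancel₀ sign_ne_zero sign_eq
    rcases lt_trichotomy (x j) 0 with h | h | h
    · simp [sign_neg h] at sign_cast
    · simp [h] at sign_cast
    · exact h
  obtain ⟨p, hp, hp'⟩ := nonempty_interior_inter_vectorCone ha.2 ha'.2 card_eq
    (fun i hi => congrArg (fun s : PrimitiveSet ξ => realEmbedding (s.1 : F)) (hj i hi))
    hx.symm x_pos
  have cone_eq : tupleCone a = tupleCone a' := hΦ.disjoint_interior.elim_set ha.1 ha'.1 p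
    (interior_subset_intrinsicInterior hp) (interior_subset_intrinsicInterior hp')
  obtain ⟨ρ, rfl⟩ := exists_perm_of_tupleCone_eq ha.2 cone_eq
  have fixed : ∀ k, k ≠ j → ρ k = k := fun k hk =>
    (injective_of_linearIndependent ha'.2 (hj k hk)).symm
  have : ρ = 1 := Equiv.ext fun k => by
    rcases eq_or_ne k j with rfl | hk
    · by_contra hne
      exact hne (ρ.injective (fixed _ hne))
    · exact fixed k hk
  rw [this]
  rfl

/-- The cones of `Φ` which meet a small box around `y` are finite in number and closed. -/
lemma IsShintaniDecomposition.eventually_exists_mem (hΦ : IsShintaniDecomposition Γ Φ)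
    (hΓ : Γ ≤ totallyPositiveUnits F) {y : RealSpace F} (hy : ∀ σ, 0 < y σ) :
    ∀ᶠ p in 𝓝 y, ∃ σ ∈ Φ, y ∈ σ ∧ p ∈ σ := by
  have := nonempty_realEmbeddings F
  obtain ⟨σ₀, hσ₀⟩ := Finite.exists_min y
  obtain ⟨σ₁, hσ₁⟩ := Finite.exists_max y
  set lo := y σ₀ / 2
  set hi := y σ₁ + 1
  have lo_pos : 0 < lo := half_pos (hy σ₀)
  have in_box : ∀ᶠ p in 𝓝 y, ∀ σ, lo ≤ p σ ∧ p σ ≤ hi := eventually_all.2 fun σ =>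
    (continuous_apply σ).tendsto y (Icc_mem_nhds ((half_lt_self (hy σ₀)).trans_le (hσ₀ σ))
      ((hσ₁ σ).trans_lt (lt_add_one _)))
  let W : Set (Set (RealSpace F)) := {σ ∈ Φ | ∃ p ∈ σ, ∀ τ : F →+* ℝ, lo ≤ p τ ∧ p τ ≤ hi}
  have W_finite : W.Finite := finite_cones_meeting hΦ hΓ lo_pos
  have avoids : ∀ᶠ p in 𝓝 y, ∀ σ ∈ W, y ∉ σ → p ∉ σ := by
    refine (W_finite.eventually_all).2 fun σ hσ => ?_
    by_cases hyσ : y ∈ σ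
    · exact .of_forall fun _ h => (h hyσ).elim
    · filter_upwards [(hΦ.toIsSimplicialFan.isClosed hσ.1).isOpen_compl.mem_nhds hyσ] with p hp _
      exact hp
  filter_upwards [in_box, avoids] with p p_in_box p_avoids
  obtain ⟨σ, hσ, hpσ⟩ := hΦ.exists_mem fun τ => lo_pos.trans_le (p_in_box τ).1
  have p_mem := intrinsicInterior_subset hpσ
  refine ⟨σ, hσ, ?_, p_mem⟩
  by_contra hyσ
  exact p_avoids σ ⟨hσ, p, p_mem, p_in_box⟩ hyσ p_mem

/-- Move from the middle of a facet slightly away from the opposite vertex. -/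
lemma IsTopTuple.exists_cone_across {n : ℕ} (hΦ : IsShintaniDecomposition Γ Φ)
    (hΓ : Γ ≤ totallyPositiveUnits F) (τ : Fin (n + 2) ≃ (F →+* ℝ))
    {a : Fin (n + 2) → PrimitiveSet ξ} (ha : IsTopTuple Φ a) (j : Fin (n + 2)) :
    ∃ σ ∈ Φ, coneDim σ = n + 2 ∧ IsFace (tupleCone (a ∘ j.succAbove)) σ ∧
      ∃ t : ℝ, 0 < t ∧ ∑ k, tupleVec a (j.succAbove k) - t • tupleVec a j ∈ σ := by
  set y : RealSpace F := ∑ k, tupleVec a (j.succAbove k)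
  have y_pos (σ) : 0 < y σ := by
    change 0 < (∑ k, tupleVec a (j.succAbove k)) σ
    rw [Finset.sum_apply]
    exact Finset.sum_pos (fun k _ => tupleVec_pos a _ σ) Finset.univ_nonempty
  have tendsto : Tendsto (fun t : ℝ => y - t • tupleVec a j) (𝓝[>] 0) (𝓝 y) := by
    refine (Continuous.tendsto' (by fun_prop) 0 y ?_).mono_left nhdsWithin_le_nhds
    rw [zero_smul, sub_zero]
  obtain ⟨t, ⟨σ, hσ, hyσ, hpσ⟩, t_pos⟩ :=
    ((tendsto.eventually (hΦ.eventually_exists_mem hΓ y_pos)).and self_mem_nhdsWithin).exists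
  have facet_mem := hΦ.face_mem _ ha.1 _ (facet_isFace ha.2 j)
  have facet_subset : tupleCone (a ∘ j.succAbove) ⊆ σ :=
    hΦ.toIsSimplicialFan.tupleCone_subset facet_mem hσ hyσ
  have vertex_mem : tupleVec a j ∈ Submodule.span ℝ σ := by
    rw [← Submodule.smul_mem_iff _ (ne_of_gt t_pos), ← sub_sub_cancel y (t • tupleVec a j)]
    exact sub_mem (Submodule.subset_span hyσ) (Submodule.subset_span hpσ)
  refine ⟨σ, hσ, coneDim_eq_of_mem_span τ ha.2 fun i => ?_, ?_, t, t_pos, hpσ⟩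
  · rcases Fin.eq_self_or_eq_succAbove j i with rfl | ⟨k, rfl⟩
    · exact vertex_mem
    · exact Submodule.subset_span
        (facet_subset (mem_vectorCone_self (tupleVec (a ∘ j.succAbove)) k))
  · simpa only [Set.inter_eq_left.2 facet_subset] using (hΦ.inter_isFace _ facet_mem σ hσ).2

lemma IsTopTuple.exists_flip {n : ℕ} (hΦ : IsShintaniDecomposition Γ Φ)
    (hΓ : Γ ≤ totallyPositiveUnits F) (hgen : HasGeneratorsIn ξ Φ)
    (τ : Fin (n + 2) ≃ (F →+* ℝ)) {a : Fin (n + 2) → PrimitiveSet ξ}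
    (ha : IsTopTuple Φ a) (j : Fin (n + 2)) :
    ∃ a' : Fin (n + 2) → PrimitiveSet ξ, IsTopTuple Φ a' ∧ (∀ k, k ≠ j → a' k = a k) ∧
      tupleSign τ a' = - tupleSign τ a := by
  obtain ⟨σ, hσ, dim_eq, facet_isFace, t, t_pos, p_mem⟩ := ha.exists_cone_across hΦ hΓ τ j
  obtain ⟨c, rfl⟩ := hgen.exists_tuple hσ dim_eq
  have facet_indep : LinearIndependent ℝ (tupleVec (a ∘ j.succAbove)) :=
    ha.2.comp _ Fin.succAbove_right_injective
  obtain ⟨ρ, hρ⟩ := exists_perm_comp_eqOn (s := {k | k ≠ j})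
    (injective_of_linearIndependent ha.2).injOn fun k hk => by
      obtain ⟨k, rfl⟩ := Fin.exists_succAbove_eq hk
      exact mem_range_of_isFace facet_indep facet_isFace k
  refine ⟨c ∘ ρ, IsTopTuple.comp_perm ⟨hσ, linearIndependent_of_coneDim dim_eq⟩ ρ,
    fun k hk => hρ hk, ?_⟩
  obtain ⟨x, x_nonneg, hx⟩ := (vectorCone_comp_equiv (tupleVec c) ρ).ge p_mem
  have p_eq : ∑ k, tupleVec a (j.succAbove k) - t • tupleVec a j =
      ∑ i, (if i = j then -t else 1) • tupleVec a i := by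
    simp [Fin.sum_univ_succAbove _ j, Fin.succAbove_ne, sub_eq_neg_add]
  have sign_eq := sign_mul_tupleSign_eq τ (a := c ∘ ρ) (fun k hk => hρ hk) (hx.symm.trans p_eq)
  rw [if_pos rfl, Left.sign_neg, sign_pos t_pos] at sign_eq
  have x_pos : 0 < x j := (x_nonneg j).lt_of_ne fun h0 => by
    have sign_mul_self := tupleSign_mul_self τ ha.2
    rw [← h0, sign_zero, SignType.coe_zero, zero_mul, SignType.coe_neg, neg_mul, eq_comm,
      neg_eq_zero, SignType.coe_one, one_mul] at sign_eq
    simp [sign_eq] at sign_mul_self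
  simpa [sign_pos x_pos] using sign_eq

end Facets

section OrbitSums

variable {F : Type} [Field F] {ξ : AddChar (𝓞 F) ℂ}

lemma isOfFinOrder_of_smul_eq_comp {G ι α : Type*} [Group G] [MulAction G α] [IsCancelSMul G α]
    [Finite ι] [Nonempty ι] {u : G} {a : ι → α} {ρ : Equiv.Perm ι} (h : u • a = a ∘ ρ) :
    IsOfFinOrder u := by
  have pow_smul_eq (k : ℕ) : u ^ k • a = a ∘ ⇑(ρ ^ k) := by
    induction k with
    | zero => simp
    | succ k ih => rw [pow_succ', mul_smul, ih, ← Pi.smul_comp, h, pow_succ']; rfl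
  have pow_smul_eq_self := pow_smul_eq (orderOf ρ)
  rw [pow_orderOf_eq_one] at pow_smul_eq_self
  obtain ⟨i⟩ := ‹Nonempty ι›
  exact isOfFinOrder_iff_pow_eq_one.2
    ⟨_, orderOf_pos ρ, IsCancelSMul.eq_one_of_smul (congrFun pow_smul_eq_self i)⟩

variable (ξ) in
/-- Ordered generators in `A_ξ` of the full-dimensional cones of `Φ`. -/
abbrev TopTuple (Φ : Set (Set (RealSpace F))) (m : ℕ) : Type :=
  {a : Fin m → PrimitiveSet ξ // IsTopTuple Φ a}

/-- The relation of lying in the same orbit of `Δ_ξ`. It is pulled back from the set of all tuples,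
because `Δ_ξ` acts on `TopTuple ξ Φ m` only when `Φ` is stable under it. -/
instance topTupleSetoid (Φ : Set (Set (RealSpace F))) (m : ℕ) : Setoid (TopTuple ξ Φ m) :=
  (MulAction.orbitRel (stabilizer ξ) (Fin m → PrimitiveSet ξ)).comap Subtype.val

variable (ξ) in
/-- The orbits of `Δ_ξ` on the ordered generators of the full-dimensional cones of `Φ`. -/
abbrev TopTupleOrbits (Φ : Set (Set (RealSpace F))) (m : ℕ) : Type :=
  Quotient (topTupleSetoid (ξ := ξ) Φ m)

variable {Φ : Set (Set (RealSpace F))} {Γ : Subgroup (𝓞 F)ˣ}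

lemma IsGeneratorSystem.isTopTuple {m : ℕ} {a : ConeOrbits ξ Φ m → Fin m → PrimitiveSet ξ}
    (ha : IsGeneratorSystem ξ Φ m a) (c : ConeOrbits ξ Φ m) : IsTopTuple Φ (a c) := by
  obtain ⟨σ, -, cone_eq⟩ := ha c
  have cone_eq : tupleCone (a c) = σ.1 := cone_eq
  refine ⟨cone_eq ▸ σ.2.1, linearIndependent_of_coneDim ?_⟩
  rw [← tupleCone_eq, cone_eq, σ.2.2]

lemma HasGeneratorsIn.exists_isGeneratorSystem (hgen : HasGeneratorsIn ξ Φ) (m : ℕ) :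
    ∃ a, IsGeneratorSystem ξ Φ m a := by
  choose a ha using fun c : ConeOrbits ξ Φ m => hgen.exists_tuple c.out.2.1 c.out.2.2
  exact ⟨a, fun c => ⟨c.out, Quotient.out_eq c, ha c⟩⟩

lemma IsGeneratorSystem.eq_of_unitScale_eq {m : ℕ}
    {a : ConeOrbits ξ Φ m → Fin m → PrimitiveSet ξ} (ha : IsGeneratorSystem ξ Φ m a)
    {c c' : ConeOrbits ξ Φ m} (u : stabilizer ξ)
    (h : unitScale (u : (𝓞 F)ˣ) (tupleCone (a c)) = tupleCone (a c')) : c = c' := by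
  obtain ⟨σ, hσ, cone_eq⟩ := ha c
  obtain ⟨σ', hσ', cone_eq'⟩ := ha c'
  rw [← hσ, ← hσ']
  exact Quotient.sound ⟨u, u.2, by rw [← cone_eq, ← cone_eq']; exact h⟩

/-- The signed value `sgn a • f a` of an invariant cochain on an orbit of tuples. -/
def signedValue {K : Type} [Field K] {m : ℕ} (τ : Fin m ≃ (F →+* ℝ))
    (f : (Fin m → PrimitiveSet ξ) → K) (q : TopTupleOrbits ξ Φ m) : K :=
  tupleSign τ q.out.1 • f q.out.1

lemma signedValue_mk {K : Type} [Field K] {m : ℕ} (τ : Fin m ≃ (F →+* ℝ))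
    {f : (Fin m → PrimitiveSet ξ) → K} (hf : ∀ (u : stabilizer ξ) a, f (u • a) = f a)
    (a : TopTuple ξ Φ m) : signedValue τ f ⟦a⟧ = tupleSign τ a.1 • f a.1 := by
  obtain ⟨u, hu⟩ : ∃ u : stabilizer ξ, u • a.1 = (⟦a⟧ : TopTupleOrbits ξ Φ m).out.1 :=
    Quotient.mk_out a
  rw [signedValue, ← hu, tupleSign_smul, hf]

variable [NumberField F] [IsTotallyReal F]

lemma IsGeneratorSystem.exists_smul_eq_comp {m : ℕ}
    {a : ConeOrbits ξ Φ m → Fin m → PrimitiveSet ξ} (ha : IsGeneratorSystem ξ Φ m a)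
    {b : Fin m → PrimitiveSet ξ} (hb : IsTopTuple Φ b) :
    ∃ (c : ConeOrbits ξ Φ m) (u : stabilizer ξ) (ρ : Equiv.Perm (Fin m)), u • b = a c ∘ ρ := by
  let σ : ConesOfDim Φ m := ⟨tupleCone b, hb.1, coneDim_vectorCone hb.2⟩
  obtain ⟨σ', hσ', cone_eq⟩ := ha (Quotient.mk _ σ)
  obtain ⟨u, hu, scale_eq⟩ := Quotient.exact hσ'.symm
  have smul_cone_eq :
      tupleCone ((⟨u, hu⟩ : stabilizer ξ) • b) = tupleCone (a (Quotient.mk _ σ)) := by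
    rw [← unitScale_tupleCone]
    exact scale_eq.trans cone_eq.symm
  obtain ⟨ρ, hρ⟩ := exists_perm_of_tupleCone_eq (linearIndependent_smul _ hb.2) smul_cone_eq
  exact ⟨_, _, ρ, hρ⟩

lemma IsGeneratorSystem.eq_of_smul_comp_eq {m : ℕ}
    {a : ConeOrbits ξ Φ (m + 1) → Fin (m + 1) → PrimitiveSet ξ}
    (ha : IsGeneratorSystem ξ Φ (m + 1) a) {c c' : ConeOrbits ξ Φ (m + 1)} {u : stabilizer ξ}
    {ρ ρ' : Equiv.Perm (Fin (m + 1))} (h : u • (a c ∘ ρ) = a c' ∘ ρ') : c = c' ∧ ρ = ρ' := by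
  obtain ⟨τ⟩ := nonempty_realEmbeddings F
  have := isCancelSMul_primitiveSet ξ τ
  have same_class : c = c' := ha.eq_of_unitScale_eq u <|
    calc unitScale (u : (𝓞 F)ˣ) (tupleCone (a c))
      _ = unitScale (u : (𝓞 F)ˣ) (tupleCone (a c ∘ ρ)) :=
        congrArg _ (vectorCone_comp_equiv (tupleVec (a c)) ρ).symm
      _ = tupleCone (u • (a c ∘ ρ)) := unitScale_tupleCone u _
      _ = tupleCone (a c' ∘ ρ') := congrArg tupleCone h
      _ = tupleCone (a c') := vectorCone_comp_equiv (tupleVec (a c')) ρ'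
  subst same_class
  obtain ⟨k, k_pos, pow_eq_one⟩ := isOfFinOrder_iff_pow_eq_one.1 <|
    isOfFinOrder_of_smul_eq_comp (a := a c) (ρ := ρ⁻¹.trans ρ')
      (funext fun i => by simpa using congrFun h (ρ⁻¹ i))
  have u_eq_one : u = 1 := Subtype.ext
    (eq_one_of_pow_eq_one τ (u.2.1 τ) k_pos.ne' (congrArg Subtype.val pow_eq_one))
  rw [u_eq_one, one_smul] at h
  exact ⟨rfl, Equiv.ext fun i =>
    injective_of_linearIndependent (ha.isTopTuple c).2 (congrFun h i)⟩

lemma IsGeneratorSystem.bijective_mk_comp_perm {m : ℕ}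
    {a : ConeOrbits ξ Φ (m + 1) → Fin (m + 1) → PrimitiveSet ξ}
    (ha : IsGeneratorSystem ξ Φ (m + 1) a) :
    Function.Bijective fun x : ConeOrbits ξ Φ (m + 1) × Equiv.Perm (Fin (m + 1)) =>
      (⟦⟨a x.1 ∘ x.2, (ha.isTopTuple x.1).comp_perm x.2⟩⟧ : TopTupleOrbits ξ Φ (m + 1)) := by
  constructor
  · rintro ⟨c, ρ⟩ ⟨c', ρ'⟩ h
    obtain ⟨u, hu⟩ := Quotient.exact h
    obtain ⟨rfl, rfl⟩ := ha.eq_of_smul_comp_eq hu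
    rfl
  · intro q
    obtain ⟨⟨b, hb⟩, rfl⟩ := Quotient.exists_rep q
    obtain ⟨c, u, ρ, h⟩ := ha.exists_smul_eq_comp hb
    exact ⟨(c, ρ), Quotient.sound ⟨u, h⟩⟩

lemma finite_topTupleOrbits {m : ℕ} (hgen : HasGeneratorsIn ξ Φ)
    [Finite (ConeOrbits ξ Φ (m + 1))] : Finite (TopTupleOrbits ξ Φ (m + 1)) := by
  obtain ⟨a, ha⟩ := hgen.exists_isGeneratorSystem (m + 1)
  exact Finite.of_surjective _ ha.bijective_mk_comp_perm.2

variable {K : Type} [Field K]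

lemma sum_signedValue {m : ℕ} (τ : Fin (m + 1) ≃ (F →+* ℝ)) [Fintype (ConeOrbits ξ Φ (m + 1))]
    [Fintype (TopTupleOrbits ξ Φ (m + 1))]
    {a : ConeOrbits ξ Φ (m + 1) → Fin (m + 1) → PrimitiveSet ξ}
    (ha : IsGeneratorSystem ξ Φ (m + 1) a)
    {f : (Fin (m + 1) → PrimitiveSet ξ) → K} (hf : f ∈ altCochains K (PrimitiveSet ξ) m)
    (hinv : ∀ (u : stabilizer ξ) a, f (u • a) = f a) :
    ∑ q : TopTupleOrbits ξ Φ (m + 1), signedValue τ f q =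
      ((m + 1).factorial : K) * ∑ c, tupleSign τ (a c) • f (a c) := by
  rw [← ha.bijective_mk_comp_perm.sum_comp, Fintype.sum_prod_type, Finset.mul_sum]
  refine Finset.sum_congr rfl fun c _ => ?_
  have value_eq (ρ : Equiv.Perm (Fin (m + 1))) :
      signedValue τ f ⟦⟨a c ∘ ρ, (ha.isTopTuple c).comp_perm ρ⟩⟧ =
        tupleSign τ (a c) • f (a c) := by
    rw [signedValue_mk τ hinv, tupleSign_comp_perm, hf.1 ρ, zsmul_eq_mul, zsmul_eq_mul]
    rcases Int.units_eq_one_or (Equiv.Perm.sign ρ) with h | h <;> rw [h] <;> push_cast <;> ring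
  simp only [value_eq, Finset.sum_const, Finset.card_univ, Fintype.card_perm, Fintype.card_fin,
    nsmul_eq_mul]

lemma exists_flip_involution {n : ℕ} (hΦ : IsShintaniDecomposition Γ Φ) (hξΓ : stabilizer ξ ≤ Γ)
    (hΓ : Γ ≤ totallyPositiveUnits F) (hgen : HasGeneratorsIn ξ Φ)
    (τ : Fin (n + 2) ≃ (F →+* ℝ)) (j : Fin (n + 2)) :
    ∃ φ : TopTupleOrbits ξ Φ (n + 2) → TopTupleOrbits ξ Φ (n + 2), Function.Involutive φ ∧
      ∀ q, ∃ a a' : TopTuple ξ Φ (n + 2), ⟦a⟧ = q ∧ ⟦a'⟧ = φ q ∧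
        a'.1 ∘ j.succAbove = a.1 ∘ j.succAbove ∧ tupleSign τ a'.1 = - tupleSign τ a.1 := by
  choose flip flip_top flip_eq flip_sign using fun a : TopTuple ξ Φ (n + 2) =>
    a.2.exists_flip hΦ hΓ hgen τ j
  let flipTop (a : TopTuple ξ Φ (n + 2)) : TopTuple ξ Φ (n + 2) := ⟨flip a, flip_top a⟩
  have flip_flip (a) : flipTop (flipTop a) = a := Subtype.ext <|
    (flip_top (flipTop a)).eq_of_eqOn hΦ τ a.2 j
      (fun k hk => ((flip_eq (flipTop a) k hk).trans (flip_eq a k hk)).symm)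
      (by rw [flip_sign, flip_sign, neg_neg])
  have flip_equivariant (a b : TopTuple ξ Φ (n + 2)) : a ≈ b → flipTop a ≈ flipTop b := by
    rintro ⟨u, hu : u • b.1 = a.1⟩
    refine ⟨u, (IsTopTuple.smul hΦ hξΓ (flip_top b) u).eq_of_eqOn hΦ τ (flip_top a) j
      (fun k hk => ?_) ?_⟩
    · change flip a k = (u • flip b) k
      rw [flip_eq a k hk, ← hu, Pi.smul_apply, Pi.smul_apply, flip_eq b k hk]
    · rw [tupleSign_smul, flip_sign, flip_sign, ← hu, tupleSign_smul]
  refine ⟨Quotient.map flipTop flip_equivariant, fun q => ?_, fun q => ?_⟩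
  · obtain ⟨a, rfl⟩ := Quotient.exists_rep q
    rw [Quotient.map_mk, Quotient.map_mk, flip_flip]
  · obtain ⟨a, rfl⟩ := Quotient.exists_rep q
    exact ⟨a, flipTop a, rfl, rfl, funext fun k => flip_eq a _ (Fin.succAbove_ne j k), flip_sign a⟩

lemma sum_signedValue_comp_succAbove [CharZero K] {n : ℕ} (hΦ : IsShintaniDecomposition Γ Φ)
    (hξΓ : stabilizer ξ ≤ Γ) (hΓ : Γ ≤ totallyPositiveUnits F) (hgen : HasGeneratorsIn ξ Φ)
    (τ : Fin (n + 2) ≃ (F →+* ℝ)) [Fintype (TopTupleOrbits ξ Φ (n + 2))]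
    {θ : (Fin (n + 1) → PrimitiveSet ξ) → K} (hinv : ∀ (u : stabilizer ξ) a, θ (u • a) = θ a)
    (j : Fin (n + 2)) :
    ∑ q : TopTupleOrbits ξ Φ (n + 2), signedValue τ (fun a => θ (a ∘ j.succAbove)) q = 0 := by
  obtain ⟨φ, hφ, φ_flips⟩ := exists_flip_involution hΦ hξΓ hΓ hgen τ j
  have hinv' (u : stabilizer ξ) (a : Fin (n + 2) → PrimitiveSet ξ) :
      θ ((u • a) ∘ j.succAbove) = θ (a ∘ j.succAbove) := hinv u (a ∘ j.succAbove)
  have cancel (q) : signedValue (Φ := Φ) τ (fun a => θ (a ∘ j.succAbove)) q +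
      signedValue τ (fun a => θ (a ∘ j.succAbove)) (φ q) = 0 := by
    obtain ⟨a, a', rfl, flip_eq, facet_eq, sign_eq⟩ := φ_flips q
    rw [← flip_eq, signedValue_mk τ hinv', signedValue_mk τ hinv', facet_eq, sign_eq, neg_smul,
      add_neg_cancel]
  refine Finset.sum_involution (fun q _ => φ q) (fun q _ => cancel q) (fun q _ hq h => hq ?_)
    (fun _ _ => Finset.mem_univ _) fun q _ => hφ q
  have cancel_self := cancel q
  rw [h] at cancel_self
  exact self_eq_neg.1 (eq_neg_of_add_eq_zero_left cancel_self)

lemma sum_signedValue_altDiff [CharZero K] {n : ℕ} (hΦ : IsShintaniDecomposition Γ Φ)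
    (hξΓ : stabilizer ξ ≤ Γ) (hΓ : Γ ≤ totallyPositiveUnits F) (hgen : HasGeneratorsIn ξ Φ)
    (τ : Fin (n + 2) ≃ (F →+* ℝ)) [Fintype (TopTupleOrbits ξ Φ (n + 2))]
    {θ : (Fin (n + 1) → PrimitiveSet ξ) → K} (hinv : ∀ (u : stabilizer ξ) a, θ (u • a) = θ a) :
    ∑ q : TopTupleOrbits ξ Φ (n + 2), signedValue τ (altDiff θ) q = 0 := by
  have expand (q : TopTupleOrbits ξ Φ (n + 2)) : signedValue τ (altDiff θ) q =
      ∑ j : Fin (n + 2), (-1) ^ (j : ℕ) * signedValue τ (fun a => θ (a ∘ j.succAbove)) q := by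
    simp only [signedValue, altDiff, zsmul_eq_mul, Finset.mul_sum]
    exact Finset.sum_congr rfl fun j _ => by ring
  simp only [expand]
  rw [Finset.sum_comm]
  refine Finset.sum_eq_zero fun j _ => ?_
  rw [← Finset.mul_sum, sum_signedValue_comp_succAbove hΦ hξΓ hΓ hgen τ hinv j, mul_zero]

end OrbitSums

section ConeCocycle

variable {ι : Type*}

/-- The point of the line `x + ℝ D` whose `j`-th coordinate vanishes. It is meaningful only when
`D j ≠ 0`; otherwise it is `x`. -/
def crossing (x D : ι → ℝ) (j : ι) : ι → ℝ := x - (x j / D j) • D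

lemma crossing_apply (x D : ι → ℝ) (j k : ι) : crossing x D j k = x k - x j / D j * D k :=
  rfl

lemma crossing_neg (x D : ι → ℝ) (j : ι) : crossing x (-D) j = crossing x D j := by
  simp only [crossing, Pi.neg_apply, div_neg, smul_neg, neg_smul, neg_neg]

lemma crossing_self (x : ι → ℝ) {D : ι → ℝ} {j : ι} (hj : D j ≠ 0) : crossing x D j j = 0 := by
  rw [crossing_apply, div_mul_cancel₀ _ hj, sub_self]

lemma eq_of_crossing_nonneg {x D : ι → ℝ}
    (hgen : ∀ j k, D j ≠ 0 → j ≠ k → crossing x D j k ≠ 0) {j k : ι} (hj : 0 < D j)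
    (hk : 0 < D k) (hxj : 0 ≤ crossing x D j) (hxk : 0 ≤ crossing x D k) : j = k := by
  by_contra hne
  have le_left : 0 ≤ x k - x j / D j * D k := hxj k
  have le_right : 0 ≤ x j - x k / D k * D j := hxk j
  rw [sub_nonneg, ← le_div_iff₀ hk] at le_left
  rw [sub_nonneg, ← le_div_iff₀ hj] at le_right
  refine hgen j k hj.ne' hne ?_
  rw [crossing_apply, le_antisymm le_left le_right, div_mul_cancel₀ _ hk.ne', sub_self]

/-- The line leaves the orthant where `x k / D k` is largest among the `k` with `D k < 0`. -/
lemma exists_crossing_nonneg [Finite ι] {x D : ι → ℝ} (hneg : ∃ k, D k < 0) {j : ι}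
    (h : 0 ≤ crossing x D j) : ∃ k, D k < 0 ∧ 0 ≤ crossing x D k := by
  obtain ⟨k, hk, k_max⟩ := Set.exists_max_image {k | D k < 0} (fun k => x k / D k)
    (Set.toFinite _) hneg
  have le_of_crossing : x k / D k ≤ x j / D j := by
    have := h k
    rwa [crossing_apply, Pi.zero_apply, sub_nonneg, ← div_le_iff_of_neg hk] at this
  refine ⟨k, hk, fun l => ?_⟩
  have hl : 0 ≤ x l - x j / D j * D l := h l
  rw [Pi.zero_apply, crossing_apply, sub_nonneg]
  rcases lt_or_ge (D l) 0 with l_neg | l_nonneg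
  · exact (div_le_iff_of_neg l_neg).1 (k_max l l_neg)
  · exact (mul_le_mul_of_nonneg_right le_of_crossing l_nonneg).trans (sub_nonneg.1 hl)

/-- A line enters and leaves the positive orthant once each, if at all. -/
lemma sum_sign_mul_indicator_crossing [Fintype ι] {x D : ι → ℝ} (hpos : ∃ j, 0 < D j)
    (hneg : ∃ j, D j < 0) (hgen : ∀ j k, D j ≠ 0 → j ≠ k → crossing x D j k ≠ 0) :
    ∑ j, (SignType.sign (D j) : ℤ) * {j | 0 ≤ crossing x D j}.indicator 1 j = 0 := by
  classical
  let entering : Finset ι := {j | 0 < D j ∧ 0 ≤ crossing x D j}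
  let leaving : Finset ι := {j | D j < 0 ∧ 0 ≤ crossing x D j}
  have entering_card : entering.card ≤ 1 := Finset.card_le_one.2 fun j hj k hk => by
    simp only [entering, Finset.mem_filter_univ] at hj hk
    exact eq_of_crossing_nonneg hgen hj.1 hk.1 hj.2 hk.2
  have leaving_card : leaving.card ≤ 1 := Finset.card_le_one.2 fun j hj k hk => by
    simp only [leaving, Finset.mem_filter_univ, ← crossing_neg x D, ← Left.neg_pos_iff] at hj hk
    refine eq_of_crossing_nonneg (D := -D) (fun j k hj => ?_) hj.1 hk.1 hj.2 hk.2
    rw [crossing_neg]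
    exact hgen j k (neg_ne_zero.1 hj)
  have nonempty_iff : entering.Nonempty ↔ leaving.Nonempty := by
    simp only [entering, leaving, Finset.filter_nonempty_iff, Finset.mem_univ, true_and]
    constructor
    · rintro ⟨j, -, hj⟩
      exact exists_crossing_nonneg hneg hj
    · rintro ⟨j, -, hj⟩
      simpa only [crossing_neg, Pi.neg_apply, Left.neg_neg_iff] using
        exists_crossing_nonneg (D := -D) (by simpa using hpos) (crossing_neg x D j ▸ hj)
  have card_eq : entering.card = leaving.card := by
    rw [← Finset.card_pos, ← Finset.card_pos] at nonempty_iff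
    lia
  have summand_eq (j : ι) : (SignType.sign (D j) : ℤ) * {j | 0 ≤ crossing x D j}.indicator 1 j =
      (if 0 < D j ∧ 0 ≤ crossing x D j then 1 else 0) -
        if D j < 0 ∧ 0 ≤ crossing x D j then 1 else 0 := by
    rcases lt_trichotomy (D j) 0 with h | h | h <;> by_cases hx : 0 ≤ crossing x D j <;>
      simp [h, hx, h.not_gt, Set.indicator]
  simp only [summand_eq, Finset.sum_sub_distrib, Finset.sum_boole]
  exact sub_eq_zero.2 (congrArg Nat.cast card_eq)

lemma exists_pos_and_neg_of_sum_mul_eq_zero [Fintype ι] {D w : ι → ℝ} (hw : ∀ j, 0 < w j)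
    (h : ∑ j, D j * w j = 0) (hD : ∃ j, D j ≠ 0) : (∃ j, 0 < D j) ∧ ∃ j, D j < 0 := by
  obtain ⟨j, hj⟩ := hD
  have term_ne_zero : ∃ k ∈ Finset.univ, D k * w k ≠ 0 :=
    ⟨j, Finset.mem_univ j, mul_ne_zero hj (hw j).ne'⟩
  obtain ⟨k, -, hk⟩ := Finset.exists_pos_of_sum_zero_of_exists_nonzero _ h term_ne_zero
  obtain ⟨l, -, hl⟩ := Finset.exists_pos_of_sum_zero_of_exists_nonzero (fun j => -(D j * w j))
    (by rw [Finset.sum_neg_distrib, h, neg_zero]) (by simpa only [neg_ne_zero] using term_ne_zero)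
  exact ⟨⟨k, (pos_iff_pos_of_mul_pos hk).2 (hw k)⟩,
    ⟨l, neg_of_mul_neg_left (neg_pos.1 hl) (hw l).le⟩⟩

lemma sum_crossing_smul [Fintype ι] {E : Type*} [AddCommGroup E] [Module ℝ E] (x : ι → ℝ)
    {D : ι → ℝ} {v : ι → E} (hD : ∑ k, D k • v k = 0) (j : ι) :
    ∑ k, crossing x D j k • v k = ∑ k, x k • v k := by
  simp only [crossing_apply, sub_smul, Finset.sum_sub_distrib, mul_smul, ← Finset.smul_sum, hD,
    smul_zero, sub_zero]

lemma crossing_ne_zero [Fintype ι] {E : Type*} [AddCommGroup E] [Module ℝ E] {x D : ι → ℝ}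
    {v : ι → E} (hD : ∑ k, D k • v k = 0) {j k : ι}
    (hy : ∑ k, x k • v k ∉ Submodule.span ℝ (v '' {j, k}ᶜ)) (hj : D j ≠ 0) :
    crossing x D j k ≠ 0 := fun crossing_eq_zero => by
  refine hy (sum_crossing_smul x hD j ▸ Submodule.sum_mem _ fun i _ => ?_)
  rcases eq_or_ne i j with rfl | hij
  · rw [crossing_self x hj, zero_smul]
    exact zero_mem _
  rcases eq_or_ne i k with rfl | hik
  · rw [crossing_eq_zero, zero_smul]
    exact zero_mem _
  · exact Submodule.smul_mem _ _ (Submodule.subset_span ⟨i, by simp [hij, hik], rfl⟩)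

lemma mem_vectorCone_comp_succAbove_iff {E : Type*} [AddCommGroup E] [Module ℝ E] {n : ℕ}
    {v : Fin (n + 1) → E} {x D : Fin (n + 1) → ℝ} (hD : ∑ k, D k • v k = 0) {j : Fin (n + 1)}
    (hj : D j ≠ 0) (hv : LinearIndependent ℝ (v ∘ j.succAbove)) :
    ∑ k, x k • v k ∈ vectorCone (v ∘ j.succAbove) ↔ 0 ≤ crossing x D j := by
  have expand : ∑ k, x k • v k =
      ∑ k, crossing x D j (j.succAbove k) • v (j.succAbove k) := by
    rw [← sum_crossing_smul x hD j, Fin.sum_univ_succAbove _ j, crossing_self x hj, zero_smul,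
      zero_add]
  constructor
  · rintro ⟨z, z_nonneg, hz⟩ k
    have coeff_eq := coeff_eq_of_linearIndependent hv (hz.symm.trans expand)
    rcases Fin.eq_self_or_eq_succAbove j k with rfl | ⟨k, rfl⟩
    · exact (crossing_self x hj).ge
    · exact (z_nonneg k).trans (congrFun coeff_eq k).le
  · exact fun h => ⟨_, fun k => h (j.succAbove k), expand⟩

variable {F : Type} [Field F] {n : ℕ}

/-- The coefficients of Cramer's linear relation between `n + 1` vectors in `ℝⁿ`. -/
def signedMinor (τ : Fin n ≃ (F →+* ℝ)) (v : Fin (n + 1) → RealSpace F) (j : Fin (n + 1)) : ℝ :=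
  (-1) ^ (j : ℕ) * (spaceBasis τ).det (v ∘ j.succAbove)

lemma sign_signedMinor (τ : Fin n ≃ (F →+* ℝ)) (v : Fin (n + 1) → RealSpace F)
    (j : Fin (n + 1)) : (SignType.sign (signedMinor τ v j) : ℤ) =
      (-1) ^ (j : ℕ) * SignType.sign ((spaceBasis τ).det (v ∘ j.succAbove)) := by
  rw [signedMinor, sign_mul, SignType.coe_mul, sign_pow, Left.sign_neg, sign_one, SignType.coe_pow]
  rfl

lemma linearIndependent_of_signedMinor_ne_zero (τ : Fin n ≃ (F →+* ℝ))
    {v : Fin (n + 1) → RealSpace F} {j : Fin (n + 1)} (h : signedMinor τ v j ≠ 0) :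
    LinearIndependent ℝ (v ∘ j.succAbove) :=
  (det_ne_zero_iff τ _).1 (right_ne_zero_of_mul h)

/-- Each coordinate is the Laplace expansion of a determinant with a repeated row. -/
lemma sum_signedMinor_smul (τ : Fin n ≃ (F →+* ℝ)) (v : Fin (n + 1) → RealSpace F) :
    ∑ j, signedMinor τ v j • v j = 0 := by
  funext σ
  let M : Matrix (Fin (n + 1)) (Fin (n + 1)) ℝ :=
    Matrix.of (Fin.cons (fun j => v j σ) fun i j => v j (τ i))
  have M_det : M.det = 0 :=
    Matrix.det_zero_of_row_eq (Fin.succ_ne_zero (τ.symm σ)).symm (by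
      funext j
      simp [M])
  rw [Matrix.det_succ_row_zero] at M_det
  rw [Finset.sum_apply, Pi.zero_apply, ← M_det]
  refine Finset.sum_congr rfl fun j _ => ?_
  have minor_eq : M.submatrix Fin.succ j.succAbove =
      Matrix.of fun i k => (v ∘ j.succAbove) k (τ i) := by
    ext i k
    simp [M]
  rw [signedMinor, spaceBasis_det_apply, Pi.smul_apply, smul_eq_mul, minor_eq]
  simp only [M, Matrix.of_apply, Fin.cons_zero]
  ring

lemma exists_sum_smul_eq_of_signedMinor_ne_zero (τ : Fin n ≃ (F →+* ℝ))
    {v : Fin (n + 1) → RealSpace F} {j : Fin (n + 1)} (h : signedMinor τ v j ≠ 0)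
    (y : RealSpace F) : ∃ x : Fin (n + 1) → ℝ, ∑ k, x k • v k = y := by
  have := finiteDimensional_realSpace τ
  have span_eq_top := (linearIndependent_of_signedMinor_ne_zero τ h).span_eq_top_of_card_eq_finrank'
    (by rw [finrank_realSpace τ, Fintype.card_fin])
  exact (Submodule.mem_span_range_iff_exists_fun ℝ).1
    (Submodule.span_mono (Set.range_comp_subset_range _ _) (span_eq_top.ge Submodule.mem_top))

/-- The vectors lie in an open half space (the one where the `σ`-th coordinate is positive), and
`y` is in general position with respect to them. -/
lemma sum_sign_mul_indicator_vectorCone (τ : Fin n ≃ (F →+* ℝ)) {v : Fin (n + 1) → RealSpace F}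
    {σ : F →+* ℝ} (hv : ∀ j, 0 < v j σ) {y : RealSpace F}
    (hy : ∀ j k, j ≠ k → y ∉ Submodule.span ℝ (v '' {j, k}ᶜ)) :
    ∑ j : Fin (n + 1), (-1) ^ (j : ℕ) *
      ((SignType.sign ((spaceBasis τ).det (v ∘ j.succAbove)) : ℤ) *
        (vectorCone (v ∘ j.succAbove)).indicator 1 y) = 0 := by
  simp only [← mul_assoc, ← sign_signedMinor]
  by_cases minors_eq_zero : ∀ j, signedMinor τ v j = 0
  · simp [minors_eq_zero]
  push Not at minors_eq_zero
  have relation := sum_signedMinor_smul τ v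
  obtain ⟨hpos, hneg⟩ := exists_pos_and_neg_of_sum_mul_eq_zero hv
    (by simpa using congrFun relation σ) minors_eq_zero
  obtain ⟨j₀, hj₀⟩ := minors_eq_zero
  obtain ⟨x, rfl⟩ := exists_sum_smul_eq_of_signedMinor_ne_zero τ hj₀ y
  rw [← sum_sign_mul_indicator_crossing (x := x) hpos hneg
    fun j k hj hjk => crossing_ne_zero relation (hy j k hjk) hj]
  refine Finset.sum_congr rfl fun j _ => ?_
  by_cases hj : signedMinor τ v j = 0
  · simp [hj]
  · have mem_iff := mem_vectorCone_comp_succAbove_iff (x := x) relation hj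
      (linearIndependent_of_signedMinor_ne_zero τ hj)
    exact congrArg _ (Set.indicator_eq_indicator mem_iff rfl)

end ConeCocycle

section GenericPoint

variable {F : Type} [Field F] {ξ : AddChar (𝓞 F) ℂ}

variable (ξ) in
/-- A totally positive point outside all subspaces spanned by at most `n` elements of `A_ξ`. It is
used with `n + 1` the dimension of `ℝ^I`, so that these are proper subspaces. -/
def IsGeneric (n : ℕ) (x : RealSpace F) : Prop :=
  (∀ τ, 0 < x τ) ∧
    ∀ m ≤ n, ∀ b : Fin m → PrimitiveSet ξ, x ∉ Submodule.span ℝ (Set.range (tupleVec b))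

namespace IsGeneric

variable {n : ℕ} {x : RealSpace F}

lemma map_unitMul (hx : IsGeneric ξ n x) (u : stabilizer ξ) :
    IsGeneric ξ n (unitMul (u : (𝓞 F)ˣ) x) := by
  refine ⟨fun τ => mul_pos (u.2.1 τ) (hx.1 τ), fun m hm b hb => hx.2 m hm (u⁻¹ • b) ?_⟩
  rw [tupleVec_smul, Set.range_comp, ← Submodule.map_span]
  exact ⟨_, hb, unitMul_inv_cancel _ x⟩

lemma coeff_pos (hx : IsGeneric ξ n x) {a : Fin (n + 1) → PrimitiveSet ξ} {z : Fin (n + 1) → ℝ}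
    (hz : ∀ i, 0 ≤ z i) (h : x = ∑ i, z i • tupleVec a i) (i : Fin (n + 1)) : 0 < z i := by
  refine (hz i).lt_of_ne fun zi_eq_zero => hx.2 n le_rfl (a ∘ i.succAbove) ?_
  rw [h, Fin.sum_univ_succAbove _ i, ← zi_eq_zero, zero_smul, zero_add]
  exact Submodule.sum_mem _ fun k _ => Submodule.smul_mem _ _ (Submodule.subset_span ⟨k, rfl⟩)

lemma mem_intrinsicInterior (τ : Fin (n + 1) ≃ (F →+* ℝ)) (hx : IsGeneric ξ n x)
    {a : Fin (n + 1) → PrimitiveSet ξ} (ha : LinearIndependent ℝ (tupleVec a))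
    (h : x ∈ tupleCone a) : x ∈ intrinsicInterior ℝ (tupleCone a) := by
  have := finiteDimensional_realSpace τ
  obtain ⟨z, z_nonneg, rfl⟩ := h
  exact interior_subset_intrinsicInterior (mem_interior_vectorCone ha
    (by rw [finrank_realSpace τ, Fintype.card_fin]) (hx.coeff_pos z_nonneg rfl))

lemma notMem_span_image_compl (hx : IsGeneric ξ n x) (a : Fin (n + 2) → PrimitiveSet ξ)
    {j k : Fin (n + 2)} (hjk : j ≠ k) : x ∉ Submodule.span ℝ (tupleVec a '' {j, k}ᶜ) := by
  intro x_mem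
  obtain ⟨k, rfl⟩ := Fin.exists_succAbove_eq hjk.symm
  refine hx.2 n le_rfl (a ∘ j.succAbove ∘ k.succAbove) (Submodule.span_mono ?_ x_mem)
  rintro _ ⟨i, hi, rfl⟩
  simp only [Set.mem_compl_iff, Set.mem_insert_iff, Set.mem_singleton_iff, not_or] at hi
  obtain ⟨i, rfl⟩ := Fin.exists_succAbove_eq hi.1
  obtain ⟨i, rfl⟩ := Fin.exists_succAbove_eq (ne_of_apply_ne j.succAbove hi.2)
  exact ⟨i, rfl⟩

end IsGeneric

variable [NumberField F]

lemma countable_primitiveSet : Countable (PrimitiveSet ξ) := by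
  have : Countable (𝓞 F) := (RingOfIntegers.basis F).equivFun.toEquiv.countable_iff.2 inferInstance
  exact Subtype.countable

variable (ξ) in
/-- The positive orthant is not covered by countably many null sets. -/
lemma exists_isGeneric {n : ℕ} (τ : Fin (n + 1) ≃ (F →+* ℝ)) : ∃ x, IsGeneric ξ n x := by
  by_contra! not_generic
  have := countable_primitiveSet (ξ := ξ)
  have := finiteDimensional_realSpace τ
  have orthant_pos : 0 < MeasureTheory.volume {x : RealSpace F | ∀ σ, 0 < x σ} := by
    refine IsOpen.measure_pos _ ?_ ⟨fun _ => 1, fun _ => zero_lt_one⟩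
    simp only [Set.ofPred_forall]
    exact isOpen_iInter_of_finite fun σ => isOpen_lt continuous_const (continuous_apply σ)
  have union_null : MeasureTheory.volume (⋃ b : Σ m : Fin (n + 1), Fin m → PrimitiveSet ξ,
      (Submodule.span ℝ (Set.range (tupleVec b.2)) : Set (RealSpace F))) = 0 := by
    refine MeasureTheory.measure_iUnion_null fun b => ?_
    refine MeasureTheory.Measure.addHaar_submodule _ _ fun span_eq_top => ?_
    have finrank_le := finrank_range_le_card (R := ℝ) (tupleVec b.2)
    rw [Set.finrank, span_eq_top, finrank_top, finrank_realSpace τ, Fintype.card_fin] at finrank_le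
    exact finrank_le.not_gt b.1.2
  refine orthant_pos.ne' (MeasureTheory.measure_mono_null (fun x hx => ?_) union_null)
  have x_not_generic := not_generic x
  simp only [IsGeneric, not_and, not_forall, not_not] at x_not_generic
  obtain ⟨m, hm, b, hb⟩ := x_not_generic hx
  exact Set.mem_iUnion.2 ⟨⟨⟨m, Nat.lt_succ_of_le hm⟩, b⟩, hb⟩

end GenericPoint

section PointCocycle

variable {F : Type} [Field F] {ξ : AddChar (𝓞 F) ℂ}

/-- The indicator of `u x ∈ σ_a`, as a function of the unit `u`. -/
def orbitIndicator (x : RealSpace F) {n : ℕ} (a : Fin n → PrimitiveSet ξ) (u : stabilizer ξ) : ℤ :=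
  (tupleCone a).indicator 1 (unitMul (u : (𝓞 F)ˣ) x)

/-- The number of points of the `Δ_ξ`-orbit of `x` in `σ_a`, with the sign of `a`. For a totally
positive `x` the number is finite, so the `finsum` is not a junk value. -/
def pointCocycle {n : ℕ} (τ : Fin n ≃ (F →+* ℝ)) (x : RealSpace F) (a : Fin n → PrimitiveSet ξ) :
    ℤ :=
  tupleSign τ a * ∑ᶠ u, orbitIndicator x a u

lemma unitMul_mem_tupleCone_smul {n : ℕ} (u v : stabilizer ξ) (a : Fin n → PrimitiveSet ξ)
    (x : RealSpace F) : unitMul ((v * u : stabilizer ξ) : (𝓞 F)ˣ) x ∈ tupleCone (v • a) ↔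
      unitMul (u : (𝓞 F)ˣ) x ∈ tupleCone a := by
  rw [← unitScale_tupleCone, unitScale_eq_image, Subgroup.coe_mul, unitMul_mul]
  exact (unitMul_injective _).mem_set_image

lemma pointCocycle_smul {n : ℕ} (τ : Fin n ≃ (F →+* ℝ)) (x : RealSpace F) (u : stabilizer ξ)
    (a : Fin n → PrimitiveSet ξ) : pointCocycle τ x (u • a) = pointCocycle τ x a := by
  rw [pointCocycle, pointCocycle, tupleSign_smul, ← finsum_comp_equiv (Equiv.mulLeft u)]
  exact congrArg _ (finsum_congr fun v =>
    Set.indicator_eq_indicator (unitMul_mem_tupleCone_smul v u a x) rfl)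

lemma pointCocycle_comp_perm {n : ℕ} (τ : Fin n ≃ (F →+* ℝ)) (x : RealSpace F)
    (a : Fin n → PrimitiveSet ξ) (ρ : Equiv.Perm (Fin n)) :
    pointCocycle τ x (a ∘ ρ) = Equiv.Perm.sign ρ * pointCocycle τ x a := by
  have cone_eq : tupleCone (a ∘ ρ) = tupleCone a := vectorCone_comp_equiv (tupleVec a) ρ
  rw [pointCocycle, pointCocycle, tupleSign_comp_perm, mul_assoc]
  simp only [orbitIndicator, cone_eq]

lemma pointCocycle_eq_zero {n : ℕ} (τ : Fin n ≃ (F →+* ℝ)) (x : RealSpace F)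
    {a : Fin n → PrimitiveSet ξ} (ha : ¬ Function.Injective a) : pointCocycle τ x a = 0 := by
  have det_eq_zero : (spaceBasis τ).det (tupleVec a) = 0 := by
    by_contra det_ne_zero
    exact ha (injective_of_linearIndependent ((det_ne_zero_iff τ _).1 det_ne_zero))
  rw [pointCocycle, tupleSign_eq, det_eq_zero, sign_zero, SignType.coe_zero, zero_mul]

variable {Φ : Set (Set (RealSpace F))} {Γ : Subgroup (𝓞 F)ˣ}

lemma IsGeneric.exists_isTopTuple {n : ℕ} (τ : Fin (n + 1) ≃ (F →+* ℝ)) {x : RealSpace F}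
    (hx : IsGeneric ξ n x) (hΦ : IsShintaniDecomposition Γ Φ) (hgen : HasGeneratorsIn ξ Φ) :
    ∃ b : Fin (n + 1) → PrimitiveSet ξ, IsTopTuple Φ b ∧ x ∈ tupleCone b := by
  have := finiteDimensional_realSpace τ
  obtain ⟨σ, hσ, x_mem⟩ := hΦ.exists_mem hx.1
  have x_mem := intrinsicInterior_subset x_mem
  have coneDim_le : coneDim σ ≤ n + 1 := (Submodule.finrank_le _).trans (finrank_realSpace τ).le
  have coneDim_eq : coneDim σ = n + 1 := coneDim_le.eq_of_not_lt fun h => by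
    obtain ⟨b, cone_eq⟩ := hgen.exists_tuple hσ rfl
    refine hx.2 _ (Nat.le_of_lt_succ h) b ?_
    rw [← span_vectorCone, ← tupleCone_eq, cone_eq]
    exact Submodule.subset_span x_mem
  obtain ⟨b, rfl⟩ := hgen.exists_tuple hσ coneDim_eq
  exact ⟨b, ⟨hσ, linearIndependent_of_coneDim coneDim_eq⟩, x_mem⟩

variable [NumberField F]

lemma nonempty_primitiveSet {n : ℕ} (τ : Fin (n + 1) ≃ (F →+* ℝ))
    (hΦ : IsShintaniDecomposition Γ Φ) (hgen : HasGeneratorsIn ξ Φ) :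
    Nonempty (PrimitiveSet ξ) := by
  obtain ⟨x, hx⟩ := exists_isGeneric ξ τ
  obtain ⟨b, -, -⟩ := hx.exists_isTopTuple τ hΦ hgen
  exact ⟨b 0⟩

variable [IsTotallyReal F]

lemma finite_support_orbitIndicator {x : RealSpace F} (hx : ∀ τ, 0 < x τ) {n : ℕ}
    (a : Fin n → PrimitiveSet ξ) : (Function.support (orbitIndicator x a)).Finite := by
  have := nonempty_realEmbeddings F
  obtain ⟨σ₀, hσ₀⟩ := Finite.exists_min x
  obtain ⟨σ₁, hσ₁⟩ := Finite.exists_max x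
  have finite_units := finite_units_meeting (b := fun i => (a i).1) (fun i => (a i).2.1.1)
    (lo := x σ₀) (hi := x σ₁) (hx σ₀)
  refine Set.Finite.of_finite_image (f := fun u : stabilizer ξ => ((u⁻¹ : stabilizer ξ) : (𝓞 F)ˣ))
    (finite_units.subset ?_) (Subtype.val_injective.comp inv_injective).injOn
  rintro _ ⟨u, hu, rfl⟩
  refine ⟨u⁻¹.2.1, _, Set.mem_of_indicator_ne_zero hu, fun σ => ?_⟩
  have inv_mul_eq : σ (((u⁻¹ : stabilizer ξ) : (𝓞 F)ˣ) : F) * unitMul (u : (𝓞 F)ˣ) x σ = x σ :=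
    congrFun (unitMul_inv_cancel (u : (𝓞 F)ˣ) x) σ
  rw [inv_mul_eq]
  exact ⟨hσ₀ σ, hσ₁ σ⟩

lemma sum_pointCocycle_comp_succAbove {n : ℕ} (τ : Fin (n + 1) ≃ (F →+* ℝ)) {x : RealSpace F}
    (hx : IsGeneric ξ n x) (a : Fin (n + 2) → PrimitiveSet ξ) :
    ∑ j : Fin (n + 2), (-1) ^ (j : ℕ) * pointCocycle τ x (a ∘ j.succAbove) = 0 := by
  simp only [pointCocycle, mul_finsum]
  rw [← finsum_sum_comm]
  · exact finsum_eq_zero_of_forall_eq_zero fun u =>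
      sum_sign_mul_indicator_vectorCone τ (fun j => tupleVec_pos a j (τ 0)) fun j k hjk =>
        (hx.map_unitMul u).notMem_span_image_compl a hjk
  · intro j _
    exact (finite_support_orbitIndicator hx.1 (a ∘ j.succAbove)).subset
      ((Function.support_mul_subset_right _ _).trans (Function.support_mul_subset_right _ _))

lemma IsGeneric.eq_of_mem_tupleCone {n : ℕ} (τ : Fin (n + 1) ≃ (F →+* ℝ)) {x : RealSpace F}
    (hx : IsGeneric ξ n x) (hΦ : IsShintaniDecomposition Γ Φ) (hξΓ : stabilizer ξ ≤ Γ)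
    {a : ConeOrbits ξ Φ (n + 1) → Fin (n + 1) → PrimitiveSet ξ}
    (ha : IsGeneratorSystem ξ Φ (n + 1) a) {c c' : ConeOrbits ξ Φ (n + 1)} {u u' : stabilizer ξ}
    (h : unitMul (u : (𝓞 F)ˣ) x ∈ tupleCone (a c))
    (h' : unitMul (u' : (𝓞 F)ˣ) x ∈ tupleCone (a c')) : c = c' ∧ u = u' := by
  have := isCancelSMul_primitiveSet ξ (τ 0)
  obtain ⟨w, rfl⟩ : ∃ w, u' = w * u := ⟨u' * u⁻¹, by group⟩
  have smul_top := IsTopTuple.smul hΦ hξΓ (ha.isTopTuple c) w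
  have cone_eq : tupleCone (w • a c) = tupleCone (a c') :=
    hΦ.disjoint_interior.elim_set smul_top.1 (ha.isTopTuple c').1 _
      ((hx.map_unitMul _).mem_intrinsicInterior τ smul_top.2
        ((unitMul_mem_tupleCone_smul u w (a c) x).2 h))
      ((hx.map_unitMul _).mem_intrinsicInterior τ (ha.isTopTuple c').2 h')
  obtain ⟨ρ, smul_eq⟩ := exists_perm_of_tupleCone_eq smul_top.2 cone_eq
  obtain ⟨rfl, rfl⟩ := ha.eq_of_smul_comp_eq (ρ := 1) smul_eq
  have w_eq_one : w = 1 := IsCancelSMul.eq_one_of_smul (x := a c 0) (congrFun smul_eq 0)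
  exact ⟨rfl, by rw [w_eq_one, one_mul]⟩

lemma IsGeneric.sum_pointCocycle_eq_one {n : ℕ} (τ : Fin (n + 1) ≃ (F →+* ℝ)) {x : RealSpace F}
    (hx : IsGeneric ξ n x) (hΦ : IsShintaniDecomposition Γ Φ) (hξΓ : stabilizer ξ ≤ Γ)
    (hgen : HasGeneratorsIn ξ Φ) [Fintype (ConeOrbits ξ Φ (n + 1))]
    {a : ConeOrbits ξ Φ (n + 1) → Fin (n + 1) → PrimitiveSet ξ}
    (ha : IsGeneratorSystem ξ Φ (n + 1) a) :
    ∑ c, tupleSign τ (a c) * pointCocycle τ x (a c) = 1 := by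
  obtain ⟨b, b_top, x_mem⟩ := hx.exists_isTopTuple τ hΦ hgen
  obtain ⟨c₀, u₀, ρ, smul_eq⟩ := ha.exists_smul_eq_comp b_top
  have mem₀ : unitMul (u₀ : (𝓞 F)ˣ) x ∈ tupleCone (a c₀) := by
    rw [tupleCone_eq, ← vectorCone_comp_equiv (tupleVec (a c₀)) ρ]
    refine (congrArg tupleCone smul_eq).le ?_
    rw [← unitScale_tupleCone]
    exact ⟨x, x_mem, rfl⟩
  have value_eq (c) : tupleSign τ (a c) * pointCocycle τ x (a c) =
      ∑ᶠ u, orbitIndicator x (a c) u := by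
    rw [pointCocycle, ← mul_assoc, tupleSign_mul_self τ (ha.isTopTuple c).2, one_mul]
  simp only [value_eq]
  rw [Fintype.sum_eq_single c₀, finsum_eq_single _ u₀]
  · exact Set.indicator_of_mem mem₀ 1
  · exact fun u hu => Set.indicator_of_notMem
      (fun mem => hu (hx.eq_of_mem_tupleCone τ hΦ hξΓ ha mem mem₀).2) 1
  · exact fun c hc => finsum_eq_zero_of_forall_eq_zero fun u => Set.indicator_of_notMem
      (fun mem => hc (hx.eq_of_mem_tupleCone τ hΦ hξΓ ha mem mem₀).1) 1

end PointCocycle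

section RankOne

variable {K V W : Type*} [Field K] [AddCommGroup V] [Module K V] [AddCommGroup W] [Module K W]

lemma exists_linearEquiv_of_rank_le_one {π : V →ₗ[K] W} (rank_le : Module.rank K W ≤ 1)
    {x : V} (hx : π x ≠ 0) :
    ∃ e : W ≃ₗ[K] K, ∀ f : V →ₗ[K] K, LinearMap.ker π ≤ LinearMap.ker f → f x = 1 →
      ∀ z, e (π z) = f z := by
  have rank_eq_one : Module.rank K W = 1 := rank_le.antisymm <|
    Cardinal.one_le_iff_pos.2 (rank_pos_iff_exists_ne_zero.2 ⟨π x, hx⟩)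
  have smul_surjective : ∀ y : W, ∃ k : K, k • π x = y :=
    (finrank_eq_one_iff_of_nonzero' _ hx).1 (Module.rank_eq_one_iff_finrank_eq_one.1 rank_eq_one)
  refine ⟨(LinearEquiv.ofBijective (LinearMap.toSpanSingleton K W (π x))
    ⟨smul_left_injective K hx, smul_surjective⟩).symm, fun f ker_le hfx z => ?_⟩
  obtain ⟨k, hk⟩ := smul_surjective (π z)
  have f_eq : f z = k := by
    have sub_mem : z - k • x ∈ LinearMap.ker f := ker_le (by simp [hk])
    simpa [hfx, sub_eq_zero] using sub_mem
  rw [LinearEquiv.symm_apply_eq, f_eq]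
  exact hk.symm

end RankOne

section OrbitSumFunctional

variable {F : Type} [Field F] {ξ : AddChar (𝓞 F) ℂ}
variable {Φ : Set (Set (RealSpace F))} {Γ : Subgroup (𝓞 F)ˣ} {n : ℕ} (τ : Fin (n + 1) ≃ (F →+* ℝ))

lemma orbitSum_eq_sum [Fintype (ConeOrbits ξ Φ (n + 1))]
    (a : ConeOrbits ξ Φ (n + 1) → Fin (n + 1) → PrimitiveSet ξ) (z : (CechComplex ξ).cycles n) :
    orbitSum ξ Φ τ a z = ∑ c, tupleSign τ (a c) • cocycleFun z (a c) :=
  finsum_eq_sum_of_fintype _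

/-- The map `η ↦ ∑ sgn(a) η_a` on cocycles, as a linear map. -/
def orbitSumLinear [Finite (ConeOrbits ξ Φ (n + 1))]
    (a : ConeOrbits ξ Φ (n + 1) → Fin (n + 1) → PrimitiveSet ξ) :
    (CechComplex ξ).cycles n →ₗ[valueField ξ] valueField ξ where
  toFun := orbitSum ξ Φ τ a
  map_add' z w := by
    have := Fintype.ofFinite (ConeOrbits ξ Φ (n + 1))
    simp only [orbitSum_eq_sum, map_add, Pi.add_apply, smul_add, Finset.sum_add_distrib]
  map_smul' k z := by
    have := Fintype.ofFinite (ConeOrbits ξ Φ (n + 1))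
    simp only [orbitSum_eq_sum, map_smul, Pi.smul_apply, smul_comm _ k, Finset.smul_sum,
      RingHom.id_apply]

variable [NumberField F] [IsTotallyReal F]

lemma orbitSum_eq_zero (hΦ : IsShintaniDecomposition Γ Φ) (hξΓ : stabilizer ξ ≤ Γ)
    (hΓ : Γ ≤ totallyPositiveUnits F) (hgen : HasGeneratorsIn ξ Φ)
    [Finite (ConeOrbits ξ Φ (n + 1))] {a : ConeOrbits ξ Φ (n + 1) → Fin (n + 1) → PrimitiveSet ξ}
    (ha : IsGeneratorSystem ξ Φ (n + 1) a) {z : (CechComplex ξ).cycles n}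
    (hz : (CechComplex ξ).homologyπ n z = 0) : orbitSum ξ Φ τ a z = 0 := by
  have := Fintype.ofFinite (ConeOrbits ξ Φ (n + 1))
  rw [orbitSum_eq_sum]
  cases n with
  | zero => simp only [cocycleFun_eq_zero hz, Pi.zero_apply, smul_zero, Finset.sum_const_zero]
  | succ n =>
    obtain ⟨θ, -, hinv, coboundary_eq⟩ := exists_cocycleFun_eq_altDiff hz
    have := finite_topTupleOrbits hgen (m := n + 1)
    have := Fintype.ofFinite (TopTupleOrbits ξ Φ (n + 2))
    have factorial_mul_sum := sum_signedValue τ ha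
      (cochainFun_mem ((CechComplex ξ).iCycles (n + 1) z)) (cochainFun_smul _)
    have sum_eq_zero := sum_signedValue_altDiff hΦ hξΓ hΓ hgen τ hinv
    rw [← coboundary_eq] at sum_eq_zero
    exact (mul_eq_zero.1 (factorial_mul_sum.symm.trans sum_eq_zero)).resolve_left
      (Nat.cast_ne_zero.2 (Nat.factorial_ne_zero _))

variable (ξ) in
lemma exists_cocycle_orbitSum_eq_one :
    ∃ z : (CechComplex ξ).cycles n, ∀ (Γ : Subgroup (𝓞 F)ˣ) (Φ : Set (Set (RealSpace F))),
      stabilizer ξ ≤ Γ → IsShintaniDecomposition Γ Φ → HasGeneratorsIn ξ Φ →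
      Finite (ConeOrbits ξ Φ (n + 1)) → ∀ a, IsGeneratorSystem ξ Φ (n + 1) a →
      orbitSum ξ Φ τ a z = 1 := by
  obtain ⟨x, hx⟩ := exists_isGeneric ξ τ
  have closed : altDiff (fun a : Fin (n + 1) → PrimitiveSet ξ =>
      (pointCocycle τ x a : valueField ξ)) = 0 := by
    funext a
    simpa [altDiff] using congrArg (Int.cast (R := valueField ξ))
      (sum_pointCocycle_comp_succAbove τ hx a)
  obtain ⟨z, hz⟩ := exists_cocycleFun_eq (G := stabilizer ξ)
    ⟨fun ρ a => by simp only [pointCocycle_comp_perm, Int.cast_mul],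
      fun a ha => by simp only [pointCocycle_eq_zero τ x ha, Int.cast_zero]⟩
    (fun u a => by rw [pointCocycle_smul]) closed
  refine ⟨z, fun Γ Φ hξΓ hΦ hgen _ a ha => ?_⟩
  have := Fintype.ofFinite (ConeOrbits ξ Φ (n + 1))
  rw [orbitSum_eq_sum, hz]
  simp only [zsmul_eq_mul]
  exact_mod_cast congrArg (Int.cast (R := valueField ξ))
    (hx.sum_pointCocycle_eq_one τ hΦ hξΓ hgen ha)

lemma exists_homology_linearEquiv (hn : Module.finrank ℚ F = n + 1) (hξ : IsOfFinOrder ξ)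
    (hΦ : IsShintaniDecomposition Γ Φ) (hξΓ : stabilizer ξ ≤ Γ) (hΓ : Γ ≤ totallyPositiveUnits F)
    (hgen : HasGeneratorsIn ξ Φ) :
    ∃ e : (CechComplex ξ).homology n ≃ₗ[valueField ξ] valueField ξ,
      ∀ (Γ' : Subgroup (𝓞 F)ˣ) (Φ' : Set (Set (RealSpace F))), stabilizer ξ ≤ Γ' →
        Γ' ≤ totallyPositiveUnits F → IsShintaniDecomposition Γ' Φ' → HasGeneratorsIn ξ Φ' →
        ∀ z a, IsGeneratorSystem ξ Φ' (n + 1) a →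
          e ((CechComplex ξ).homologyπ n z) = orbitSum ξ Φ' τ a z := by
  obtain ⟨s⟩ := nonempty_primitiveSet τ hΦ hgen
  obtain ⟨a, ha⟩ := hgen.exists_isGeneratorSystem (n + 1)
  obtain ⟨z₁, orbitSum_eq_one⟩ := exists_cocycle_orbitSum_eq_one ξ τ
  have := finite_coneOrbits hξ hΓ hΦ (n + 1)
  have class_ne_zero : (CechComplex ξ).homologyπ n z₁ ≠ 0 := fun class_eq_zero => zero_ne_one <|
    (orbitSum_eq_zero τ hΦ hξΓ hΓ hgen ha class_eq_zero).symm.trans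
      (orbitSum_eq_one Γ Φ hξΓ hΦ hgen inferInstance a ha)
  obtain ⟨e, he⟩ := exists_linearEquiv_of_rank_le_one (π := ((CechComplex ξ).homologyπ n).hom)
    (rank_homology_cechComplex_le_one ξ (τ 0) s hn) class_ne_zero
  refine ⟨e, fun Γ' Φ' hξΓ' hΓ' hΦ' hgen' z a' ha' => ?_⟩
  have := finite_coneOrbits hξ hΓ' hΦ' (n + 1)
  exact he (orbitSumLinear τ a')
    (fun _ class_eq_zero => orbitSum_eq_zero τ hΦ' hξΓ' hΓ' hgen' ha' class_eq_zero)
    (orbitSum_eq_one Γ' Φ' hξΓ' hΦ' hgen' inferInstance a' ha') z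

end OrbitSumFunctional

end

end ShintaniEcc

theorem proposition5p5 (F : Type) [Field F] [NumberField F] [NumberField.IsTotallyReal F]
    (n : ℕ) (hn : Module.finrank ℚ F = n + 1) (τ : Fin (n + 1) ≃ (F →+* ℝ))
    (ξ : AddChar (𝓞 F) ℂ) (htors : IsOfFinOrder ξ) (hξ : ξ ≠ 1)
    (Γ : Subgroup (𝓞 F)ˣ) (hΓ : stabilizer ξ ≤ Γ) (hΓ' : Γ ≤ totallyPositiveUnits F)
    (Φ : Set (Set (RealSpace F))) (hΦ : IsShintaniDecomposition Γ Φ)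
    (hgen : HasGeneratorsIn ξ Φ) :
    Finite (ConeOrbits ξ Φ (n + 1)) ∧
    ∃ κ : (CechComplex ξ).homology n ≅ PointCohomology ξ n,
      (∀ f, IsCechComparison (valueField ξ) (stabilizer ξ) (PrimitiveSet ξ) n f ↔ f = κ.hom) ∧
      ∃ e : PointCohomology ξ n ≃ₗ[valueField ξ] valueField ξ,
        (∀ e' : PointCohomology ξ n →ₗ[valueField ξ] valueField ξ,
          (∀ z a, IsGeneratorSystem ξ Φ (n + 1) a →
            e' (κ.hom ((CechComplex ξ).homologyπ n z)) = orbitSum ξ Φ τ a z) ↔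
          e' = e.toLinearMap) ∧
        ∀ (Γ' : Subgroup (𝓞 F)ˣ) (Φ' : Set (Set (RealSpace F))), stabilizer ξ ≤ Γ' →
          Γ' ≤ totallyPositiveUnits F → IsShintaniDecomposition Γ' Φ' → HasGeneratorsIn ξ Φ' →
          ∀ z a, IsGeneratorSystem ξ Φ' (n + 1) a →
            e (κ.hom ((CechComplex ξ).homologyπ n z)) = orbitSum ξ Φ' τ a z := by
  have hfin := finite_coneOrbits htors hΓ' hΦ (n + 1)
  have := isCancelSMul_primitiveSet ξ (τ 0)
  obtain ⟨s⟩ := nonempty_primitiveSet τ hΦ hgen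
  obtain ⟨a, ha⟩ := hgen.exists_isGeneratorSystem (n + 1)
  obtain ⟨κ, hκ⟩ := exists_cechComparison_iso (valueField ξ) (stabilizer ξ) s n
  obtain ⟨e, he⟩ := exists_homology_linearEquiv τ hn htors hΦ hΓ hΓ' hgen
  let eκ : PointCohomology ξ n ≃ₗ[valueField ξ] valueField ξ := κ.toLinearEquiv.symm ≪≫ₗ e
  have eκ_class (z) : eκ (κ.hom ((CechComplex ξ).homologyπ n z)) =
      e ((CechComplex ξ).homologyπ n z) := congrArg e (κ.toLinearEquiv.symm_apply_apply _)
  refine ⟨hfin, κ, hκ, eκ, fun e' => ⟨fun he' => LinearMap.ext fun y => ?_, ?_⟩, ?_⟩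
  · obtain ⟨z, rfl⟩ := (κ.toLinearEquiv.surjective.comp (homologyπ_surjective _ n)) y
    exact (he' z a ha).trans ((eκ_class z).trans (he Γ Φ hΓ hΓ' hΦ hgen z a ha)).symm
  · rintro rfl z a ha
    exact (eκ_class z).trans (he Γ Φ hΓ hΓ' hΦ hgen z a ha)
  · intro Γ' Φ' hξΓ' hΓ₁ hΦ' hgen' z a ha
    exact (eκ_class z).trans (he Γ' Φ' hξΓ' hΓ₁ hΦ' hgen' z a ha)
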